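/- Work over $\mathbb{C}$. A Puiseux series is a series $S=\sum_{i>0}c_ix^{i/N}$; its polydromy order $\nu(S)$ is the least common denominator of its exponents, $[S]_{\le l}$ denotes the sum of its terms of exponent $\le l$, and $S$ is called modified if its order in $x$ is not an integer. $S$ is a $y$-root of $f\in\mathbb{C}[[x,y]]$ if $f(x,S)=0$. Let $Z=(f=0)$ be an irreducible germ of plane curve at the origin $O$, $f\in\mathbb{C}[[x,y]]$, not tangent to the $y$-axis, and let $S$ be a modified Puiseux series that is a $y$-root of $f$. Let $(n;m_1,\dots,m_g)$, $g\ge 1$, be its characteristic sequence: $n=\nu(S)$, and with $m_0=0$, $d_0=n$, $d_i=\gcd(n,m_1,\dots,m_i)$, the number $m_i/n$ is the smallest exponent of $S$ whose numerator over $n$ is not divisible by $d_{i-1}$, and $d_g=1$. For $1\le i\le g$ let $h_{i,0},h_{i,1},\dots,h_{i,k_i}$ be the successive quotients of the Euclidean algorithm applied to $m_i-m_{i-1}$ and $d_{i-1}$ (so $m_i-m_{i-1}=h_{i,0}d_{i-1}+r_{i,1}$ with $0<r_{i,1}<d_{i-1}$), and put $\gamma_0=0$, $\gamma_i=\gamma_{i-1}+\sum_{j=0}^{k_i}h_{i,j}$.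 Let $q_1=O,q_2,\dots,q_k$ be the centres of the blow-ups in the standard resolution of $Z$, i.e. the composition of the smallest number of point blow-ups after which the pull-back of $Z$ has normal crossing support. Let $P$ be the proximity matrix ($P_{a,a}=1$, $P_{a,b}=-1$ if $q_a$ lies on the exceptional divisor of the blow-up of $q_b$ or on its strict transform, and $P_{a,b}=0$ otherwise), let $X_a$ be the $a$-th row of $P^{-1}$, and for nonzero $G\in\mathbb{C}[[x,y]]$ let $\mathrm{ord}(G)$ be the vector of multiplicities at $q_1,\dots,q_k$ of the strict transforms of the curve $G=0$. Then there are polynomials $H_{i,j}\in\mathbb{C}[x,y]$, indexed by the pairs $(i,j)$ with either $1\le i\le g-1$ and $0\le j\le h_{i+1,0}$, or $(i,j)=(g,0)$, such that, with $H_i=\sum_{j=0}^{h_{i+1,0}}H_{i,j}$ for $1\le i\le g-1$ and $$F_{i,j}=\Big(\big((y^{n/d_1}+H_1)^{d_1/d_2}+H_2\big)^{d_2/d_3}+\cdots+H_{i-1}\Big)^{d_{i-1}/d_i}+H_{i,0}+H_{i,1}+\cdots+H_{i,j},$$ the following hold for every such pair $(i,j)$. 1. $F_{i,j}$ is irreducible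 in $\mathbb{C}[[x,y]]$ and has a $y$-root $S_i$ (depending on $j$) with $[S_i]_{\le (m_i+jd_i)/n}=[S]_{\le (m_i+jd_i)/n}$ and polydromy order $\nu(S_i)=n/d_i$. 2. $H_{i,j}$ is a (finite) $\mathbb{C}$-linear combination of terms $T=x^\alpha y^\beta F_1^{\delta_1}\cdots F_{i-1}^{\delta_{i-1}}$ with $\alpha,\beta,\delta_1,\dots,\delta_{i-1}\ge 0$ integers and $F_l:=F_{l,h_{l+1,0}}$, each of which satisfies $$\mathrm{ord}(T)\cdot X_{\gamma_l}\ \ge\ X_{\gamma_i+j}\cdot X_{\gamma_l}\qquad\text{for all }1\le l\le g.$$ For any family $H_{i,j}$ with these properties, $\{F_1,\dots,F_{g-1}\}$ is called a set of standard factors of $S$; in particular sets of standard factors exist. -/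

import Mathlib

noncomputable section

namespace PlaneBranch

/-! ## Puiseux series -/

/-- A Puiseux series: a series in rational powers of `x` with a common denominator of the exponents
and with strictly positive order.  Series in rational powers of `x` are modelled by Hahn series
with exponents in `ℚ`. -/
def IsPuiseux (S : HahnSeries ℚ ℂ) : Prop :=
  ∃ n : ℕ, 0 < n ∧ ∀ q : ℚ, S.coeff q ≠ 0 → ∃ i : ℕ, 0 < i ∧ q = (i : ℚ) / n

/-- The polydromy order `ν(S)`: the least common denominator of the exponents of `S`, i.e. the least
`n ≥ 1` such that `S` is a series in `x^{1/n}`. -/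
def polydromy (S : HahnSeries ℚ ℂ) : ℕ :=
  sInf {n : ℕ | 0 < n ∧ ∀ q : ℚ, S.coeff q ≠ 0 → ∃ i : ℤ, q = (i : ℚ) / n}

/-- The partial sum `[S]_{≤ l}`. -/
def partialSum (S : HahnSeries ℚ ℂ) (l : ℚ) : HahnSeries ℚ ℂ where
  coeff q := if q ≤ l then S.coeff q else 0
  isPWO_support' := by
    refine S.isPWO_support.mono ?_
    intro q hq
    simp only [Function.mem_support, ne_eq, ite_eq_right_iff, Classical.not_imp] at hq
    exact hq.2

/-- A Puiseux series is modified if its order in `x` is not an integer. -/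
def IsModified (S : HahnSeries ℚ ℂ) : Prop :=
  ∀ z : ℤ, S.orderTop ≠ ((z : ℚ) : WithTop ℚ)

/-- For `S = ∑ c_i x^{i/N}`, the power series `∑ c_i t^i` in `t = x^{1/N}`. -/
def uniformized (S : HahnSeries ℚ ℂ) (N : ℕ) : PowerSeries ℂ :=
  PowerSeries.mk fun i => S.coeff ((i : ℚ) / N)

/-- The Puiseux series `S` is a `y`-root of `f ∈ ℂ⟦x, y⟧`: `f(x, S(x)) = 0`, written as an identity
of power series in `t = x^{1/ν(S)}`.  The variables `x`, `y` are `X 0`, `X 1`. -/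
def IsYRoot (f : MvPowerSeries (Fin 2) ℂ) (S : HahnSeries ℚ ℂ) : Prop :=
  IsPuiseux S ∧
    MvPowerSeries.subst
      (![PowerSeries.X ^ polydromy S, uniformized S (polydromy S)] :
        Fin 2 → MvPowerSeries Unit ℂ) f = 0

/-! ## The characteristic sequence and the Euclidean algorithms -/

/-- `d_0 = n`, `d_i = gcd(n, m_1, …, m_i)`. -/
def dgcd (n : ℕ) (m : ℕ → ℕ) : ℕ → ℕ
  | 0 => n
  | i + 1 => Nat.gcd (dgcd n m i) (m (i + 1))

/-- `(n; m_1, …, m_g)` is the characteristic sequence of the Puiseux series `S`, whose exponents are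
all at least `1` (the branch is not tangent to the `y`-axis) and not all integers.  By convention
`m_0 = 0`. For `1 ≤ i ≤ g`, `m_i` is the first numerator of an exponent of `S` (written with
denominator `n = ν(S)`) that is not a multiple of `d_{i-1}`, and `d_g = 1`. -/
structure IsCharSeq (S : HahnSeries ℚ ℂ) (n g : ℕ) (m : ℕ → ℕ) : Prop where
  puiseux : IsPuiseux S
  one_le : ∀ q : ℚ, S.coeff q ≠ 0 → 1 ≤ q
  polydromy_eq : polydromy S = n
  pos : 1 ≤ g
  zero : m 0 = 0
  coeff_ne : ∀ i, 1 ≤ i → i ≤ g → S.coeff ((m i : ℚ) / n) ≠ 0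
  not_dvd : ∀ i, 1 ≤ i → i ≤ g → ¬ dgcd n m (i - 1) ∣ m i
  first : ∀ i, 1 ≤ i → i ≤ g → ∀ η : ℕ, η < m i →
    S.coeff ((η : ℚ) / n) ≠ 0 → dgcd n m (i - 1) ∣ η
  last : dgcd n m g = 1

/-- The list of successive quotients in the Euclidean algorithm for `a = q_0 b + r_1`,
`b = q_1 r_1 + r_2`, and so on until the remainder vanishes. -/
def euclidQuotients (a b : ℕ) : List ℕ :=
  if _h : b = 0 then [] else (a / b) :: euclidQuotients b (a % b)
termination_by b
decreasing_by exact Nat.mod_lt _ (Nat.pos_of_ne_zero _h)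

/-- The quotients `h_{i,0}, h_{i,1}, …, h_{i,k_i}` of the `i`-th Euclidean algorithm, which starts
with `m_i - m_{i-1} = h_{i,0} d_{i-1} + r_{i,1}` (recall `m_0 = 0`). -/
def hList (n : ℕ) (m : ℕ → ℕ) (i : ℕ) : List ℕ :=
  euclidQuotients (m i - m (i - 1)) (dgcd n m (i - 1))

/-- The quotient `h_{i,0}`. -/
def hZero (n : ℕ) (m : ℕ → ℕ) (i : ℕ) : ℕ := (hList n m i).headD 0

/-- `γ_0 = 0` and `γ_i = γ_{i-1} + ∑_{j=0}^{k_i} h_{i,j}`. -/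
def gammaIdx (n : ℕ) (m : ℕ → ℕ) : ℕ → ℕ
  | 0 => 0
  | i + 1 => gammaIdx n m i + (hList n m (i + 1)).sum

/-! ## Blow-ups, strict transforms, proximity -/

/-- A point in the first infinitesimal neighbourhood of a point with local coordinates `(x, y)`:
the tangent direction `y = a x`, or the direction of the `y`-axis. -/
inductive Direction : Type
  | slope (a : ℂ) : Direction
  | vertical : Direction

/-- The blow-up in the local coordinates at the new point:
`(x, y) = (u, u (v + a))` at the direction `y = a x`, and `(x, y) = (u v, v)` at the vertical
direction. -/
def blowUpMap : Direction → Fin 2 → MvPowerSeries (Fin 2) ℂ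
  | .slope a => ![MvPowerSeries.X 0, MvPowerSeries.X 0 * (MvPowerSeries.X 1 + MvPowerSeries.C a)]
  | .vertical => ![MvPowerSeries.X 0 * MvPowerSeries.X 1, MvPowerSeries.X 1]

/-- The exceptional divisor of the blow-up is a coordinate axis at the new point. -/
def excVar : Direction → Fin 2
  | .slope _ => 0
  | .vertical => 1

/-- The multiplicity at the origin of the curve `G = 0`. -/
def mult (G : MvPowerSeries (Fin 2) ℂ) : ℕ := G.order.toNat

/-- The local equation, at the point `p` of the first neighbourhood, of the strict transform of the
curve `G = 0`: the pull-back of `G` divided by the `mult G`-th power of the equation of the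
exceptional divisor. -/
def strictTransform (p : Direction) (G : MvPowerSeries (Fin 2) ℂ) : MvPowerSeries (Fin 2) ℂ :=
  fun e => MvPowerSeries.coeff (e + Finsupp.single (excVar p) (mult G))
    (MvPowerSeries.subst (blowUpMap p) G)

/-- A sequence of directions `p 0, p 1, …` encodes a sequence of infinitely near points
`Q_0 = O, Q_1, Q_2, …`: `Q_{j+1}` is the point of direction `p j` in the first neighbourhood of
`Q_j`.  `strictFrom p i l G` is the strict transform at `Q_{i+l}` of the curve with equation `G` at
`Q_i`. -/
def strictFrom (p : ℕ → Direction) (i : ℕ) : ℕ → MvPowerSeries (Fin 2) ℂ → MvPowerSeries (Fin 2) ℂ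
  | 0, G => G
  | l + 1, G => strictTransform (p (i + l)) (strictFrom p i l G)

/-- For `i < j`, the local equation at `Q_j` of (the strict transform of) the exceptional divisor of
the blow-up of `Q_i`. It is a unit if `Q_j` does not lie on this divisor. -/
def excAt (p : ℕ → Direction) (i j : ℕ) : MvPowerSeries (Fin 2) ℂ :=
  strictFrom p (i + 1) (j - (i + 1)) (MvPowerSeries.X (excVar (p i)))

/-- `Q_j` is proximate to `Q_i`. -/
def Proximate (p : ℕ → Direction) (j i : ℕ) : Prop :=
  i < j ∧ MvPowerSeries.constantCoeff (excAt p i j) = 0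

/-- `u, v` are local coordinates at the origin. -/
def IsCoordinates (u v : MvPowerSeries (Fin 2) ℂ) : Prop :=
  MvPowerSeries.constantCoeff u = 0 ∧ MvPowerSeries.constantCoeff v = 0 ∧
    MvPowerSeries.coeff (Finsupp.single 0 1) u * MvPowerSeries.coeff (Finsupp.single 1 1) v -
      MvPowerSeries.coeff (Finsupp.single 1 1) u * MvPowerSeries.coeff (Finsupp.single 0 1) v ≠ 0

/-- The reduced curve `R = 0` has normal crossings at the origin. -/
def IsNormalCrossing (R : MvPowerSeries (Fin 2) ℂ) : Prop :=
  ∃ u v w, IsCoordinates u v ∧ IsUnit w ∧ (R = w ∨ R = w * u ∨ R = w * u * v)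

/-- For a reduced `f`, the reduced local equation at `Q_j` of the support of the pull-back of
`f = 0` under the blow-ups of `Q_0, …, Q_{j-1}`: the strict transform of the curve together with the
exceptional divisors. -/
def supportAt (p : ℕ → Direction) (f : MvPowerSeries (Fin 2) ℂ) (j : ℕ) :
    MvPowerSeries (Fin 2) ℂ :=
  strictFrom p 0 j f * ∏ i ∈ Finset.range j, excAt p i j

/-- For an irreducible germ `f = 0`: the standard (minimal embedded) resolution consists of the
blow-ups of `q_1 = Q_0, …, q_k = Q_{k-1}`.  Each next centre is the point of the strict transform on
the last exceptional divisor, and the process stops at the first stage at which the pull-back of the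
curve has normal crossing support. -/
structure IsStandardResolution (f : MvPowerSeries (Fin 2) ℂ) (k : ℕ) (p : ℕ → Direction) :
    Prop where
  passes : ∀ j ≤ k, MvPowerSeries.constantCoeff (strictFrom p 0 j f) = 0
  not_nc : ∀ j < k, ¬ IsNormalCrossing (supportAt p f j)
  nc : IsNormalCrossing (supportAt p f k)

open Classical in
/-- The proximity matrix of `q_1, …, q_k` (rows and columns are numbered from `0` here, so that
`q_i = Q_{i-1}`). -/
def proximityMatrix (k : ℕ) (p : ℕ → Direction) : Matrix (Fin k) (Fin k) ℤ :=
  Matrix.of fun i j => if i = j then 1 else if Proximate p i j then -1 else 0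

/-- `X_i`, for `1 ≤ i ≤ k`: the `i`-th row (numbered from `1`) of the inverse proximity matrix. -/
def Xrow (k : ℕ) (p : ℕ → Direction) (i : ℕ) : Fin k → ℤ :=
  fun c => if h : 1 ≤ i ∧ i ≤ k then (proximityMatrix k p)⁻¹ ⟨i - 1, by omega⟩ c else 0

/-- `ord(G)`: the multiplicities at `q_1, …, q_k` of the strict transforms of the curve `G = 0`. -/
def ordVec (k : ℕ) (p : ℕ → Direction) (G : MvPowerSeries (Fin 2) ℂ) : Fin k → ℤ :=
  fun c => (mult (strictFrom p 0 c G) : ℤ)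

/-! ## Standard factors -/

/-- `B_0 = y` and `B_i = B_{i-1}^{d_{i-1}/d_i} + H_{i,0} + ⋯ + H_{i,h_{i+1,0}}`; for
`1 ≤ i ≤ g - 1` this is `F_i = F_{i,h_{i+1,0}}`. -/
def standardF (n : ℕ) (m : ℕ → ℕ) (H : ℕ → ℕ → MvPolynomial (Fin 2) ℂ) :
    ℕ → MvPolynomial (Fin 2) ℂ
  | 0 => MvPolynomial.X 1
  | i + 1 => standardF n m H i ^ (dgcd n m i / dgcd n m (i + 1)) +
      ∑ j ∈ Finset.range (hZero n m (i + 2) + 1), H (i + 1) j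

/-- For `i ≥ 1`:
`F_{i,j} = ((y^{n/d_1} + H_1)^{d_1/d_2} + ⋯ + H_{i-1})^{d_{i-1}/d_i} + H_{i,0} + ⋯ + H_{i,j}`. -/
def nestedF (n : ℕ) (m : ℕ → ℕ) (H : ℕ → ℕ → MvPolynomial (Fin 2) ℂ) (i j : ℕ) :
    MvPolynomial (Fin 2) ℂ :=
  standardF n m H (i - 1) ^ (dgcd n m (i - 1) / dgcd n m i) +
    ∑ j' ∈ Finset.range (j + 1), H i j'

/-- The term `x^α y^β F_1^{δ_1} ⋯ F_{i-1}^{δ_{i-1}}`. -/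
def factorTerm (n : ℕ) (m : ℕ → ℕ) (H : ℕ → ℕ → MvPolynomial (Fin 2) ℂ) (i : ℕ)
    (α β : ℕ) (δ : ℕ → ℕ) : MvPolynomial (Fin 2) ℂ :=
  MvPolynomial.X 0 ^ α * MvPolynomial.X 1 ^ β *
    ∏ l ∈ Finset.Icc 1 (i - 1), nestedF n m H l (hZero n m (l + 1)) ^ δ l

/-- The terms allowed in `H_{i,j}`: those with
`ord(x^α y^β F_1^{δ_1} ⋯ F_{i-1}^{δ_{i-1}}) · X_{γ_l} ≥ X_{γ_i + j} · X_{γ_l}` for `1 ≤ l ≤ g`. -/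
def admissibleTerms (n g : ℕ) (m : ℕ → ℕ) (k : ℕ) (p : ℕ → Direction)
    (H : ℕ → ℕ → MvPolynomial (Fin 2) ℂ) (i j : ℕ) : Set (MvPolynomial (Fin 2) ℂ) :=
  {T | ∃ (α β : ℕ) (δ : ℕ → ℕ), T = factorTerm n m H i α β δ ∧
    ∀ l, 1 ≤ l → l ≤ g →
      Xrow k p (gammaIdx n m i + j) ⬝ᵥ Xrow k p (gammaIdx n m l) ≤
        ordVec k p (T : MvPowerSeries (Fin 2) ℂ) ⬝ᵥ Xrow k p (gammaIdx n m l)}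

/-- The index set of the polynomials `H_{i,j}` and `F_{i,j}`: `1 ≤ i ≤ g - 1` and
`0 ≤ j ≤ h_{i+1,0}`, or `i = g` and `j = 0`. -/
def IsIndex (n g : ℕ) (m : ℕ → ℕ) (i j : ℕ) : Prop :=
  (1 ≤ i ∧ i < g ∧ j ≤ hZero n m (i + 1)) ∨ (i = g ∧ j = 0)

/-- The defining properties of the family `H_{i,j}` from which standard factors are built: `F_{i,j}`
is the equation of an irreducible germ which has a `y`-root `T` with
`[T]_{≤ (m_i + j d_i)/n} = [S]_{≤ (m_i + j d_i)/n}` and `ν(T) = n/d_i`, and `H_{i,j}` is a linear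
combination of admissible terms. -/
def IsStandardFamily (S : HahnSeries ℚ ℂ) (n g : ℕ) (m : ℕ → ℕ) (k : ℕ) (p : ℕ → Direction)
    (H : ℕ → ℕ → MvPolynomial (Fin 2) ℂ) : Prop :=
  ∀ i j, IsIndex n g m i j →
    Irreducible (nestedF n m H i j : MvPowerSeries (Fin 2) ℂ) ∧
    (∃ T : HahnSeries ℚ ℂ, IsYRoot (nestedF n m H i j : MvPowerSeries (Fin 2) ℂ) T ∧
      partialSum T (((m i + j * dgcd n m i : ℕ) : ℚ) / n) =
        partialSum S (((m i + j * dgcd n m i : ℕ) : ℚ) / n) ∧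
      polydromy T = n / dgcd n m i) ∧
    H i j ∈ Submodule.span ℂ (admissibleTerms n g m k p H i j)

/-- `F_1, …, F_{g-1}` is a set of standard factors of `S`: `F_i = F_{i,h_{i+1,0}}` for a family
`H_{i,j}` as above. -/
def IsSetOfStandardFactors (S : HahnSeries ℚ ℂ) (n g : ℕ) (m : ℕ → ℕ) (k : ℕ)
    (p : ℕ → Direction) (F : ℕ → MvPolynomial (Fin 2) ℂ) : Prop :=
  ∃ H : ℕ → ℕ → MvPolynomial (Fin 2) ℂ, IsStandardFamily S n g m k p H ∧
    ∀ i, 1 ≤ i → i < g → F i = nestedF n m H i (hZero n m (i + 1))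

end PlaneBranch

end

open PlaneBranch

noncomputable section

namespace PlaneBranch

/-! ### Blow-ups and strict transforms -/

/-! Take for `F_{i,j}` the norm of the partial sum of `S` up to `x^{(m_i + j d_i)/n}`, the product
of `y` minus each of its `n/d_i` conjugates (`normPoly`, `factorPoly`). It is a polynomial in `x,
y`, monic in `y` of degree `n/d_i`. The partial sum is a root. It is irreducible because the
conjugates are distinct and a factor vanishing at one of them vanishes at all
(`irreducible_normPoly`). The `H_{i,j}` are then forced: they are differences of consecutive norms,
starting from `F_{i-1}^{d_{i-1}/d_i}` (`stepPoly`). That `S` is modified gives `F_0 = y`.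

The substance is the admissibility of the terms. `H_{i,j}` has degree less than `n/d_i` in `y`, so
it expands in terms `x^α ∏_{s<i} F_s^{δ_s}` with `δ_s < d_s/d_{s+1}`. Along the branch of `S`
different terms have different orders, so nothing cancels and every term has at least the order of
`H_{i,j}` (`mem_span_expansionTerms`). That order is bounded below by grouping the conjugates
according to their contact with `S` (`le_order_normPoly`, `order_stdPoly`).

The scalar products with rows of `P⁻¹` are intersection numbers. By the proximity equalities, a row
is the multiplicity vector of a branch generic at the corresponding point, divided by its
multiplicity there (`mul_Xrow`); Noether's formula then evaluates `ord(G) · X_a`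
(`mul_ordVec_dotProduct_Xrow`). Genericity is literal: a coefficient is transcendental over `ℂ`. The
curvette at `q_{γ_i+j}` is `S` cut at the order `m_i + j d_i`, with a transcendental coefficient
there (`curvette`). To prove this, contact with `S` is followed through the blow-ups (`Stage`).
Comparing `S` with its conjugates `t ↦ ζ t` gives the orders of the lifted coordinates without
computing any lift (`Stage.coeff_snd`). That `S` passes through the centres rests on Weierstrass
preparation: an irreducible germ has a single tangent, and its strict transform is again irreducible
(`exists_blowStep_of_evalAt_eq_zero`, `irreducible_strictTransform`).

With `A_r = ∑_{s<r} (m_{s+1} - m_s) d_s` (`contactSum`), admissibility becomes a numerical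
comparison between the orders of a term along `S` and along a curvette (`le_mul_order`). -/

lemma constantCoeff_blowUpMap (p : Direction) (i : Fin 2) :
    MvPowerSeries.constantCoeff (blowUpMap p i) = 0 := by
  cases p <;> fin_cases i <;> simp [blowUpMap]

lemma hasSubst_blowUpMap (p : Direction) : MvPowerSeries.HasSubst (blowUpMap p) :=
  MvPowerSeries.hasSubst_of_constantCoeff_zero (constantCoeff_blowUpMap p)

lemma X_dvd_blowUpMap (p : Direction) (i : Fin 2) :
    MvPowerSeries.X (excVar p) ∣ blowUpMap p i := by
  cases p <;> fin_cases i <;> simp [blowUpMap, excVar]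

lemma coe_mult {G : MvPowerSeries (Fin 2) ℂ} (hG : G ≠ 0) : (mult G : ℕ∞) = G.order :=
  MvPowerSeries.ne_zero_iff_order_finite.mp hG

lemma mult_mul {F G : MvPowerSeries (Fin 2) ℂ} (hF : F ≠ 0) (hG : G ≠ 0) :
    mult (F * G) = mult F + mult G := by
  have := MvPowerSeries.order_mul F G
  rw [← coe_mult hF, ← coe_mult hG, ← coe_mult (mul_ne_zero hF hG)] at this
  exact_mod_cast this

lemma mult_eq_zero_of_constantCoeff_ne_zero {G : MvPowerSeries (Fin 2) ℂ}
    (hG : MvPowerSeries.constantCoeff G ≠ 0) : mult G = 0 := by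
  have h0 : G.order = 0 := by
    by_contra h
    exact hG (MvPowerSeries.order_ne_zero_iff_constCoeff_eq_zero.mp h)
  simp [mult, h0]

lemma one_le_mult {G : MvPowerSeries (Fin 2) ℂ} (h0 : G ≠ 0)
    (hG : MvPowerSeries.constantCoeff G = 0) : 1 ≤ mult G := by
  have := MvPowerSeries.one_le_order_iff_constCoeff_eq_zero.mpr hG
  rw [← coe_mult h0] at this
  exact_mod_cast this

lemma coeff_eq_zero_of_degree_lt_mult {G : MvPowerSeries (Fin 2) ℂ} {d : Fin 2 →₀ ℕ}
    (h : d.degree < mult G) : MvPowerSeries.coeff d G = 0 := by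
  by_cases hG : G = 0
  · simp [hG]
  · apply MvPowerSeries.coeff_of_lt_order
    rw [← coe_mult hG]
    exact_mod_cast h

lemma coeff_strictTransform (p : Direction) (G : MvPowerSeries (Fin 2) ℂ) (e : Fin 2 →₀ ℕ) :
    MvPowerSeries.coeff e (strictTransform p G) =
      MvPowerSeries.coeff (e + Finsupp.single (excVar p) (mult G))
        (MvPowerSeries.subst (blowUpMap p) G) := rfl

lemma mvX_ne_zero (i : Fin 2) : (MvPowerSeries.X i : MvPowerSeries (Fin 2) ℂ) ≠ 0 :=
  nonZeroDivisors.ne_zero MvPowerSeries.X_mem_nonzeroDivisors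

lemma coeff_single_X_mul (i : Fin 2) (G : MvPowerSeries (Fin 2) ℂ) :
    MvPowerSeries.coeff (Finsupp.single i 1) (MvPowerSeries.X i * G) =
      MvPowerSeries.constantCoeff G := by
  conv_lhs => rw [← add_zero (Finsupp.single i 1)]
  rw [MvPowerSeries.X, MvPowerSeries.coeff_add_monomial_mul, one_mul,
    MvPowerSeries.coeff_zero_eq_constantCoeff_apply]

/-- Both variables pull back to multiples of the exceptional equation, so a monomial of degree `e`
pulls back to a multiple of its `e`-th power. -/
lemma X_pow_mult_dvd_subst (p : Direction) (G : MvPowerSeries (Fin 2) ℂ) :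
    MvPowerSeries.X (excVar p) ^ mult G ∣ MvPowerSeries.subst (blowUpMap p) G := by
  rw [MvPowerSeries.X_pow_dvd_iff]
  intro e he
  rw [MvPowerSeries.coeff_subst (hasSubst_blowUpMap p)]
  refine finsum_eq_zero_of_forall_eq_zero fun d => ?_
  by_cases hd : d.degree < mult G
  · rw [coeff_eq_zero_of_degree_lt_mult hd, zero_smul]
  · have hdvd : (MvPowerSeries.X (excVar p) : MvPowerSeries (Fin 2) ℂ) ^ d.degree ∣
        d.prod fun s k => blowUpMap p s ^ k := by
      rw [Finsupp.degree_eq_sum, Finsupp.prod_fintype _ _ (by simp), ← Finset.prod_pow_eq_pow_sum]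
      exact Finset.prod_dvd_prod_of_dvd _ _ fun i _ => pow_dvd_pow_of_dvd (X_dvd_blowUpMap p i) _
    rw [MvPowerSeries.X_pow_dvd_iff.mp hdvd e (by omega), smul_zero]

/-- The pull-back under a blow-up is the strict transform times a power of the equation of the
exceptional divisor. -/
lemma subst_blowUpMap_eq (p : Direction) (G : MvPowerSeries (Fin 2) ℂ) :
    MvPowerSeries.subst (blowUpMap p) G =
      MvPowerSeries.X (excVar p) ^ mult G * strictTransform p G := by
  obtain ⟨H, hH⟩ := X_pow_mult_dvd_subst p G
  rw [hH]
  congr 1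
  ext e
  rw [coeff_strictTransform, hH, MvPowerSeries.X_pow_eq, add_comm, MvPowerSeries.coeff_add_monomial_mul, one_mul]

/-- Hadamard's lemma for two variables. -/
lemma exists_eq_C_add_X_mul (G : MvPowerSeries (Fin 2) ℂ) :
    ∃ G₁ G₂ : MvPowerSeries (Fin 2) ℂ, G = MvPowerSeries.C (MvPowerSeries.constantCoeff G) +
      MvPowerSeries.X 0 * G₁ + MvPowerSeries.X 1 * G₂ := by
  let G₀ : MvPowerSeries (Fin 2) ℂ := fun e => if e 0 = 0 then MvPowerSeries.coeff e G else 0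
  have hG₀ (e) : MvPowerSeries.coeff e G₀ = if e 0 = 0 then MvPowerSeries.coeff e G else 0 := rfl
  obtain ⟨G₁, h₁⟩ : MvPowerSeries.X 0 ∣ G - G₀ := by
    rw [MvPowerSeries.X_dvd_iff]
    intro e he
    simp [hG₀, he]
  obtain ⟨G₂, h₂⟩ : MvPowerSeries.X 1 ∣ G₀ - MvPowerSeries.C (MvPowerSeries.constantCoeff G) := by
    rw [MvPowerSeries.X_dvd_iff]
    intro e he
    rw [map_sub, hG₀, MvPowerSeries.coeff_C]
    by_cases h0 : e = 0
    · simp [h0]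
    · have : e 0 ≠ 0 := fun h => h0 (by ext i; fin_cases i <;> simp [h, he])
      simp [h0, this]
  exact ⟨G₁, G₂, by rw [add_assoc, ← h₁, add_comm, ← h₂]; ring⟩

lemma constantCoeff_subst_blowUpMap (p : Direction) (G : MvPowerSeries (Fin 2) ℂ) :
    MvPowerSeries.constantCoeff (MvPowerSeries.subst (blowUpMap p) G) =
      MvPowerSeries.constantCoeff G := by
  obtain ⟨G₁, G₂, h⟩ := exists_eq_C_add_X_mul G
  have hs := hasSubst_blowUpMap p
  conv_lhs => rw [h]
  rw [MvPowerSeries.subst_add hs, MvPowerSeries.subst_add hs, MvPowerSeries.subst_mul hs,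
    MvPowerSeries.subst_mul hs, MvPowerSeries.subst_X hs, MvPowerSeries.subst_X hs,
    MvPowerSeries.subst_C]
  simp [constantCoeff_blowUpMap]

lemma mult_le_one_of_coeff_ne_zero {G : MvPowerSeries (Fin 2) ℂ} (i : Fin 2)
    (h : MvPowerSeries.coeff (Finsupp.single i 1) G ≠ 0) : mult G ≤ 1 := by
  by_contra hlt
  exact h (coeff_eq_zero_of_degree_lt_mult (by simpa using hlt))

/-- The strict transform of a smooth curve is smooth or empty. -/
lemma mult_strictTransform_le_one (p : Direction) {G : MvPowerSeries (Fin 2) ℂ} (hG0 : G ≠ 0)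
    (hG : mult G ≤ 1) : mult (strictTransform p G) ≤ 1 := by
  classical
  have hs := hasSubst_blowUpMap p
  by_cases hc : MvPowerSeries.constantCoeff G = 0
  · have h1 : mult G = 1 := le_antisymm hG (one_le_mult hG0 hc)
    obtain ⟨G₁, G₂, h⟩ := exists_eq_C_add_X_mul G
    rw [hc, map_zero, zero_add] at h
    have hne : MvPowerSeries.constantCoeff G₁ ≠ 0 ∨ MvPowerSeries.constantCoeff G₂ ≠ 0 := by
      by_contra! hcon
      have h2 : 2 ≤ mult G := by
        have : (2 : ℕ∞) ≤ G.order := by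
          rw [h]
          refine le_trans (le_min ?_ ?_) MvPowerSeries.min_order_le_add <;>
          · rw [MvPowerSeries.order_mul]
            refine le_trans (by norm_num : (2 : ℕ∞) ≤ 1 + 1) (add_le_add ?_ ?_) <;>
            · rw [MvPowerSeries.one_le_order_iff_constCoeff_eq_zero]
              simp [hcon.1, hcon.2]
        rw [← coe_mult hG0] at this
        exact_mod_cast this
      omega
    -- Modulo the exceptional variable a pull-back is constant, so it has no linear term in the
    -- other variable.
    have hlin (q : Direction) (H : MvPowerSeries (Fin 2) ℂ) (j : Fin 2) (hj : j ≠ excVar q) :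
        MvPowerSeries.coeff (Finsupp.single j 1) (MvPowerSeries.subst (blowUpMap q) H) = 0 := by
      obtain ⟨H₁, H₂, h⟩ := exists_eq_C_add_X_mul H
      have hs := hasSubst_blowUpMap q
      rw [h, MvPowerSeries.subst_add hs, MvPowerSeries.subst_add hs, MvPowerSeries.subst_mul hs,
        MvPowerSeries.subst_mul hs, MvPowerSeries.subst_X hs, MvPowerSeries.subst_X hs,
        MvPowerSeries.subst_C, add_assoc, map_add, MvPowerSeries.coeff_C]
      rw [if_neg (by simp), zero_add]
      have hdvd := dvd_add
        ((X_dvd_blowUpMap q 0).mul_right (MvPowerSeries.subst (blowUpMap q) H₁))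
        ((X_dvd_blowUpMap q 1).mul_right (MvPowerSeries.subst (blowUpMap q) H₂))
      exact MvPowerSeries.X_dvd_iff.mp hdvd _ (Finsupp.single_eq_of_ne hj.symm)
    have key := subst_blowUpMap_eq p G
    conv_lhs at key => rw [h]
    rw [MvPowerSeries.subst_add hs, MvPowerSeries.subst_mul hs, MvPowerSeries.subst_mul hs,
      MvPowerSeries.subst_X hs, MvPowerSeries.subst_X hs, h1, pow_one] at key
    cases p with
    | slope a =>
      simp only [blowUpMap, excVar, Matrix.cons_val_zero, Matrix.cons_val_one] at key
      rw [mul_assoc (MvPowerSeries.X 0 : MvPowerSeries (Fin 2) ℂ), ← mul_add] at key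
      have hst := mul_left_cancel₀ (mvX_ne_zero 0) key
      -- The strict transform is `G₁ + (v + a) G₂`, with `G₁`, `G₂` pulled back. It is a unit if
      -- `G₂(0) = 0`; otherwise its coefficient at `v` is `G₂(0)`.
      by_cases h2 : MvPowerSeries.constantCoeff G₂ = 0
      · have h1' : MvPowerSeries.constantCoeff G₁ ≠ 0 := by tauto
        refine le_trans (mult_eq_zero_of_constantCoeff_ne_zero ?_).le zero_le_one
        rw [← hst]
        have e1 := constantCoeff_subst_blowUpMap (.slope a) G₁
        have e2 := constantCoeff_subst_blowUpMap (.slope a) G₂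
        simp only [blowUpMap] at e1 e2
        simp [e1, e2, h1', h2]
      · refine mult_le_one_of_coeff_ne_zero 1 ?_
        have e1 := hlin (.slope a) G₁ 1 (by simp [excVar])
        have e2 := hlin (.slope a) G₂ 1 (by simp [excVar])
        have e3 := constantCoeff_subst_blowUpMap (.slope a) G₂
        simp only [blowUpMap] at e1 e2 e3
        rw [← hst, map_add, e1, zero_add, add_mul, map_add, MvPowerSeries.coeff_C_mul, e2, mul_zero,
          add_zero, coeff_single_X_mul, e3]
        exact h2
    | vertical =>
      simp only [blowUpMap, excVar, Matrix.cons_val_zero, Matrix.cons_val_one] at key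
      rw [mul_comm (MvPowerSeries.X 0 : MvPowerSeries (Fin 2) ℂ) (MvPowerSeries.X 1),
        mul_assoc (MvPowerSeries.X 1 : MvPowerSeries (Fin 2) ℂ), ← mul_add] at key
      have hst := mul_left_cancel₀ (mvX_ne_zero 1) key
      by_cases h2 : MvPowerSeries.constantCoeff G₁ = 0
      · have h1' : MvPowerSeries.constantCoeff G₂ ≠ 0 := by tauto
        refine le_trans (mult_eq_zero_of_constantCoeff_ne_zero ?_).le zero_le_one
        rw [← hst]
        have e1 := constantCoeff_subst_blowUpMap .vertical G₁
        have e2 := constantCoeff_subst_blowUpMap .vertical G₂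
        simp only [blowUpMap, mul_comm (MvPowerSeries.X 0 : MvPowerSeries (Fin 2) ℂ)] at e1 e2
        simp [e2, h1']
      · refine mult_le_one_of_coeff_ne_zero 0 ?_
        have e2 := hlin .vertical G₂ 0 (by simp [excVar])
        have e3 := constantCoeff_subst_blowUpMap .vertical G₁
        simp only [blowUpMap, mul_comm (MvPowerSeries.X 0 : MvPowerSeries (Fin 2) ℂ)] at e2 e3
        rw [← hst, map_add, e2, add_zero, coeff_single_X_mul, e3]
        exact h2
  · refine le_trans (mult_eq_zero_of_constantCoeff_ne_zero ?_).le zero_le_one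
    have key := congrArg MvPowerSeries.constantCoeff (subst_blowUpMap_eq p G)
    rw [constantCoeff_subst_blowUpMap, mult_eq_zero_of_constantCoeff_ne_zero hc, pow_zero,
      one_mul] at key
    rwa [← key]

/-! ### Parametrized branches and their lifts under blow-ups -/

section Param

variable {L : Type*} [Field L]

/-- The parametrized branch passes through the origin. -/
def IsCentered (φ : PowerSeries L × PowerSeries L) : Prop :=
  PowerSeries.constantCoeff φ.1 = 0 ∧ PowerSeries.constantCoeff φ.2 = 0

lemma IsCentered.hasSubst {φ : PowerSeries L × PowerSeries L} (h : IsCentered φ) :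
    MvPowerSeries.HasSubst (![φ.1, φ.2] : Fin 2 → MvPowerSeries Unit L) := by
  refine MvPowerSeries.hasSubst_of_constantCoeff_zero fun i => ?_
  fin_cases i
  · exact h.1
  · exact h.2

lemma isCentered_X_pow_mul {D : ℕ} (hD : 1 ≤ D) (u v : PowerSeries L) :
    IsCentered (PowerSeries.X ^ D * u, PowerSeries.X ^ D * v) := by
  constructor <;> simp [show D ≠ 0 by omega]

/-- The multiplicity of a parametrized branch. -/
def pmult (φ : PowerSeries L × PowerSeries L) : ℕ := (min φ.1.order φ.2.order).toNat

variable [Algebra ℂ L]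

/-- The pull-back of `G ∈ ℂ⟦x, y⟧` under the parametrization `(x, y) = φ`. -/
def evalAt (φ : PowerSeries L × PowerSeries L) (G : MvPowerSeries (Fin 2) ℂ) : PowerSeries L :=
  MvPowerSeries.subst (![φ.1, φ.2] : Fin 2 → MvPowerSeries Unit L) G

variable {φ φ' : PowerSeries L × PowerSeries L}

lemma evalAt_mul (h : IsCentered φ) (F G : MvPowerSeries (Fin 2) ℂ) :
    evalAt φ (F * G) = evalAt φ F * evalAt φ G :=
  MvPowerSeries.subst_mul h.hasSubst F G

lemma evalAt_add (h : IsCentered φ) (F G : MvPowerSeries (Fin 2) ℂ) :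
    evalAt φ (F + G) = evalAt φ F + evalAt φ G :=
  MvPowerSeries.subst_add h.hasSubst F G

lemma evalAt_pow (h : IsCentered φ) (F : MvPowerSeries (Fin 2) ℂ) (k : ℕ) :
    evalAt φ (F ^ k) = evalAt φ F ^ k :=
  MvPowerSeries.subst_pow h.hasSubst F k

lemma evalAt_X (h : IsCentered φ) (i : Fin 2) : evalAt φ (MvPowerSeries.X i) = ![φ.1, φ.2] i :=
  MvPowerSeries.subst_X h.hasSubst i

lemma evalAt_zero (h : IsCentered φ) : evalAt φ 0 = 0 := by
  have := map_zero (MvPowerSeries.substAlgHom (R := ℂ) h.hasSubst)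
  rwa [MvPowerSeries.coe_substAlgHom] at this

lemma evalAt_C (h : IsCentered φ) (a : ℂ) :
    evalAt φ (MvPowerSeries.C a) = PowerSeries.C (algebraMap ℂ L a) := by
  have := AlgHom.commutes (MvPowerSeries.substAlgHom (R := ℂ) h.hasSubst) a
  rw [MvPowerSeries.coe_substAlgHom, MvPowerSeries.algebraMap_apply,
    MvPowerSeries.algebraMap_apply] at this
  exact this

lemma evalAt_coe (F : MvPolynomial (Fin 2) ℂ) :
    evalAt φ (F : MvPowerSeries (Fin 2) ℂ) = MvPolynomial.aeval ![φ.1, φ.2] F :=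
  MvPowerSeries.subst_coe F

lemma coeff_evalAt (h : IsCentered φ) (G : MvPowerSeries (Fin 2) ℂ) (k : ℕ) :
    PowerSeries.coeff k (evalAt φ G) = ∑ᶠ d : Fin 2 →₀ ℕ,
      MvPowerSeries.coeff d G • PowerSeries.coeff k (φ.1 ^ d 0 * φ.2 ^ d 1) := by
  rw [PowerSeries.coeff, evalAt, MvPowerSeries.coeff_subst h.hasSubst]
  refine finsum_congr fun d => ?_
  rw [Finsupp.prod_fintype _ _ (by simp), Fin.prod_univ_two]
  rfl

/-- The equations relating a parametrized branch and its lift under a blow-up. -/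
def BlowEq : Direction → PowerSeries L × PowerSeries L → PowerSeries L × PowerSeries L → Prop
  | .slope a, φ, φ' =>
      φ.1 ≠ 0 ∧ φ'.1 = φ.1 ∧ φ.1 * (φ'.2 + PowerSeries.C (algebraMap ℂ L a)) = φ.2
  | .vertical, φ, φ' => φ.2 ≠ 0 ∧ φ'.2 = φ.2 ∧ φ'.1 * φ.2 = φ.1

/-- `φ'` is the lift of the parametrized branch `φ` under the blow-up with centre the origin, and it
passes through the point of direction `p`. -/
structure BlowStep (p : Direction) (φ φ' : PowerSeries L × PowerSeries L) : Prop where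
  centered : IsCentered φ
  centered' : IsCentered φ'
  eq : BlowEq p φ φ'

lemma BlowStep.evalAt_eq {p : Direction} (h : BlowStep p φ φ') (G : MvPowerSeries (Fin 2) ℂ) :
    evalAt φ G = evalAt φ' (MvPowerSeries.subst (blowUpMap p) G) := by
  have h' := h.centered'
  rw [evalAt, evalAt, MvPowerSeries.subst_comp_subst_apply (hasSubst_blowUpMap p) h'.hasSubst]
  congr 1
  funext i
  change _ = evalAt φ' (blowUpMap p i)
  cases p with
  | slope a =>
    obtain ⟨-, h1, h2⟩ := h.eq
    fin_cases i <;> simp [blowUpMap, evalAt_X h', evalAt_mul h', evalAt_add h', evalAt_C h', h1, h2]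
  | vertical =>
    obtain ⟨-, h1, h2⟩ := h.eq
    fin_cases i <;> simp [blowUpMap, evalAt_X h', evalAt_mul h', h1, h2]

/-- The exceptional coordinate is the one which divides the other along the branch, so its order is
the minimum. -/
lemma BlowStep.order_exc {p : Direction} (h : BlowStep p φ φ') :
    (evalAt φ' (MvPowerSeries.X (excVar p))).order = pmult φ := by
  rw [evalAt_X h.centered']
  cases p with
  | slope a =>
    obtain ⟨h0, h1, h2⟩ := h.eq
    have : φ.1.order ≤ φ.2.order := by rw [← h2, PowerSeries.order_mul]; exact le_self_add
    simp [excVar, pmult, h1, min_eq_left this, PowerSeries.coe_toNat_order h0]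
  | vertical =>
    obtain ⟨h0, h1, h2⟩ := h.eq
    have : φ.2.order ≤ φ.1.order := by rw [← h2, PowerSeries.order_mul]; exact le_add_self
    simp [excVar, pmult, h1, min_eq_right this, PowerSeries.coe_toNat_order h0]

/-- One step of Noether's formula: take orders in the factorization of the pull-back into the strict
transform and a power of the exceptional equation. -/
lemma BlowStep.order_evalAt {p : Direction} (h : BlowStep p φ φ') (G : MvPowerSeries (Fin 2) ℂ) :
    (evalAt φ G).order =
      ((mult G * pmult φ : ℕ) : ℕ∞) + (evalAt φ' (strictTransform p G)).order := by
  rw [h.evalAt_eq, subst_blowUpMap_eq, evalAt_mul h.centered', evalAt_pow h.centered',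
    PowerSeries.order_mul, PowerSeries.order_pow, h.order_exc]
  simp

/-- Noether's formula for the intersection of a parametrized branch and a curve. -/
lemma order_evalAt_eq_sum_add {p : ℕ → Direction} {Φ : ℕ → PowerSeries L × PowerSeries L}
    (G : MvPowerSeries (Fin 2) ℂ) (s r : ℕ)
    (h : ∀ c, s ≤ c → c < s + r → BlowStep (p c) (Φ c) (Φ (c + 1))) :
    (evalAt (Φ s) G).order =
      ((∑ l ∈ Finset.range r, mult (strictFrom p s l G) * pmult (Φ (s + l)) : ℕ) : ℕ∞) +
        (evalAt (Φ (s + r)) (strictFrom p s r G)).order := by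
  induction r with
  | zero => simp [strictFrom]
  | succ r ih =>
    rw [ih fun c h1 h2 => h c h1 (by omega), Finset.sum_range_succ,
      (h (s + r) (by omega) (by omega)).order_evalAt, Nat.cast_add, ← add_assoc]
    rfl

/-- The parametrized branch has two coordinates of order `D` whose leading coefficients have a
transcendental ratio. -/
def IsGeneric (D : ℕ) (φ : PowerSeries L × PowerSeries L) : Prop :=
  1 ≤ D ∧ ∃ u v : PowerSeries L, φ = (PowerSeries.X ^ D * u, PowerSeries.X ^ D * v) ∧
    PowerSeries.constantCoeff u ≠ 0 ∧
    Transcendental ℂ (PowerSeries.constantCoeff v / PowerSeries.constantCoeff u)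

lemma IsGeneric.isCentered {D : ℕ} (h : IsGeneric D φ) : IsCentered φ := by
  obtain ⟨hD, u, v, rfl, -⟩ := h
  exact isCentered_X_pow_mul hD u v

lemma coeff_evalAt_eq_zero_of_lt {D m k : ℕ} (hD : 1 ≤ D) (u v : PowerSeries L)
    {G : MvPowerSeries (Fin 2) ℂ} (hG : ∀ d, d.degree < m → MvPowerSeries.coeff d G = 0)
    (hk : k < D * m) :
    PowerSeries.coeff k (evalAt (PowerSeries.X ^ D * u, PowerSeries.X ^ D * v) G) = 0 := by
  rw [coeff_evalAt (isCentered_X_pow_mul hD u v)]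
  refine finsum_eq_zero_of_forall_eq_zero fun d => ?_
  by_cases hd : d.degree < m
  · rw [hG d hd, zero_smul]
  · rw [mul_pow, mul_pow, mul_mul_mul_comm, ← pow_mul, ← pow_mul, ← pow_add,
      PowerSeries.coeff_X_pow_mul', if_neg, smul_zero]
    have : d.degree = d 0 + d 1 := by rw [Finsupp.degree_eq_sum, Fin.sum_univ_two]
    rw [← mul_add, ← this]
    have := Nat.mul_le_mul_left D (not_lt.mp hd)
    omega

/-- Monomials of degree `e` have order at least `D * e`, so this coefficient only sees the form of
degree `m` of `G`, evaluated at the leading coefficients. -/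
lemma coeff_evalAt_leading {D m : ℕ} (hD : 1 ≤ D) (u v : PowerSeries L)
    {G : MvPowerSeries (Fin 2) ℂ} (hG : ∀ d, d.degree < m → MvPowerSeries.coeff d G = 0) :
    PowerSeries.coeff (D * m) (evalAt (PowerSeries.X ^ D * u, PowerSeries.X ^ D * v) G) =
      ∑ i ∈ Finset.range (m + 1),
        MvPowerSeries.coeff (Finsupp.single 0 (m - i) + Finsupp.single 1 i) G •
          (PowerSeries.constantCoeff u ^ (m - i) * PowerSeries.constantCoeff v ^ i) := by
  classical
  rw [coeff_evalAt (isCentered_X_pow_mul hD u v)]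
  have hinj : Set.InjOn (fun i : ℕ => (Finsupp.single 0 (m - i) + Finsupp.single 1 i : Fin 2 →₀ ℕ))
      (Finset.range (m + 1)) := by
    intro i _ j _ hij
    simpa using DFunLike.congr_fun hij 1
  have hterm (d : Fin 2 →₀ ℕ) (hd : ¬ d.degree < m) :
      PowerSeries.coeff (D * m) ((PowerSeries.X ^ D * u) ^ d 0 * (PowerSeries.X ^ D * v) ^ d 1) =
        if d.degree = m then
          PowerSeries.constantCoeff u ^ d 0 * PowerSeries.constantCoeff v ^ d 1 else 0 := by
    have hdeg : d.degree = d 0 + d 1 := by rw [Finsupp.degree_eq_sum, Fin.sum_univ_two]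
    rw [mul_pow, mul_pow, mul_mul_mul_comm, ← pow_mul, ← pow_mul, ← pow_add,
      PowerSeries.coeff_X_pow_mul', ← mul_add, ← hdeg]
    by_cases h : d.degree = m
    · simp [h]
    · have := Nat.mul_lt_mul_of_pos_left (show m < d.degree by omega) (show 0 < D by omega)
      rw [if_neg (by omega), if_neg h]
  rw [finsum_eq_sum_of_support_subset
    (s := (Finset.range (m + 1)).image fun i => Finsupp.single 0 (m - i) + Finsupp.single 1 i),
    Finset.sum_image hinj]
  · refine Finset.sum_congr rfl fun i hi => ?_
    have hi' : i < m + 1 := Finset.mem_range.mp hi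
    have hdeg : (Finsupp.single 0 (m - i) + Finsupp.single 1 i : Fin 2 →₀ ℕ).degree = m := by
      rw [map_add, Finsupp.degree_single, Finsupp.degree_single]; omega
    rw [hterm _ (by omega), if_pos hdeg]
    simp
  · intro d hd
    have h1 : ¬ d.degree < m := fun h => hd (by simp [hG d h])
    have h2 : d.degree = m := by
      by_contra h
      exact hd (by simp only [hterm d h1, if_neg h, smul_zero])
    rw [Finsupp.degree_eq_sum, Fin.sum_univ_two] at h2
    simp only [Finset.coe_image, Finset.coe_range, Set.mem_image, Set.mem_Iio]
    refine ⟨d 1, by omega, ?_⟩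
    ext i
    fin_cases i
    · simp; omega
    · simp

/-- The leading coefficient is the initial form of `G` at the leading coefficients of the branch. Up
to a power of the first one, it is a nonzero complex polynomial in their transcendental ratio, hence
nonzero: no complex curve is tangent to a generic branch. -/
lemma IsGeneric.order_evalAt {D : ℕ} (h : IsGeneric D φ) {G : MvPowerSeries (Fin 2) ℂ}
    (hG : G ≠ 0) : (evalAt φ G).order = ((D * mult G : ℕ) : ℕ∞) := by
  obtain ⟨hD, u, v, rfl, hu, htr⟩ := h
  have hlow : ∀ d : Fin 2 →₀ ℕ, d.degree < mult G → MvPowerSeries.coeff d G = 0 := fun d hd =>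
    coeff_eq_zero_of_degree_lt_mult hd
  rw [PowerSeries.order_eq_nat]
  refine ⟨?_, fun k hk => coeff_evalAt_eq_zero_of_lt hD u v hlow hk⟩
  rw [coeff_evalAt_leading hD u v hlow]
  set m := mult G with hm
  set α := PowerSeries.constantCoeff u
  set β := PowerSeries.constantCoeff v
  let q : Polynomial ℂ := ∑ i ∈ Finset.range (m + 1),
    Polynomial.monomial i
      (MvPowerSeries.coeff (Finsupp.single 0 (m - i) + Finsupp.single 1 i) G)
  have hq : q ≠ 0 := by
    obtain ⟨d, hd, hdeg⟩ := MvPowerSeries.exists_coeff_ne_zero_and_order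
      (MvPowerSeries.ne_zero_iff_order_finite.mp hG)
    have hdeg' : d.degree = m := by
      rw [← coe_mult hG] at hdeg
      exact ENat.natCast_inj.mp hdeg
    rw [Finsupp.degree_eq_sum, Fin.sum_univ_two] at hdeg'
    intro h0
    apply hd
    have := congrArg (fun r => Polynomial.coeff r (d 1)) h0
    simp only [q, Polynomial.finsetSum_coeff, Polynomial.coeff_monomial, Polynomial.coeff_zero,
      Finset.sum_ite_eq', Finset.mem_range] at this
    have he : (Finsupp.single 0 (m - d 1) + Finsupp.single 1 (d 1) : Fin 2 →₀ ℕ) = d := by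
      ext i
      fin_cases i
      · simp; omega
      · simp
    rwa [if_pos (by omega), he] at this
  have hval : Polynomial.aeval (β / α) q ≠ 0 := fun h0 => htr ⟨q, hq, h0⟩
  intro h0
  apply hval
  have hα : α ^ m ≠ 0 := pow_ne_zero _ hu
  apply mul_left_cancel₀ hα
  rw [mul_zero, ← h0, map_sum, Finset.mul_sum]
  refine Finset.sum_congr rfl fun i hi => ?_
  have hi' : i < m + 1 := Finset.mem_range.mp hi
  rw [Polynomial.aeval_monomial, Algebra.smul_def, div_pow]
  have : α ^ m = α ^ (m - i) * α ^ i := by rw [← pow_add]; congr 1; omega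
  rw [this]
  field_simp

lemma IsGeneric.pmult_eq {D : ℕ} (h : IsGeneric D φ) : pmult φ = D := by
  obtain ⟨hD, u, v, rfl, hu, htr⟩ := h
  have hv : PowerSeries.constantCoeff v ≠ 0 := by
    intro h0
    rw [h0, zero_div] at htr
    exact htr isAlgebraic_zero
  have hord (w : PowerSeries L) (hw : PowerSeries.constantCoeff w ≠ 0) :
      (PowerSeries.X ^ D * w).order = (D : ℕ∞) := by
    rw [PowerSeries.order_mul, PowerSeries.order_X_pow, PowerSeries.order_zero_of_unit, add_zero]
    exact PowerSeries.isUnit_iff_constantCoeff.mpr hw.isUnit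
  simp [pmult, hord u hu, hord v hv]

end Param

/-! ### The inverse proximity matrix -/

lemma proximityMatrix_isUnit_det (k : ℕ) (p : ℕ → Direction) :
    IsUnit (proximityMatrix k p).det := by
  classical
  rw [Matrix.det_of_isLowerTriangular]
  · simp [proximityMatrix]
  · intro i j hij
    have hij' : i < j := hij
    simp only [proximityMatrix, Matrix.of_apply]
    rw [if_neg hij'.ne, if_neg fun h => absurd h.1 (by simpa using hij'.le)]

section Xrow

variable {L : Type*} [Field L] [Algebra ℂ L] {p : ℕ → Direction}
  {θ : ℕ → PowerSeries L × PowerSeries L} {a D : ℕ}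

lemma excAt_succ {b c : ℕ} (h : b < c) :
    excAt p b (c + 1) = strictTransform (p c) (excAt p b c) := by
  obtain ⟨r, rfl⟩ := Nat.exists_eq_add_of_lt h
  unfold excAt
  rw [show b + r + 1 + 1 - (b + 1) = r + 1 by omega, show b + r + 1 - (b + 1) = r by omega]
  rw [strictFrom, show b + 1 + r = b + r + 1 by omega]

lemma excAt_self_succ (b : ℕ) : excAt p b (b + 1) = MvPowerSeries.X (excVar (p b)) := by
  simp [excAt, strictFrom]

lemma mvX_mult (i : Fin 2) : mult (MvPowerSeries.X i : MvPowerSeries (Fin 2) ℂ) ≤ 1 :=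
  mult_le_one_of_coeff_ne_zero i (by simp)

/-- Nonvanishing along the branch is what the induction carries: it keeps the equations of the
successive strict transforms nonzero. -/
lemma excAt_ne_zero_and_mult_le_one (hstep : ∀ c, c < a → BlowStep (p c) (θ c) (θ (c + 1)))
    {b c : ℕ} (hbc : b < c) (hca : c ≤ a) :
    excAt p b c ≠ 0 ∧ (evalAt (θ c) (excAt p b c)) ≠ 0 ∧ mult (excAt p b c) ≤ 1 := by
  induction c, hbc using Nat.le_induction with
  | base =>
    rw [excAt_self_succ]
    refine ⟨mvX_ne_zero _, ?_, mvX_mult _⟩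
    rw [Ne, ← PowerSeries.order_eq_top, (hstep b hca).order_exc]
    exact ENat.natCast_ne_top _
  | succ c hc ih =>
    obtain ⟨h1, h2, h3⟩ := ih (by omega)
    have hs := hstep c (by omega)
    have hev : evalAt (θ (c + 1)) (strictTransform (p c) (excAt p b c)) ≠ 0 := by
      intro h0
      have := hs.order_evalAt (excAt p b c)
      rw [h0, PowerSeries.order_zero, add_top, PowerSeries.order_eq_top] at this
      exact h2 this
    rw [excAt_succ hc]
    refine ⟨fun h0 => hev ?_, hev, mult_strictTransform_le_one _ h1 h3⟩
    rw [h0, evalAt_zero hs.centered']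

/-- Proximity thus becomes a multiplicity, and the proximity equality an instance of Noether's
formula. -/
lemma mult_excAt (hstep : ∀ c, c < a → BlowStep (p c) (θ c) (θ (c + 1)))
    {b c : ℕ} (hbc : b < c) (hca : c ≤ a) [Decidable (Proximate p c b)] :
    mult (excAt p b c) = if Proximate p c b then 1 else 0 := by
  obtain ⟨h1, -, h3⟩ := excAt_ne_zero_and_mult_le_one hstep hbc hca
  split_ifs with h
  · exact le_antisymm h3 (one_le_mult h1 h.2)
  · exact mult_eq_zero_of_constantCoeff_ne_zero fun h0 => h ⟨hbc, h0⟩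

open Classical in
/-- The proximity equality for a parametrized branch which is generic at a point. -/
lemma pmult_eq_sum_proximate (hstep : ∀ c, c < a → BlowStep (p c) (θ c) (θ (c + 1)))
    (hgen : IsGeneric D (θ a)) {b : ℕ} (hb : b < a) :
    pmult (θ b) = ∑ c ∈ Finset.range (a + 1), if Proximate p c b then pmult (θ c) else 0 := by
  obtain ⟨r, rfl⟩ := Nat.exists_eq_add_of_lt hb
  -- Noether's formula for the exceptional divisor of `Q_b`, whose intersection number with the
  -- lifted branch is `pmult (θ b)`.
  have h := order_evalAt_eq_sum_add (p := p) (Φ := θ) (MvPowerSeries.X (excVar (p b))) (b + 1) r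
    fun c _ h2 => hstep c (by omega)
  have hexc (l : ℕ) : strictFrom p (b + 1) l (MvPowerSeries.X (excVar (p b))) =
      excAt p b (b + 1 + l) := by simp [excAt]
  rw [(hstep b hb).order_exc, hexc, show b + 1 + r = b + r + 1 by omega,
    hgen.order_evalAt (excAt_ne_zero_and_mult_le_one hstep hb le_rfl).1, ← Nat.cast_add] at h
  have h' := ENat.natCast_inj.mp h
  rw [h', Finset.sum_range_succ, mult_excAt hstep hb le_rfl, hgen.pmult_eq]
  congr 1
  · rw [show b + r + 1 = (b + 1) + r by omega, Finset.sum_range_add,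
      Finset.sum_eq_zero (s := Finset.range (b + 1)), zero_add]
    · refine Finset.sum_congr rfl fun l hl => ?_
      have := Finset.mem_range.mp hl
      rw [hexc, mult_excAt hstep (by omega) (by omega)]
      split_ifs <;> simp
    · intro c hc
      have := Finset.mem_range.mp hc
      rw [if_neg fun h => absurd h.1 (by omega)]
  · split_ifs <;> simp

/-- The rows of the inverse proximity matrix are the multiplicities of generic branches. -/
theorem mul_Xrow (hstep : ∀ c, c < a → BlowStep (p c) (θ c) (θ (c + 1)))
    (hgen : IsGeneric D (θ a)) {k : ℕ} (hak : a + 1 ≤ k) (c : Fin k) :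
    (D : ℤ) * Xrow k p (a + 1) c = if (c : ℕ) ≤ a then (pmult (θ c) : ℤ) else 0 := by
  classical
  set e : Fin k → ℤ := fun c => if (c : ℕ) ≤ a then (pmult (θ c) : ℤ) else 0 with he
  let i₀ : Fin k := ⟨a, by omega⟩
  -- The proximity equalities say that `e` times the proximity matrix is `D` times a unit vector;
  -- multiplying by the inverse matrix isolates the row.
  have hmul : Matrix.vecMul e (proximityMatrix k p) = (D : ℤ) • Pi.single i₀ 1 := by
    ext b
    have hsum : Matrix.vecMul e (proximityMatrix k p) b =
        e b - ∑ c : Fin k, if Proximate p c b then e c else 0 := by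
      have : ∀ c : Fin k, e c * proximityMatrix k p c b =
          (if c = b then e b else 0) - if Proximate p c b then e c else 0 := by
        intro c
        simp only [proximityMatrix, Matrix.of_apply]
        by_cases hcb : c = b
        · subst hcb
          rw [if_pos rfl, if_pos rfl, if_neg fun h => absurd h.1 (lt_irrefl _)]; ring
        · rw [if_neg hcb, if_neg hcb]; split_ifs <;> ring
      simp only [Matrix.vecMul, dotProduct, this, Finset.sum_sub_distrib, Finset.sum_ite_eq',
        Finset.mem_univ, if_true]
    have hfin : (∑ c : Fin k, if Proximate p c b then e c else 0) =
        ∑ c ∈ Finset.range (a + 1), if Proximate p c b then (pmult (θ c) : ℤ) else 0 := by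
      rw [Fin.sum_univ_eq_sum_range
        (fun c => if Proximate p c b then (if c ≤ a then (pmult (θ c) : ℤ) else 0) else 0) k]
      symm
      refine Finset.sum_subset_zero_on_sdiff (fun x hx => ?_) (fun x hx => ?_) fun x hx => ?_
      · simp only [Finset.mem_range] at hx ⊢; omega
      · simp only [Finset.mem_sdiff, Finset.mem_range] at hx
        rw [if_neg (show ¬ x ≤ a by omega)]; simp
      · simp only [Finset.mem_range] at hx
        rw [if_pos (show x ≤ a by omega)]
    rw [hsum, hfin]
    rcases lt_trichotomy (b : ℕ) a with hb | hb | hb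
    · have := pmult_eq_sum_proximate hstep hgen hb
      have hne : b ≠ i₀ := fun h => by rw [h] at hb; exact lt_irrefl _ hb
      simp only [he, if_pos hb.le, Pi.smul_apply, Pi.single_apply, if_neg hne, smul_zero]
      rw [this]
      push_cast
      simp
    · have hbi : b = i₀ := Fin.ext hb
      rw [Finset.sum_eq_zero]
      · simp [he, hgen.pmult_eq, hbi, i₀]
      · intro c hc
        have := Finset.mem_range.mp hc
        rw [if_neg fun h => absurd h.1 (by omega)]
    · have hne : b ≠ i₀ := fun h => by rw [h] at hb; exact lt_irrefl _ hb
      rw [Finset.sum_eq_zero]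
      · simp [he, if_neg (show ¬ (b : ℕ) ≤ a by omega), hne]
      · intro c hc
        have := Finset.mem_range.mp hc
        rw [if_neg fun h => absurd h.1 (by omega)]
  have hinv := congrArg (fun w => Matrix.vecMul w (proximityMatrix k p)⁻¹) hmul
  simp only [Matrix.vecMul_vecMul,
    Matrix.mul_nonsing_inv _ (proximityMatrix_isUnit_det k p), Matrix.vecMul_one,
    Matrix.smul_vecMul, Matrix.single_one_vecMul] at hinv
  have := congrFun hinv c
  simp only [Pi.smul_apply, smul_eq_mul, Matrix.row] at this
  rw [show (if (c : ℕ) ≤ a then (pmult (θ c) : ℤ) else 0) = e c from rfl, this, Xrow,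
    dif_pos ⟨by omega, hak⟩]
  rfl

/-- The product of the order vector of a curve with a row of the inverse proximity matrix is an
intersection number. -/
theorem mul_ordVec_dotProduct_Xrow (hstep : ∀ c, c < a → BlowStep (p c) (θ c) (θ (c + 1)))
    (hgen : IsGeneric D (θ a)) {k : ℕ} (hak : a + 1 ≤ k) {G : MvPowerSeries (Fin 2) ℂ}
    (hG : evalAt (θ 0) G ≠ 0) :
    (D : ℤ) * (ordVec k p G ⬝ᵥ Xrow k p (a + 1)) = ((evalAt (θ 0) G).order.toNat : ℤ) := by
  -- Noether's formula is stopped at the point where the branch is generic; what remains there is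
  -- `D` times the multiplicity of the strict transform.
  have h := order_evalAt_eq_sum_add (p := p) (Φ := θ) G 0 a fun c _ h2 => hstep c (by omega)
  rw [zero_add] at h
  have hne : strictFrom p 0 a G ≠ 0 := by
    intro h0
    rw [h0, evalAt_zero hgen.isCentered, PowerSeries.order_zero, add_top,
      PowerSeries.order_eq_top] at h
    exact hG h
  rw [hgen.order_evalAt hne, ← Nat.cast_add] at h
  rw [h, ENat.toNat_natCast]
  have hsum : (∑ c : Fin k, ordVec k p G c * (if (c : ℕ) ≤ a then (pmult (θ c) : ℤ) else 0)) =
      ∑ c ∈ Finset.range (a + 1), (mult (strictFrom p 0 c G) * pmult (θ c) : ℤ) := by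
    refine (Fin.sum_univ_eq_sum_range (fun c : ℕ => (mult (strictFrom p 0 c G) : ℤ) *
        (if c ≤ a then (pmult (θ c) : ℤ) else 0)) k).trans ?_
    symm
    refine Finset.sum_subset_zero_on_sdiff (fun x hx => ?_) (fun x hx => ?_) fun x hx => ?_
    · simp only [Finset.mem_range] at hx ⊢; omega
    · simp only [Finset.mem_sdiff, Finset.mem_range] at hx
      rw [if_neg (show ¬ x ≤ a by omega)]; simp
    · simp only [Finset.mem_range] at hx
      rw [if_pos (show x ≤ a by omega)]
  simp only [dotProduct, Finset.mul_sum]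
  simp_rw [mul_left_comm (D : ℤ), mul_Xrow hstep hgen hak]
  rw [hsum, Finset.sum_range_succ, hgen.pmult_eq]
  push_cast
  simp [mul_comm]

end Xrow

/-! ### Irreducible germs have one tangent, and irreducible strict transforms -/

section Weierstrass

open IsLocalRing

variable {A : Type*} [CommRing A]

/-- The scaled polynomial is formally `ϖ^deg D(X/ϖ)`, and rescaling undoes the division. -/
lemma rescale_coe_scaleRoots (D : Polynomial A) (ϖ : A) :
    PowerSeries.rescale ϖ (D.scaleRoots ϖ : PowerSeries A) =
      PowerSeries.C (ϖ ^ D.natDegree) * (D : PowerSeries A) := by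
  ext k
  rw [PowerSeries.coeff_rescale, Polynomial.coeff_coe, Polynomial.coeff_scaleRoots,
    PowerSeries.coeff_C_mul, Polynomial.coeff_coe]
  by_cases hk : k ≤ D.natDegree
  · rw [mul_left_comm, ← pow_add, Nat.add_sub_cancel' hk, mul_comm]
  · rw [Polynomial.coeff_eq_zero_of_natDegree_lt (by omega)]
    simp

lemma isDistinguishedAt_scaleRoots {D : Polynomial A} {I : Ideal A} (hD : D.IsDistinguishedAt I)
    (ϖ : A) : (D.scaleRoots ϖ).IsDistinguishedAt I where
  mem {k} hk := by
    rw [Polynomial.natDegree_scaleRoots] at hk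
    rw [Polynomial.coeff_scaleRoots]
    exact Ideal.mul_mem_right _ _ (hD.mem hk)
  monic := (Polynomial.monic_scaleRoots_iff ϖ).mpr hD.monic

variable [IsDomain A] [IsLocalRing A] [IsAdicComplete (maximalIdeal A) A]

/-- If a power series divides `f(ϖ X)`, with `f` irreducible, then `f` is up to a unit the polynomial
obtained from the Weierstrass polynomial of the divisor by scaling its roots by `ϖ`. -/
lemma associated_scaleRoots_of_dvd_rescale {ϖ : A} (hϖ0 : ϖ ≠ 0)
    {f a : PowerSeries A} (hf : Irreducible f) (ha : ¬ IsUnit a)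
    (ha0 : a.map (residue A) ≠ 0) (hdvd : a ∣ PowerSeries.rescale ϖ f) :
    ∃ D : Polynomial A, D.IsDistinguishedAt (maximalIdeal A) ∧
      D.natDegree = (a.map (residue A)).order.toNat ∧ 0 < D.natDegree ∧
      Associated (D.scaleRoots ϖ : PowerSeries A) f := by
  obtain ⟨D, h, hW⟩ := PowerSeries.exists_isWeierstrassFactorization ha0
  have hD := hW.isDistinguishedAt
  have hpos : 0 < D.natDegree := by
    rw [Nat.pos_iff_ne_zero]
    intro h0
    apply ha
    rw [hW.eq_mul, hD.monic.natDegree_eq_zero.mp h0]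
    simpa using hW.isUnit
  have hWD : PowerSeries.IsWeierstrassFactorization (D : PowerSeries A) D 1 :=
    ⟨hD, isUnit_one, by simp⟩
  have hWs : PowerSeries.IsWeierstrassFactorization
      (D.scaleRoots ϖ : PowerSeries A) (D.scaleRoots ϖ) 1 :=
    ⟨isDistinguishedAt_scaleRoots hD ϖ, isUnit_one, by simp⟩
  refine ⟨D, hD, hW.natDegree_eq_toNat_order_map, hpos, ?_⟩
  -- Divide `f` by the scaled polynomial. After rescaling, `D` divides both `f(ϖX)` and the image of
  -- the divisor, hence `r(ϖX)`, whose degree is less than that of `D`. Uniqueness of Weierstrass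
  -- division forces `r = 0`, and irreducibility makes `q` a unit.
  obtain ⟨q, r, hr⟩ := PowerSeries.exists_isWeierstrassDivision f hWs.map_ne_zero
  have hdeg : r.degree < D.natDegree := by
    have h1 := hr.degree_lt
    have h2 := hWs.natDegree_eq_toNat_order_map
    rw [Polynomial.natDegree_scaleRoots] at h2
    rw [h2]
    exact h1
  have hr0 : r = 0 := by
    have hcoe : ((r.comp (Polynomial.C ϖ * Polynomial.X) : Polynomial A) : PowerSeries A) =
        PowerSeries.rescale ϖ (r : PowerSeries A) := by
      ext k
      rw [Polynomial.coeff_coe, Polynomial.comp_C_mul_X_coeff, PowerSeries.coeff_rescale,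
        Polynomial.coeff_coe, mul_comm]
    have hDr : (D : PowerSeries A) ∣ PowerSeries.rescale ϖ (r : PowerSeries A) := by
      have h1 : (D : PowerSeries A) ∣ PowerSeries.rescale ϖ f :=
        (Dvd.intro h hW.eq_mul.symm).trans hdvd
      rw [hr.eq_mul_add, map_add, map_mul, rescale_coe_scaleRoots] at h1
      exact (dvd_add_right ((dvd_mul_left _ _).mul_right _)).mp h1
    obtain ⟨w, hw⟩ := hDr
    have hdiv : PowerSeries.IsWeierstrassDivision 0 (D : PowerSeries A) (-w)
        (r.comp (Polynomial.C ϖ * Polynomial.X)) := by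
      constructor
      · have h2 := hWD.natDegree_eq_toNat_order_map
        change _ < (((D : PowerSeries A).map (residue A)).order.toNat : WithBot ℕ)
        rw [← h2, Polynomial.degree_lt_iff_coeff_zero]
        intro k hk
        rw [Polynomial.comp_C_mul_X_coeff, (Polynomial.degree_lt_iff_coeff_zero _ _).mp hdeg k hk,
          zero_mul]
      · rw [hcoe, hw]; ring
    have h0 := (hdiv.eq_zero hWD.map_ne_zero).2
    ext k
    have := congrArg (fun t => Polynomial.coeff t k) h0
    simp only [Polynomial.comp_C_mul_X_coeff, Polynomial.coeff_zero, mul_eq_zero] at this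
    exact this.resolve_right (pow_ne_zero _ hϖ0)
  have hfq : f = (D.scaleRoots ϖ : PowerSeries A) * q := by
    simpa [hr0] using hr.eq_mul_add
  have hnu : ¬ IsUnit (D.scaleRoots ϖ : PowerSeries A) := by
    rw [PowerSeries.isUnit_iff_constantCoeff, ← PowerSeries.coeff_zero_eq_constantCoeff_apply,
      Polynomial.coeff_coe]
    exact (isDistinguishedAt_scaleRoots hD ϖ).mem (by rwa [Polynomial.natDegree_scaleRoots])
  obtain ⟨u, hu⟩ := (hf.isUnit_or_isUnit hfq).resolve_left hnu
  exact ⟨u, by rw [hu, ← hfq]⟩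

end Weierstrass

/-! ### Series in two variables as series in `x` over `ℂ⟦y⟧`; strict transforms in the vertical
chart. -/

/-- Power series in one variable, as coefficients of power series in two variables. -/
abbrev CoeffRing : Type := MvPowerSeries (Fin 1) ℂ

instance : IsDomain CoeffRing := NoZeroDivisors.to_isDomain _

lemma mem_maximalIdeal_coeffRing {a : CoeffRing} :
    a ∈ IsLocalRing.maximalIdeal CoeffRing ↔ MvPowerSeries.constantCoeff a = 0 := by
  rw [IsLocalRing.mem_maximalIdeal, mem_nonunits_iff, MvPowerSeries.isUnit_iff_constantCoeff,
    isUnit_iff_ne_zero, not_not]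

lemma X_dvd_iff_coeffRing {a : CoeffRing} :
    MvPowerSeries.X 0 ∣ a ↔ MvPowerSeries.constantCoeff a = 0 := by
  rw [MvPowerSeries.X_dvd_iff]
  constructor
  · intro h
    exact h 0 rfl
  · intro h e he
    have : e = 0 := Finsupp.ext fun i => by fin_cases i; simpa using he
    rw [this]
    exact h

lemma maximalIdeal_coeffRing : IsLocalRing.maximalIdeal CoeffRing =
    Ideal.span (Set.range (MvPowerSeries.X : Fin 1 → CoeffRing)) := by
  rw [Set.range_unique]
  ext a
  rw [mem_maximalIdeal_coeffRing, Ideal.mem_span_singleton]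
  exact X_dvd_iff_coeffRing.symm

instance : IsAdicComplete (IsLocalRing.maximalIdeal CoeffRing) CoeffRing := by
  rw [maximalIdeal_coeffRing]
  infer_instance

/-- Power series in `x, y` as power series in `x` with coefficients in power series in `y`. -/
abbrev toIterated : MvPowerSeries (Fin 2) ℂ ≃ₐ[ℂ] PowerSeries CoeffRing :=
  MvPowerSeries.finSuccEquiv ℂ 1

lemma coeff_coeff_toIterated (G : MvPowerSeries (Fin 2) ℂ) (k l : ℕ) :
    MvPowerSeries.coeff (Finsupp.single 0 l) (PowerSeries.coeff k (toIterated G)) =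
      MvPowerSeries.coeff (Finsupp.single 0 k + Finsupp.single 1 l) G := by
  rw [MvPowerSeries.coeff_coeff_finSuccEquiv]
  congr 2
  ext i
  fin_cases i
  · simp
  · change (Finsupp.cons k (Finsupp.single (0 : Fin 1) l)) (Fin.succ 0) = _
    rw [Finsupp.cons_succ]
    simp

lemma finsupp_fin_one (x : Fin 1 →₀ ℕ) : x = Finsupp.single 0 (x 0) :=
  Finsupp.ext fun i => by fin_cases i; simp

lemma finsupp_fin_two (x : Fin 2 →₀ ℕ) : x = Finsupp.single 0 (x 0) + Finsupp.single 1 (x 1) := by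
  ext i; fin_cases i <;> simp

lemma coeff_subst_vertical (G : MvPowerSeries (Fin 2) ℂ) (k l : ℕ) :
    MvPowerSeries.coeff (Finsupp.single 0 k + Finsupp.single 1 l)
      (MvPowerSeries.subst (blowUpMap .vertical) G) =
    if k ≤ l then MvPowerSeries.coeff (Finsupp.single 0 k + Finsupp.single 1 (l - k)) G else 0 := by
  classical
  have hterm (d : Fin 2 →₀ ℕ) : (d.prod fun s e => blowUpMap .vertical s ^ e) =
      MvPowerSeries.monomial (Finsupp.single 0 (d 0) + Finsupp.single 1 (d 0 + d 1)) (1 : ℂ) := by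
    rw [Finsupp.prod_fintype _ _ (by simp), Fin.prod_univ_two]
    simp only [blowUpMap, Matrix.cons_val_zero, Matrix.cons_val_one]
    rw [mul_pow, MvPowerSeries.X_pow_eq, MvPowerSeries.X_pow_eq, MvPowerSeries.X_pow_eq,
      MvPowerSeries.monomial_mul_monomial, MvPowerSeries.monomial_mul_monomial, one_mul, one_mul,
      add_assoc, ← Finsupp.single_add]
  rw [MvPowerSeries.coeff_subst (hasSubst_blowUpMap _)]
  have hne (d : Fin 2 →₀ ℕ) (h : ¬ (d 0 = k ∧ d 0 + d 1 = l)) :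
      MvPowerSeries.coeff d G • MvPowerSeries.coeff (Finsupp.single 0 k + Finsupp.single 1 l)
        (d.prod fun s e => blowUpMap .vertical s ^ e) = 0 := by
    rw [hterm, MvPowerSeries.coeff_monomial, if_neg, smul_zero]
    intro h'
    have h0 := DFunLike.congr_fun h' 0
    have h1 := DFunLike.congr_fun h' 1
    simp at h0 h1
    exact h ⟨h0.symm, h1.symm⟩
  split_ifs with hkl
  · rw [finsum_eq_single _ (Finsupp.single 0 k + Finsupp.single 1 (l - k))]
    · rw [hterm, MvPowerSeries.coeff_monomial, if_pos]
      · simp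
      · simp [Nat.add_sub_cancel' hkl]
    · intro d hd
      refine hne d fun h => hd ?_
      rw [finsupp_fin_two d, h.1, show d 1 = l - k by omega]
  · exact finsum_eq_zero_of_forall_eq_zero fun d => hne d (by omega)

/-- Since `x^k y^l` becomes `u^k v^{k+l}`, the pull-back in this chart merely rescales the main
variable; this makes Weierstrass theory with `ϖ = y` applicable. -/
lemma toIterated_subst_vertical (G : MvPowerSeries (Fin 2) ℂ) :
    toIterated (MvPowerSeries.subst (blowUpMap .vertical) G) =
      PowerSeries.rescale (MvPowerSeries.X 0) (toIterated G) := by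
  ext k x
  rw [finsupp_fin_one x, coeff_coeff_toIterated, coeff_subst_vertical, PowerSeries.coeff_rescale,
    MvPowerSeries.X_pow_eq]
  generalize x 0 = l
  split_ifs with h
  · obtain ⟨r, rfl⟩ := Nat.exists_eq_add_of_le h
    rw [Finsupp.single_add, MvPowerSeries.coeff_add_monomial_mul, one_mul, coeff_coeff_toIterated,
      Nat.add_sub_cancel_left]
  · rw [MvPowerSeries.coeff_monomial_mul, if_neg]
    intro hle
    exact h (by simpa using hle 0)

-- Below the top degree, the coefficient of `x^k` is divisible by `y` as `D` is distinguished, and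
-- the scaling adds `y^{deg D - k}`. Hence `x^{deg D}` is the only term of total degree at most `deg
-- D`.
open IsLocalRing in
lemma coeff_symm_scaleRoots {D : Polynomial CoeffRing}
    (hD : D.IsDistinguishedAt (maximalIdeal CoeffRing)) {e : Fin 2 →₀ ℕ}
    (he : e.degree ≤ D.natDegree) :
    MvPowerSeries.coeff e
      (toIterated.symm (D.scaleRoots (MvPowerSeries.X 0) : PowerSeries CoeffRing)) =
      if e = Finsupp.single 0 D.natDegree then 1 else 0 := by
  classical
  rw [finsupp_fin_two e, ← coeff_coeff_toIterated, AlgEquiv.apply_symm_apply, Polynomial.coeff_coe,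
    Polynomial.coeff_scaleRoots]
  rw [Finsupp.degree_eq_sum, Fin.sum_univ_two] at he
  generalize e 0 = k at *
  generalize e 1 = l at *
  by_cases hk : k < D.natDegree
  · obtain ⟨w, hw⟩ := X_dvd_iff_coeffRing.mpr (mem_maximalIdeal_coeffRing.mp (hD.mem hk))
    rw [hw, mul_right_comm, ← pow_succ', MvPowerSeries.X_pow_eq, MvPowerSeries.coeff_monomial_mul,
      if_neg, if_neg]
    · intro h
      have := DFunLike.congr_fun h 0
      simp at this
      omega
    · intro h
      have := h 0
      simp at this
      omega
  · have hk' : k = D.natDegree := by omega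
    have hl : l = 0 := by omega
    subst hk' hl
    simp [hD.monic.coeff_natDegree]

lemma mult_symm_scaleRoots {D : Polynomial CoeffRing}
    (hD : D.IsDistinguishedAt (IsLocalRing.maximalIdeal CoeffRing)) :
    mult (toIterated.symm (D.scaleRoots (MvPowerSeries.X 0) : PowerSeries CoeffRing)) =
      D.natDegree := by
  have h : (toIterated.symm (D.scaleRoots (MvPowerSeries.X 0) : PowerSeries CoeffRing)).order =
      (D.natDegree : ℕ∞) := by
    rw [MvPowerSeries.order_eq_nat]
    refine ⟨⟨Finsupp.single 0 D.natDegree, ?_, by simp⟩, fun d hd => ?_⟩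
    · rw [coeff_symm_scaleRoots hD (by simp)]; simp
    · rw [coeff_symm_scaleRoots hD hd.le, if_neg]
      rintro rfl
      simp at hd
  rw [mult, h, ENat.toNat_natCast]

lemma mult_eq_of_associated {F G : MvPowerSeries (Fin 2) ℂ} (hF : F ≠ 0) (h : Associated F G) :
    mult F = mult G := by
  obtain ⟨u, rfl⟩ := h
  rw [mult_mul hF u.ne_zero, mult_eq_zero_of_constantCoeff_ne_zero (G := u), add_zero]
  exact (MvPowerSeries.isUnit_iff_constantCoeff.mp u.isUnit).ne_zero

/-- Weierstrass data for a divisor `a` of the pull-back of an irreducible `f` in the vertical chart: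
the order of `a(u, 0)` is the multiplicity of `f`, and the initial form of `f` is a power of `x`. -/
lemma exists_associated_of_dvd_subst_vertical {f a : MvPowerSeries (Fin 2) ℂ} (hf : Irreducible f)
    (ha : ¬ IsUnit a) (ha0 : (toIterated a).map (IsLocalRing.residue CoeffRing) ≠ 0)
    (hdvd : a ∣ MvPowerSeries.subst (blowUpMap .vertical) f) :
    0 < mult f ∧ ((toIterated a).map (IsLocalRing.residue CoeffRing)).order = mult f ∧
      ∃ E : MvPowerSeries (Fin 2) ℂ, Associated E f ∧ ∀ e : Fin 2 →₀ ℕ, e.degree ≤ mult f →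
        MvPowerSeries.coeff e E = if e = Finsupp.single 0 (mult f) then 1 else 0 := by
  have h1 : Irreducible (toIterated f) := (MulEquiv.irreducible_iff toIterated.toMulEquiv).mpr hf
  have h2 : ¬ IsUnit (toIterated a) := by rwa [isUnit_map_iff toIterated]
  have h3 : toIterated a ∣ PowerSeries.rescale (MvPowerSeries.X 0) (toIterated f) := by
    rw [← toIterated_subst_vertical]
    exact map_dvd toIterated hdvd
  obtain ⟨D, hD, hdeg, hpos, hass⟩ := associated_scaleRoots_of_dvd_rescale
    (nonZeroDivisors.ne_zero MvPowerSeries.X_mem_nonzeroDivisors) h1 h2 ha0 h3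
  have hass' : Associated
      (toIterated.symm (D.scaleRoots (MvPowerSeries.X 0) : PowerSeries CoeffRing)) f := by
    have := hass.map toIterated.symm
    rwa [AlgEquiv.symm_apply_apply] at this
  have hne : toIterated.symm (D.scaleRoots (MvPowerSeries.X 0) : PowerSeries CoeffRing) ≠ 0 := by
    intro h0
    have := mult_symm_scaleRoots hD
    rw [h0, mult, MvPowerSeries.order_zero] at this
    simp at this
    omega
  have hm : mult f = D.natDegree := by
    rw [← mult_eq_of_associated hne hass', mult_symm_scaleRoots hD]
  refine ⟨hm ▸ hpos, ?_, _, hass', fun e he => ?_⟩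
  · rw [hm, hdeg, PowerSeries.coe_toNat_order ha0]
  · rw [hm] at he ⊢
    exact coeff_symm_scaleRoots hD he

/-- A monomial `x^a y^b` of least degree in `f` becomes `u^a` in the strict transform, and survives
at `v = 0`. -/
lemma map_residue_strictTransform_vertical_ne_zero {f : MvPowerSeries (Fin 2) ℂ} (hf : f ≠ 0) :
    (toIterated (strictTransform .vertical f)).map (IsLocalRing.residue CoeffRing) ≠ 0 := by
  obtain ⟨d, hd, hdeg⟩ := MvPowerSeries.exists_coeff_ne_zero_and_order
    (MvPowerSeries.ne_zero_iff_order_finite.mp hf)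
  have hdeg' : d.degree = mult f := by
    rw [← coe_mult hf] at hdeg
    exact ENat.natCast_inj.mp hdeg
  rw [Finsupp.degree_eq_sum, Fin.sum_univ_two] at hdeg'
  intro h0
  have h1 := congrArg (PowerSeries.coeff (d 0)) h0
  rw [PowerSeries.coeff_map, (PowerSeries.coeff (d 0)).map_zero, IsLocalRing.residue_eq_zero_iff,
    mem_maximalIdeal_coeffRing, ← MvPowerSeries.coeff_zero_eq_constantCoeff_apply,
    ← Finsupp.single_zero (0 : Fin 1), coeff_coeff_toIterated, coeff_strictTransform] at h1
  simp only [Finsupp.single_zero, add_zero, excVar] at h1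
  rw [coeff_subst_vertical, if_pos (by omega), show mult f - d 0 = d 1 by omega,
    ← finsupp_fin_two] at h1
  exact hd h1

/-- The vertical case of `irreducible_strictTransform`. -/
lemma irreducible_strictTransform_vertical {f : MvPowerSeries (Fin 2) ℂ} (hf : Irreducible f)
    (hp : MvPowerSeries.constantCoeff (strictTransform .vertical f) = 0) :
    Irreducible (strictTransform .vertical f) := by
  have hnu : ¬ IsUnit (strictTransform .vertical f) := by
    rw [MvPowerSeries.isUnit_iff_constantCoeff, hp]; simp
  have hmap := map_residue_strictTransform_vertical_ne_zero hf.ne_zero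
  have hsub : strictTransform .vertical f ∣ MvPowerSeries.subst (blowUpMap .vertical) f := by
    rw [subst_blowUpMap_eq]; exact dvd_mul_left _ _
  refine ⟨hnu, fun a b hab => ?_⟩
  by_contra! hcon
  -- At `v = 0` the strict transform and each of two nonunit factors would all have order `mult f >
  -- 0`, while orders add up in a product.
  obtain ⟨hpos, h1, -⟩ := exists_associated_of_dvd_subst_vertical hf hnu hmap hsub
  rw [hab, map_mul, map_mul] at hmap
  rw [hab, map_mul, map_mul, PowerSeries.order_mul,
    (exists_associated_of_dvd_subst_vertical hf hcon.1 (left_ne_zero_of_mul hmap)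
      ((Dvd.intro _ hab.symm).trans hsub)).2.1,
    (exists_associated_of_dvd_subst_vertical hf hcon.2 (right_ne_zero_of_mul hmap)
      ((Dvd.intro_left _ hab.symm).trans hsub)).2.1, ← Nat.cast_add, ENat.natCast_inj] at h1
  omega

lemma exists_eq_X_pow_mul {L : Type*} [Field L] {x : PowerSeries L} {g : ℕ} (h : (g : ℕ∞) ≤ x.order) :
    ∃ u, x = PowerSeries.X ^ g * u := by
  have : PowerSeries.X ^ g ∣ x := by
    rw [PowerSeries.X_pow_dvd_iff]
    intro m hm
    exact PowerSeries.coeff_of_lt_order m (lt_of_lt_of_le (by exact_mod_cast hm) h)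
  exact this

/-- The vertical case of `blowEq_of_evalAt_eq_zero`. -/
lemma order_lt_of_evalAt_eq_zero_vertical {L : Type*} [Field L] [Algebra ℂ L]
    {φ : PowerSeries L × PowerSeries L} (hφ : IsCentered φ) (hφ0 : φ ≠ 0)
    {f : MvPowerSeries (Fin 2) ℂ} (hf : Irreducible f)
    (hp : MvPowerSeries.constantCoeff (strictTransform .vertical f) = 0)
    (hev : evalAt φ f = 0) : φ.2.order < φ.1.order := by
  by_contra! hle
  have hx0 : φ.1 ≠ 0 := by
    intro h0
    rw [h0, PowerSeries.order_zero, top_le_iff, PowerSeries.order_eq_top] at hle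
    exact hφ0 (Prod.ext h0 hle)
  -- Replace `f` by an associate whose initial form is `x^{mult f}`. If `x` had at most the order of
  -- `y` along the branch, the leading coefficient would be a power of that of `x`, so not zero.
  obtain ⟨hpos, -, E, ⟨q, hq⟩, hE⟩ := exists_associated_of_dvd_subst_vertical hf
    (by rw [MvPowerSeries.isUnit_iff_constantCoeff, hp]; simp)
    (map_residue_strictTransform_vertical_ne_zero hf.ne_zero)
    (by rw [subst_blowUpMap_eq]; exact dvd_mul_left _ _)
  have hEev : evalAt φ E = 0 := by
    have h1 : evalAt φ (f * (q⁻¹ : (MvPowerSeries (Fin 2) ℂ)ˣ)) = 0 := by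
      rw [evalAt_mul hφ, hev, zero_mul]
    rwa [← hq, Units.mul_inv_cancel_right] at h1
  have hg := PowerSeries.coe_toNat_order hx0
  set g := φ.1.order.toNat with hgdef
  have hg1 : 1 ≤ g := by
    have := PowerSeries.one_le_order_iff_constCoeff_eq_zero.mpr hφ.1
    rw [← hg] at this
    exact_mod_cast this
  obtain ⟨u, hu⟩ := exists_eq_X_pow_mul hg.le
  obtain ⟨v, hv⟩ := exists_eq_X_pow_mul (hg.le.trans hle)
  have hu0 : PowerSeries.constantCoeff u ≠ 0 := by
    intro h0
    have h1 := PowerSeries.coeff_order hx0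
    rw [← hgdef, hu, PowerSeries.coeff_X_pow_mul', if_pos le_rfl, Nat.sub_self,
      PowerSeries.coeff_zero_eq_constantCoeff_apply] at h1
    exact h1 h0
  have hlead := coeff_evalAt_leading (m := mult f) hg1 u v (G := E) (fun d hd => by
    rw [hE d hd.le, if_neg]
    rintro rfl
    simp at hd)
  rw [← hu, ← hv, hEev, map_zero, Finset.sum_eq_single 0] at hlead
  · rw [Nat.sub_zero, Finsupp.single_zero, add_zero, hE _ (by simp), if_pos rfl, one_smul, pow_zero,
      mul_one] at hlead
    exact pow_ne_zero _ hu0 hlead.symm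
  · intro i hi hi0
    have := Finset.mem_range.mp hi
    rw [hE, if_neg, zero_smul]
    · intro h
      have := DFunLike.congr_fun h 1
      simp at this
      omega
    · rw [map_add, Finsupp.degree_single, Finsupp.degree_single]; omega
  · simp

/-! Reduction of a slope direction to the vertical direction. -/

/-- The images of the variables under the linear change of coordinates exchanging the direction
`y = a x` and the direction of the `y`-axis. -/
def tiltMap (a : ℂ) : Fin 2 → MvPowerSeries (Fin 2) ℂ :=
  ![MvPowerSeries.X 1, MvPowerSeries.X 0 + MvPowerSeries.C a * MvPowerSeries.X 1]

/-- The inverse of `tiltMap`. -/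
def untiltMap (a : ℂ) : Fin 2 → MvPowerSeries (Fin 2) ℂ :=
  ![MvPowerSeries.X 1 - MvPowerSeries.C a * MvPowerSeries.X 0, MvPowerSeries.X 0]

lemma hasSubst_tiltMap (a : ℂ) : MvPowerSeries.HasSubst (tiltMap a) :=
  MvPowerSeries.hasSubst_of_constantCoeff_zero fun i => by fin_cases i <;> simp [tiltMap]

lemma hasSubst_untiltMap (a : ℂ) : MvPowerSeries.HasSubst (untiltMap a) :=
  MvPowerSeries.hasSubst_of_constantCoeff_zero fun i => by fin_cases i <;> simp [untiltMap]

lemma subst_C_two {b : Fin 2 → MvPowerSeries (Fin 2) ℂ} (a : ℂ) :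
    MvPowerSeries.subst b (MvPowerSeries.C a : MvPowerSeries (Fin 2) ℂ) = MvPowerSeries.C a :=
  MvPowerSeries.subst_C a

/-- The change of coordinates exchanging the direction `y = a x` and that of the `y`-axis. -/
def tilt (a : ℂ) : MvPowerSeries (Fin 2) ℂ ≃ₐ[ℂ] MvPowerSeries (Fin 2) ℂ :=
  AlgEquiv.ofAlgHom (MvPowerSeries.substAlgHom (hasSubst_tiltMap a))
    (MvPowerSeries.substAlgHom (hasSubst_untiltMap a))
    (by
      ext1 G
      rw [AlgHom.comp_apply, MvPowerSeries.coe_substAlgHom, MvPowerSeries.coe_substAlgHom,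
        MvPowerSeries.subst_comp_subst_apply (hasSubst_untiltMap a) (hasSubst_tiltMap a)]
      have : (fun s => MvPowerSeries.subst (tiltMap a) (untiltMap a s)) = MvPowerSeries.X := by
        have h := hasSubst_tiltMap a
        funext i
        fin_cases i
        · change MvPowerSeries.subst (tiltMap a)
            (MvPowerSeries.X 1 - MvPowerSeries.C a * MvPowerSeries.X 0) = _
          rw [MvPowerSeries.subst_sub h, MvPowerSeries.subst_mul h, MvPowerSeries.subst_X h,
            MvPowerSeries.subst_X h, subst_C_two]
          simp [tiltMap]
        · change MvPowerSeries.subst (tiltMap a) (MvPowerSeries.X 0) = _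
          rw [MvPowerSeries.subst_X h]
          simp [tiltMap]
      rw [this, MvPowerSeries.subst_self]; rfl)
    (by
      ext1 G
      rw [AlgHom.comp_apply, MvPowerSeries.coe_substAlgHom, MvPowerSeries.coe_substAlgHom,
        MvPowerSeries.subst_comp_subst_apply (hasSubst_tiltMap a) (hasSubst_untiltMap a)]
      have : (fun s => MvPowerSeries.subst (untiltMap a) (tiltMap a s)) = MvPowerSeries.X := by
        have h := hasSubst_untiltMap a
        funext i
        fin_cases i
        · change MvPowerSeries.subst (untiltMap a) (MvPowerSeries.X 1) = _
          rw [MvPowerSeries.subst_X h]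
          simp [untiltMap]
        · change MvPowerSeries.subst (untiltMap a)
            (MvPowerSeries.X 0 + MvPowerSeries.C a * MvPowerSeries.X 1) = _
          rw [MvPowerSeries.subst_add h, MvPowerSeries.subst_mul h, MvPowerSeries.subst_X h,
            MvPowerSeries.subst_X h, subst_C_two]
          simp [untiltMap]
      rw [this, MvPowerSeries.subst_self]; rfl)

lemma tilt_apply (a : ℂ) (G : MvPowerSeries (Fin 2) ℂ) :
    tilt a G = MvPowerSeries.subst (tiltMap a) G := by
  rw [← MvPowerSeries.coe_substAlgHom (hasSubst_tiltMap a)]; rfl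

lemma tilt_symm_apply (a : ℂ) (G : MvPowerSeries (Fin 2) ℂ) :
    (tilt a).symm G = MvPowerSeries.subst (untiltMap a) G := by
  rw [← MvPowerSeries.coe_substAlgHom (hasSubst_untiltMap a)]; rfl

lemma order_le_order_subst {b : Fin 2 → MvPowerSeries (Fin 2) ℂ}
    (hb : ∀ i, MvPowerSeries.constantCoeff (b i) = 0) (G : MvPowerSeries (Fin 2) ℂ) :
    G.order ≤ (MvPowerSeries.subst b G).order := by
  refine le_trans ?_ (MvPowerSeries.le_order_subst
    (MvPowerSeries.hasSubst_of_constantCoeff_zero hb) G)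
  have : (1 : ℕ∞) ≤ ⨅ i, (b i).order :=
    le_iInf fun i => MvPowerSeries.one_le_order_iff_constCoeff_eq_zero.mpr (hb i)
  calc G.order = 1 * G.order := (one_mul _).symm
    _ ≤ _ := mul_le_mul_left this _

lemma mult_tilt (a : ℂ) (G : MvPowerSeries (Fin 2) ℂ) : mult (tilt a G) = mult G := by
  have h1 : G.order ≤ (tilt a G).order := by
    rw [tilt_apply]
    exact order_le_order_subst (fun i => by fin_cases i <;> simp [tiltMap]) G
  have h2 : (tilt a G).order ≤ G.order := by
    conv_rhs => rw [← (tilt a).symm_apply_apply G, tilt_symm_apply]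
    exact order_le_order_subst (fun i => by fin_cases i <;> simp [untiltMap]) _
  rw [mult, mult, le_antisymm h1 h2]

/-- The tilt carries the chart of slope `a` to the vertical one; `tilt 0` exchanges the two
coordinates at the new point. -/
lemma subst_vertical_tilt (a : ℂ) (G : MvPowerSeries (Fin 2) ℂ) :
    MvPowerSeries.subst (blowUpMap .vertical) (tilt a G) =
      tilt 0 (MvPowerSeries.subst (blowUpMap (.slope a)) G) := by
  have h := hasSubst_blowUpMap .vertical
  have h0 := hasSubst_tiltMap 0
  rw [tilt_apply, tilt_apply, MvPowerSeries.subst_comp_subst_apply (hasSubst_tiltMap a) h,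
    MvPowerSeries.subst_comp_subst_apply (hasSubst_blowUpMap _) h0]
  congr 1
  funext i
  fin_cases i
  · change MvPowerSeries.subst (blowUpMap .vertical) (MvPowerSeries.X 1) =
      MvPowerSeries.subst (tiltMap 0) (MvPowerSeries.X 0)
    rw [MvPowerSeries.subst_X h, MvPowerSeries.subst_X h0]
    rfl
  · change MvPowerSeries.subst (blowUpMap .vertical)
      (MvPowerSeries.X 0 + MvPowerSeries.C a * MvPowerSeries.X 1) =
      MvPowerSeries.subst (tiltMap 0)
        (MvPowerSeries.X 0 * (MvPowerSeries.X 1 + MvPowerSeries.C a))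
    rw [MvPowerSeries.subst_add h, MvPowerSeries.subst_mul h, MvPowerSeries.subst_X h,
      MvPowerSeries.subst_X h, subst_C_two, MvPowerSeries.subst_mul h0,
      MvPowerSeries.subst_add h0, MvPowerSeries.subst_X h0, MvPowerSeries.subst_X h0, subst_C_two]
    simp [blowUpMap, tiltMap]
    ring

lemma strictTransform_vertical_tilt (a : ℂ) (G : MvPowerSeries (Fin 2) ℂ) :
    strictTransform .vertical (tilt a G) = tilt 0 (strictTransform (.slope a) G) := by
  have h := subst_vertical_tilt a G
  rw [subst_blowUpMap_eq, subst_blowUpMap_eq, mult_tilt, map_mul, map_pow] at h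
  have hX : tilt 0 (MvPowerSeries.X (excVar (.slope a))) =
      MvPowerSeries.X (excVar .vertical) := by
    rw [tilt_apply]
    exact MvPowerSeries.subst_X (hasSubst_tiltMap 0) 0
  rw [hX] at h
  exact mul_left_cancel₀ (pow_ne_zero _ (mvX_ne_zero _)) h

lemma constantCoeff_eq_zero_iff_not_isUnit (G : MvPowerSeries (Fin 2) ℂ) :
    MvPowerSeries.constantCoeff G = 0 ↔ ¬ IsUnit G := by
  rw [MvPowerSeries.isUnit_iff_constantCoeff, isUnit_iff_ne_zero, not_not]

lemma constantCoeff_tilt_eq_zero (a : ℂ) {G : MvPowerSeries (Fin 2) ℂ}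
    (h : MvPowerSeries.constantCoeff G = 0) : MvPowerSeries.constantCoeff (tilt a G) = 0 := by
  rw [constantCoeff_eq_zero_iff_not_isUnit] at h ⊢
  rwa [isUnit_map_iff (tilt a)]

lemma irreducible_tilt_iff (a : ℂ) {G : MvPowerSeries (Fin 2) ℂ} :
    Irreducible (tilt a G) ↔ Irreducible G :=
  MulEquiv.irreducible_iff (tilt a).toMulEquiv

/-- The strict transform of an irreducible germ at a point through which it passes is
irreducible. -/
theorem irreducible_strictTransform {p : Direction} {f : MvPowerSeries (Fin 2) ℂ}
    (hf : Irreducible f) (hp : MvPowerSeries.constantCoeff (strictTransform p f) = 0) :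
    Irreducible (strictTransform p f) := by
  cases p with
  | vertical => exact irreducible_strictTransform_vertical hf hp
  | slope a =>
    rw [← irreducible_tilt_iff 0, ← strictTransform_vertical_tilt]
    refine irreducible_strictTransform_vertical ((irreducible_tilt_iff a).mpr hf) ?_
    rw [strictTransform_vertical_tilt]
    exact constantCoeff_tilt_eq_zero 0 hp

/-! ### Lifting a parametrization of an irreducible germ. -/

section Lift

variable {L : Type*} [Field L]

lemma exists_eq_mul_of_order_lt {x y : PowerSeries L} (h : x.order < y.order) :
    ∃ w, w * x = y ∧ PowerSeries.constantCoeff w = 0 := by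
  have hx : x ≠ 0 := by
    rintro rfl
    simp at h
  have hg := PowerSeries.coe_toNat_order hx
  set g := x.order.toNat with hgdef
  obtain ⟨u, hu⟩ := exists_eq_X_pow_mul hg.le
  have hu0 : PowerSeries.constantCoeff u ≠ 0 := by
    intro h0
    have h1 := PowerSeries.coeff_order hx
    rw [← hgdef, hu, PowerSeries.coeff_X_pow_mul', if_pos le_rfl, Nat.sub_self,
      PowerSeries.coeff_zero_eq_constantCoeff_apply] at h1
    exact h1 h0
  obtain ⟨v, hv⟩ := exists_eq_X_pow_mul (x := y) (g := g + 1) (by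
    rw [← hg] at h
    exact_mod_cast Order.add_one_le_of_lt h)
  refine ⟨PowerSeries.X * v * u⁻¹, ?_, by simp⟩
  rw [hv, hu, mul_assoc, mul_left_comm u⁻¹, PowerSeries.inv_mul_cancel _ hu0, pow_succ]
  ring

variable [Algebra ℂ L]

/-- A parametrization of an irreducible germ lifts to the blow-up, and passes through the same point
as the strict transform of the germ. -/
theorem exists_blowStep_of_evalAt_eq_zero {φ : PowerSeries L × PowerSeries L} (hφ : IsCentered φ)
    (hφ0 : φ ≠ 0) {p : Direction} {f : MvPowerSeries (Fin 2) ℂ} (hf : Irreducible f)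
    (hp : MvPowerSeries.constantCoeff (strictTransform p f) = 0) (hev : evalAt φ f = 0) :
    ∃ φ', BlowStep p φ φ' ∧ φ' ≠ 0 ∧ evalAt φ' (strictTransform p f) = 0 := by
  have key : ∃ φ', BlowStep p φ φ' ∧ φ' ≠ 0 := by
    cases p with
    | vertical =>
      have hlt := order_lt_of_evalAt_eq_zero_vertical hφ hφ0 hf hp hev
      have h0 : φ.2 ≠ 0 := fun h0 => by simp [h0] at hlt
      obtain ⟨w, hw, hw0⟩ := exists_eq_mul_of_order_lt hlt
      exact ⟨(w, φ.2), ⟨hφ, ⟨hw0, hφ.2⟩, h0, rfl, hw⟩, fun h => h0 (congrArg Prod.snd h)⟩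
    | slope a =>
      -- In tilted coordinates the branch is `(y - a x, x)`. The vertical case makes `y - a x` a
      -- multiple of `x` with quotient vanishing at the origin.
      set ψ : PowerSeries L × PowerSeries L :=
        (φ.2 - PowerSeries.C (algebraMap ℂ L a) * φ.1, φ.1) with hψ
      have hψc : IsCentered ψ := ⟨by simp [hψ, hφ.1, hφ.2], hφ.1⟩
      have hψ0 : ψ ≠ 0 := by
        intro h
        have h1 : φ.1 = 0 := congrArg Prod.snd h
        have h2 : φ.2 - PowerSeries.C (algebraMap ℂ L a) * φ.1 = 0 := congrArg Prod.fst h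
        rw [h1, mul_zero, sub_zero] at h2
        exact hφ0 (Prod.ext h1 h2)
      have hψev : evalAt ψ (tilt a f) = 0 := by
        rw [← hev, tilt_apply, evalAt, evalAt,
          MvPowerSeries.subst_comp_subst_apply (hasSubst_tiltMap a) hψc.hasSubst]
        congr 1
        funext i
        change evalAt ψ (tiltMap a i) = _
        fin_cases i
        · change evalAt ψ (MvPowerSeries.X 1) = φ.1
          rw [evalAt_X hψc]; rfl
        · change evalAt ψ (MvPowerSeries.X 0 + MvPowerSeries.C a * MvPowerSeries.X 1) = φ.2
          rw [evalAt_add hψc, evalAt_mul hψc, evalAt_X hψc, evalAt_X hψc, evalAt_C hψc]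
          simp [hψ]
      have hlt := order_lt_of_evalAt_eq_zero_vertical hψc hψ0 ((irreducible_tilt_iff a).mpr hf)
        (by rw [strictTransform_vertical_tilt]; exact constantCoeff_tilt_eq_zero 0 hp) hψev
      have h0 : φ.1 ≠ 0 := fun h0 => by simp [hψ, h0] at hlt
      obtain ⟨w, hw, hw0⟩ := exists_eq_mul_of_order_lt hlt
      refine ⟨(φ.1, w), ⟨hφ, ⟨hφ.1, hw0⟩, h0, rfl, ?_⟩, fun h => h0 (congrArg Prod.fst h)⟩
      have hw' : w * φ.1 = φ.2 - PowerSeries.C (algebraMap ℂ L a) * φ.1 := hw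
      change φ.1 * (w + _) = φ.2
      rw [mul_add, mul_comm, hw']; ring
  obtain ⟨φ', hs, h0⟩ := key
  refine ⟨φ', hs, h0, ?_⟩
  rw [hs.evalAt_eq, subst_blowUpMap_eq, evalAt_mul hs.centered', evalAt_pow hs.centered'] at hev
  refine (mul_eq_zero.mp hev).resolve_left (pow_ne_zero _ ?_)
  rw [Ne, ← PowerSeries.order_eq_top, hs.order_exc]
  exact ENat.natCast_ne_top _

end Lift

/-! ### Iterated lifts of parametrized branches -/

section Lift

open PowerSeries

variable {L : Type*} [Field L]

lemma order_eq_iff_exists {x : PowerSeries L} {D : ℕ} :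
    x.order = D ↔ ∃ u, x = X ^ D * u ∧ constantCoeff u ≠ 0 := by
  constructor
  · intro h
    obtain ⟨u, hu⟩ := exists_eq_X_pow_mul (g := D) h.ge
    refine ⟨u, hu, fun h0 => ?_⟩
    have := (PowerSeries.order_eq_nat.mp h).1
    rw [hu, coeff_X_pow_mul', if_pos le_rfl, Nat.sub_self, coeff_zero_eq_constantCoeff] at this
    exact this h0
  · rintro ⟨u, rfl, hu⟩
    rw [order_mul, order_X_pow, order_zero_of_unit (isUnit_iff_constantCoeff.mpr hu.isUnit),
      add_zero]

variable [Algebra ℂ L]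

lemma BlowStep.unique {q : Direction} {ψ ψ₁ ψ₂ : PowerSeries L × PowerSeries L}
    (h₁ : BlowStep q ψ ψ₁) (h₂ : BlowStep q ψ ψ₂) : ψ₁ = ψ₂ := by
  have e₁ := h₁.eq
  have e₂ := h₂.eq
  cases q with
  | slope a =>
    obtain ⟨h0, h1, h2⟩ := e₁
    obtain ⟨-, h3, h4⟩ := e₂
    refine Prod.ext (h1.trans h3.symm) ?_
    have := mul_left_cancel₀ h0 (h2.trans h4.symm)
    exact add_right_cancel this
  | vertical =>
    obtain ⟨h0, h1, h2⟩ := e₁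
    obtain ⟨-, h3, h4⟩ := e₂
    exact Prod.ext (mul_right_cancel₀ h0 (h2.trans h4.symm)) (h1.trans h3.symm)

open Classical in
/-- The lift of a parametrized branch to the blow-up, at the point of direction `q` (if it passes
through this point). -/
def blowParam (q : Direction) (ψ : PowerSeries L × PowerSeries L) :
    PowerSeries L × PowerSeries L :=
  if h : ∃ ψ', BlowStep q ψ ψ' then h.choose else 0

lemma BlowStep.blowParam_eq {q : Direction} {ψ ψ' : PowerSeries L × PowerSeries L}
    (h : BlowStep q ψ ψ') : blowParam q ψ = ψ' := by
  have hex : ∃ ψ', BlowStep q ψ ψ' := ⟨ψ', h⟩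
  rw [blowParam, dif_pos hex]
  exact hex.choose_spec.unique h

/-- The successive lifts of a parametrized branch. -/
def liftParam (p : ℕ → Direction) (ψ : PowerSeries L × PowerSeries L) :
    ℕ → PowerSeries L × PowerSeries L
  | 0 => ψ
  | e + 1 => blowParam (p e) (liftParam p ψ e)

/-- The parametrized branch passes through the points of directions `p 0, …, p (b - 1)`. -/
def CanLift (p : ℕ → Direction) (ψ : PowerSeries L × PowerSeries L) (b : ℕ) : Prop :=
  ∀ e < b, BlowStep (p e) (liftParam p ψ e) (liftParam p ψ (e + 1))

variable {p : ℕ → Direction} {ψ ψ' : PowerSeries L × PowerSeries L} {b : ℕ}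

lemma CanLift.mono (h : CanLift p ψ b) {b' : ℕ} (hb : b' ≤ b) : CanLift p ψ b' :=
  fun e he => h e (he.trans_le hb)

lemma liftParam_succ_eq (hs : BlowStep (p b) (liftParam p ψ b) ψ') :
    liftParam p ψ (b + 1) = ψ' :=
  hs.blowParam_eq

lemma CanLift.succ (h : CanLift p ψ b) (hs : BlowStep (p b) (liftParam p ψ b) ψ') :
    CanLift p ψ (b + 1) := by
  intro e he
  rcases Nat.lt_succ_iff_lt_or_eq.mp he with h' | rfl
  · exact h e h'
  · rwa [liftParam_succ_eq hs]

/-- A branch which lies on an irreducible germ passes through the same points. -/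
lemma canLift_of_evalAt_eq_zero {φ : PowerSeries L × PowerSeries L} (hφ : IsCentered φ)
    (hφ0 : φ ≠ 0) {f : MvPowerSeries (Fin 2) ℂ} (hf : Irreducible f) (hev : evalAt φ f = 0)
    {k : ℕ} (hp : ∀ j ≤ k, MvPowerSeries.constantCoeff (strictFrom p 0 j f) = 0) :
    CanLift p φ k := by
  have main : ∀ j ≤ k, CanLift p φ j ∧ Irreducible (strictFrom p 0 j f) ∧
      IsCentered (liftParam p φ j) ∧ liftParam p φ j ≠ 0 ∧
      evalAt (liftParam p φ j) (strictFrom p 0 j f) = 0 := by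
    intro j
    induction j with
    | zero => exact fun _ => ⟨fun e he => absurd he (Nat.not_lt_zero e), hf, hφ, hφ0, hev⟩
    | succ j ih =>
      intro hj
      obtain ⟨h1, h2, h3, h4, h5⟩ := ih (by omega)
      have hpj := hp (j + 1) hj
      simp only [strictFrom, zero_add] at hpj ⊢
      obtain ⟨φ', s1, s2, s3⟩ := exists_blowStep_of_evalAt_eq_zero h3 h4 h2 hpj h5
      refine ⟨h1.succ s1, irreducible_strictTransform h2 hpj, ?_⟩
      rw [liftParam_succ_eq s1]
      exact ⟨s1.centered', s2, s3⟩
  exact (main k le_rfl).1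

lemma BlowStep.order_lt_of_slope_zero (h : BlowStep (.slope 0) ψ ψ') : ψ.1.order < ψ.2.order := by
  obtain ⟨h0, h1, h2⟩ := h.eq
  have hpos : 1 ≤ ψ'.2.order := by
    rw [PowerSeries.one_le_order_iff_constCoeff_eq_zero]; exact h.centered'.2
  rw [← h2, map_zero, map_zero, add_zero, order_mul, ← PowerSeries.coe_toNat_order h0]
  cases hh : ψ'.2.order with
  | top => simp
  | coe r => rw [hh] at hpos; norm_cast at hpos ⊢; omega

lemma BlowStep.order_eq_of_slope {a : ℂ} (ha : a ≠ 0) (h : BlowStep (.slope a) ψ ψ') :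
    ψ.1.order = ψ.2.order := by
  obtain ⟨h0, h1, h2⟩ := h.eq
  rw [← h2, order_mul, order_zero_of_unit (f := ψ'.2 + _), add_zero]
  rw [isUnit_iff_constantCoeff, map_add, h.centered'.2]
  simpa using ha

lemma BlowStep.order_lt_of_vertical (h : BlowStep .vertical ψ ψ') : ψ.2.order < ψ.1.order := by
  obtain ⟨h0, h1, h2⟩ := h.eq
  have hpos : 1 ≤ ψ'.1.order := by
    rw [PowerSeries.one_le_order_iff_constCoeff_eq_zero]; exact h.centered'.1
  rw [← h2, order_mul, ← PowerSeries.coe_toNat_order h0]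
  cases hh : ψ'.1.order with
  | top => simp
  | coe r => rw [hh] at hpos; norm_cast at hpos ⊢; omega

lemma BlowStep.direction_eq_of_lt {q : Direction} (h : BlowStep q ψ ψ')
    (hlt : ψ.1.order < ψ.2.order) : q = .slope 0 := by
  cases q with
  | vertical => exact absurd h.order_lt_of_vertical hlt.not_gt
  | slope a =>
    by_contra hne
    exact hlt.ne (h.order_eq_of_slope fun h0 => hne (by rw [h0]))

lemma BlowStep.direction_eq_of_gt {q : Direction} (h : BlowStep q ψ ψ')
    (hlt : ψ.2.order < ψ.1.order) : q = .vertical := by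
  cases q with
  | vertical => rfl
  | slope a =>
    exfalso
    by_cases ha : a = 0
    · subst ha; exact h.order_lt_of_slope_zero.not_gt hlt
    · exact hlt.ne' (h.order_eq_of_slope ha)

lemma BlowStep.exists_slope_of_le {q : Direction} (h : BlowStep q ψ ψ')
    (hle : ψ.1.order ≤ ψ.2.order) : ∃ a, q = .slope a := by
  cases q with
  | vertical => exact absurd h.order_lt_of_vertical hle.not_gt
  | slope a => exact ⟨a, rfl⟩

lemma BlowStep.exists_slope_of_eq {q : Direction} (h : BlowStep q ψ ψ')
    (hle : ψ.1.order = ψ.2.order) : ∃ a, a ≠ 0 ∧ q = .slope a := by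
  obtain ⟨a, rfl⟩ := h.exists_slope_of_le hle.le
  refine ⟨a, ?_, rfl⟩
  rintro rfl
  exact h.order_lt_of_slope_zero.ne hle

/-! ### Conjugates of a complex branch. -/

/-- The branch obtained by the substitution `t ↦ ζ t`. -/
def twist (ζ : ℂ) (φ : PowerSeries ℂ × PowerSeries ℂ) : PowerSeries ℂ × PowerSeries ℂ :=
  (rescale ζ φ.1, rescale ζ φ.2)

lemma rescale_injective {ζ : ℂ} (hζ : ζ ≠ 0) : Function.Injective (rescale ζ) := by
  intro f g h
  ext k
  have := congrArg (coeff k) h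
  rw [coeff_rescale, coeff_rescale] at this
  exact mul_left_cancel₀ (pow_ne_zero k hζ) this

lemma constantCoeff_rescale (ζ : ℂ) (f : PowerSeries ℂ) :
    constantCoeff (rescale ζ f) = constantCoeff f := by
  rw [← coeff_zero_eq_constantCoeff_apply, coeff_rescale]; simp

lemma rescale_C' (ζ a : ℂ) : rescale ζ (C a : PowerSeries ℂ) = C a := by
  ext k
  rw [coeff_rescale, coeff_C]
  split_ifs with h <;> simp [h]

lemma BlowStep.twist {q : Direction} {φ φ' : PowerSeries ℂ × PowerSeries ℂ} (h : BlowStep q φ φ')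
    {ζ : ℂ} (hζ : ζ ≠ 0) : BlowStep q (twist ζ φ) (twist ζ φ') where
  centered := ⟨by simpa [PlaneBranch.twist, constantCoeff_rescale] using h.centered.1,
    by simpa [PlaneBranch.twist, constantCoeff_rescale] using h.centered.2⟩
  centered' := ⟨by simpa [PlaneBranch.twist, constantCoeff_rescale] using h.centered'.1,
    by simpa [PlaneBranch.twist, constantCoeff_rescale] using h.centered'.2⟩
  eq := by
    have e := h.eq
    have hne (x : PowerSeries ℂ) (hx : x ≠ 0) : rescale ζ x ≠ 0 := fun h0 =>
      hx (rescale_injective hζ (h0.trans (map_zero _).symm))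
    cases q with
    | slope a =>
      obtain ⟨h0, h1, h2⟩ := e
      refine ⟨hne _ h0, congrArg (rescale ζ) h1, ?_⟩
      have := congrArg (rescale ζ) h2
      rwa [map_mul, map_add, Algebra.algebraMap_self, RingHom.id_apply, rescale_C'] at this
    | vertical =>
      obtain ⟨h0, h1, h2⟩ := e
      refine ⟨hne _ h0, congrArg (rescale ζ) h1, ?_⟩
      have := congrArg (rescale ζ) h2
      rwa [map_mul] at this

/-- The blow-up equations have complex constants, free of `t`, so they commute with `t ↦ ζ t`. -/
lemma liftParam_twist {φ : PowerSeries ℂ × PowerSeries ℂ} (h : CanLift p φ b) {ζ : ℂ}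
    (hζ : ζ ≠ 0) : liftParam p (twist ζ φ) b = twist ζ (liftParam p φ b) := by
  induction b with
  | zero => rfl
  | succ b ih =>
    refine liftParam_succ_eq ?_
    rw [ih (h.mono (Nat.le_succ b))]
    exact (h b (Nat.lt_succ_self b)).twist hζ

end Lift

/-! ### Contact of parametrized branches -/

section Contact

open PowerSeries

variable {L : Type*} [Field L]

lemma constantCoeff_one_add {ρ : ℕ} (hρ : 0 < ρ) (w : PowerSeries L) :
    constantCoeff (1 + X ^ ρ * w) = 1 := by
  simp [hρ.ne']

variable [Algebra ℂ L]

variable (L) in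
/-- Extension of the coefficients of a complex power series to `L`. -/
abbrev ext (x : PowerSeries ℂ) : PowerSeries L := PowerSeries.map (algebraMap ℂ L) x

lemma ext_ne_zero {x : PowerSeries ℂ} (h : x ≠ 0) : ext L x ≠ 0 := fun h0 =>
  h (PowerSeries.map_injective _ (algebraMap ℂ L).injective (h0.trans (map_zero _).symm))

lemma constantCoeff_ext (x : PowerSeries ℂ) :
    constantCoeff (ext L x) = algebraMap ℂ L (constantCoeff x) := by
  rw [← coeff_zero_eq_constantCoeff_apply, coeff_map, coeff_zero_eq_constantCoeff_apply]

lemma constantCoeff_ext_ne_zero {x : PowerSeries ℂ} (h : constantCoeff x ≠ 0) :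
    constantCoeff (ext L x) ≠ 0 := by
  rw [constantCoeff_ext]
  exact (map_ne_zero _).mpr h

/-- The branch `ψ` has contact `ρ` with the complex branch `φ`, and the first term in which they
differ is a complex multiple of `c`. -/
def HasContact (ρ : ℕ) (c : L) (φ : PowerSeries ℂ × PowerSeries ℂ)
    (ψ : PowerSeries L × PowerSeries L) : Prop :=
  -- The first coordinates need only agree up to a unit factor, because a toric chain mixes the two
  -- coordinates. The unspecified complex factor `μ` does not affect transcendence.
  ∃ (w w' : PowerSeries L) (μ : ℂ), μ ≠ 0 ∧ ψ.1 = ext L φ.1 * (1 + X ^ ρ * w') ∧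
    ψ.2 = ext L φ.2 + X ^ ρ * w ∧ constantCoeff w = algebraMap ℂ L μ * c

lemma isCentered_of_hasContact {ρ : ℕ} (hρ : 0 < ρ) {c : L} {φ : PowerSeries ℂ × PowerSeries ℂ}
    {ψ : PowerSeries L × PowerSeries L} (hφ : IsCentered φ) (h : HasContact ρ c φ ψ) :
    IsCentered ψ := by
  obtain ⟨w, w', μ, -, h1, h2, -⟩ := h
  refine ⟨?_, ?_⟩
  · rw [h1, map_mul, constantCoeff_ext, hφ.1]; simp
  · rw [h2, map_add, constantCoeff_ext, hφ.2]; simp [hρ.ne']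

lemma le_order_iff_exists {y : PowerSeries ℂ} {D : ℕ} : (D : ℕ∞) ≤ y.order ↔ ∃ v, y = X ^ D * v := by
  refine ⟨exists_eq_X_pow_mul, ?_⟩
  rintro ⟨v, rfl⟩
  rw [order_mul, order_X_pow]
  exact le_self_add

/-- Contact drops by the multiplicity under a blow-up in which the first coordinate is minimal. -/
lemma HasContact.blowStep_slope {ρ D : ℕ} {c : L} {a : ℂ} {φ φ' : PowerSeries ℂ × PowerSeries ℂ}
    {ψ : PowerSeries L × PowerSeries L} (hs : BlowStep (.slope a) φ φ')
    (hD : φ.1.order = D) (h : HasContact ρ c φ ψ) (hρ : D < ρ) :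
    ∃ ψ', BlowStep (.slope a) ψ ψ' ∧ HasContact (ρ - D) c φ' ψ' := by
  have hcent := isCentered_of_hasContact (by omega) hs.centered h
  obtain ⟨w, w', μ, hμ, h1, h2, h3⟩ := h
  obtain ⟨u, hu, hu0⟩ := order_eq_iff_exists.mp hD
  obtain ⟨e0, e1, e2⟩ := hs.eq
  have hρ' : ρ = ρ - D + D := by omega
  set U : PowerSeries L := ext L u * (1 + X ^ ρ * w') with hU
  have hcU : constantCoeff U = algebraMap ℂ L (constantCoeff u) := by
    rw [hU, map_mul, constantCoeff_one_add (by omega), mul_one, constantCoeff_ext]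
  have hU0 : constantCoeff U ≠ 0 := by rw [hcU]; exact (map_ne_zero _).mpr hu0
  have hUinv : U * U⁻¹ = 1 := PowerSeries.mul_inv_cancel U hU0
  -- Here `ψ.1 = X^D U`, and `ψ.2 - ψ.1 (φ'.2 + a)` equals `X^ρ` times the bracket; dividing gives
  -- the difference of the lifted second coordinates. The bracket and `w` have the same constant
  -- term, as `φ.1` vanishes at `0`.
  set w₁ : PowerSeries L := (w - ext L φ.1 * w' * (ext L φ'.2 + C (algebraMap ℂ L a))) * U⁻¹
    with hw₁
  have hext1 : ext L φ.1 = X ^ D * ext L u := by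
    rw [hu]; simp only [ext, map_mul, map_pow, PowerSeries.map_X]
  have hext2 : ext L φ.2 = ext L φ.1 * (ext L φ'.2 + C (algebraMap ℂ L a)) := by
    rw [← e2]; simp only [ext, map_mul, map_add, PowerSeries.map_C, Algebra.algebraMap_self,
      RingHom.id_apply]
  have hcont : HasContact (ρ - D) c φ' (ψ.1, ext L φ'.2 + X ^ (ρ - D) * w₁) := by
    refine ⟨w₁, X ^ D * w', μ / constantCoeff u, div_ne_zero hμ hu0, ?_, rfl, ?_⟩
    · rw [e1, h1, ← mul_assoc, ← pow_add, ← hρ']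
    · have hx0 : constantCoeff (ext L φ.1) = 0 := by
        rw [constantCoeff_ext, hs.centered.1, map_zero]
      rw [hw₁, map_mul, map_sub, map_mul, map_mul, hx0, h3, PowerSeries.constantCoeff_inv, hcU,
        map_div₀]
      field_simp
      ring
  refine ⟨_, ⟨hcent, isCentered_of_hasContact (by omega) hs.centered' hcont, ?_, rfl, ?_⟩, hcont⟩
  · rw [h1]
    refine mul_ne_zero (ext_ne_zero e0) fun h0 => ?_
    have := constantCoeff_one_add (L := L) (show 0 < ρ by omega) w'
    rw [h0, map_zero] at this
    exact zero_ne_one this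
  · have key : ext L φ.1 * (1 + X ^ ρ * w') * (X ^ (ρ - D) * w₁) =
        X ^ ρ * (w - ext L φ.1 * w' * (ext L φ'.2 + C (algebraMap ℂ L a))) := by
      rw [hext1, hw₁]
      calc _ = (X ^ (ρ - D + D)) * (w - X ^ D * ext L u * w' *
              (ext L φ'.2 + C (algebraMap ℂ L a))) * (U * U⁻¹) := by rw [hU, pow_add, hext1]; ring
        _ = _ := by rw [hUinv, ← hρ']; ring
    rw [h2, h1, hext2]
    dsimp only
    linear_combination key

lemma order_ext (x : PowerSeries ℂ) : (ext L x).order = x.order := by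
  by_cases hx : x = 0
  · simp [hx, ext]
  · obtain ⟨u, hu, hu0⟩ := order_eq_iff_exists.mp (PowerSeries.coe_toNat_order hx).symm
    rw [← PowerSeries.coe_toNat_order hx]
    refine order_eq_iff_exists.mpr ⟨ext L u, ?_, constantCoeff_ext_ne_zero hu0⟩
    conv_lhs => rw [hu]
    simp only [ext, map_mul, map_pow, PowerSeries.map_X]

lemma HasContact.order_fst {ρ : ℕ} {c : L} {φ : PowerSeries ℂ × PowerSeries ℂ}
    {ψ : PowerSeries L × PowerSeries L} (hρ : 0 < ρ) (h : HasContact ρ c φ ψ) :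
    ψ.1.order = φ.1.order := by
  obtain ⟨w, w', μ, -, h1, -⟩ := h
  rw [h1, order_mul, order_ext, order_zero_of_unit (f := 1 + X ^ ρ * w'), add_zero]
  rw [isUnit_iff_constantCoeff, constantCoeff_one_add hρ]
  exact isUnit_one

lemma HasContact.le_order_snd {ρ D : ℕ} {c : L} {φ : PowerSeries ℂ × PowerSeries ℂ}
    {ψ : PowerSeries L × PowerSeries L} (hρ : D ≤ ρ) (h : HasContact ρ c φ ψ)
    (hD : (D : ℕ∞) ≤ φ.2.order) : (D : ℕ∞) ≤ ψ.2.order := by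
  obtain ⟨w, w', μ, -, -, h2, -⟩ := h
  rw [h2]
  refine le_trans (le_min ?_ ?_) (PowerSeries.min_order_le_order_add _ _)
  · rwa [order_ext]
  · rw [order_mul, order_X_pow]
    exact le_trans (by exact_mod_cast hρ) le_self_add

/-- The point is generic on the exceptional divisor for a branch of contact equal to the
multiplicity, with transcendental first difference. -/
lemma HasContact.isGeneric {D : ℕ} (hD1 : 1 ≤ D) {c : L} (hc : Transcendental ℂ c)
    {φ : PowerSeries ℂ × PowerSeries ℂ} {ψ : PowerSeries L × PowerSeries L}
    (h : HasContact D c φ ψ) (hD : φ.1.order = D) (hD' : (D : ℕ∞) ≤ φ.2.order) :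
    IsGeneric D ψ := by
  obtain ⟨w, w', μ, hμ, h1, h2, h3⟩ := h
  obtain ⟨u, hu, hu0⟩ := order_eq_iff_exists.mp hD
  obtain ⟨v, hv⟩ := le_order_iff_exists.mp hD'
  refine ⟨hD1, ext L u * (1 + X ^ D * w'), ext L v + w, Prod.ext ?_ ?_, ?_, ?_⟩
  · rw [h1, hu]; simp only [ext, map_mul, map_pow, PowerSeries.map_X]; ring
  · rw [h2, hv]; simp only [ext, map_mul, map_pow, PowerSeries.map_X]; ring
  · rw [map_mul, constantCoeff_one_add (by omega), mul_one]
    exact constantCoeff_ext_ne_zero hu0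
  · rw [map_mul, constantCoeff_one_add (by omega), mul_one, map_add, constantCoeff_ext,
      constantCoeff_ext, h3]
    intro halg
    apply hc
    have hu1 : algebraMap ℂ L (constantCoeff u) ≠ 0 := (map_ne_zero _).mpr hu0
    have hμ1 : algebraMap ℂ L μ ≠ 0 := (map_ne_zero _).mpr hμ
    have : c = ((algebraMap ℂ L (constantCoeff v) + algebraMap ℂ L μ * c) /
        algebraMap ℂ L (constantCoeff u) * algebraMap ℂ L (constantCoeff u) -
        algebraMap ℂ L (constantCoeff v)) * algebraMap ℂ L μ⁻¹ := by
      rw [map_inv₀]; field_simp; ring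
    rw [this]
    exact ((halg.mul (isAlgebraic_algebraMap _)).sub (isAlgebraic_algebraMap _)).mul
      (isAlgebraic_algebraMap _)

end Contact

/-! ### Toric chains of blow-ups -/

lemma euclidQuotients_pos {a b : ℕ} (h : b ≠ 0) :
    euclidQuotients a b = (a / b) :: euclidQuotients b (a % b) := by
  rw [euclidQuotients, dif_neg h]

lemma euclidQuotients_zero (a : ℕ) : euclidQuotients a 0 = [] := by
  rw [euclidQuotients, dif_pos rfl]

/-- The sum of the quotients in the Euclidean algorithm. -/
def euclidSum (a b : ℕ) : ℕ := (euclidQuotients a b).sum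

lemma euclidSum_pos {a b : ℕ} (h : b ≠ 0) : euclidSum a b = a / b + euclidSum b (a % b) := by
  rw [euclidSum, euclidQuotients_pos h, List.sum_cons, euclidSum]

lemma euclidSum_swap {a b : ℕ} (h : a < b) : euclidSum a b = euclidSum b a := by
  rw [euclidSum_pos (by omega), Nat.div_eq_of_lt h, Nat.mod_eq_of_lt h, zero_add]

/-- The sum of the quotients counts the steps of the subtractive algorithm, one for each blow-up of
a toric chain. -/
lemma euclidSum_sub_left {a b : ℕ} (hb : 0 < b) (h : b < a) :
    euclidSum a b = euclidSum (a - b) b + 1 := by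
  rw [euclidSum_pos hb.ne', euclidSum_pos hb.ne' (a := a - b), ← Nat.mod_eq_sub_mod h.le,
    Nat.div_eq_sub_div hb h.le]
  omega

lemma euclidSum_sub_right {a b : ℕ} (ha : 0 < a) (h : a < b) :
    euclidSum a b = euclidSum a (b - a) + 1 := by
  rw [euclidSum_swap h, euclidSum_sub_left ha h]
  rcases lt_trichotomy (b - a) a with h' | h' | h'
  · rw [euclidSum_swap h']
  · rw [h']
  · rw [euclidSum_swap h']

lemma euclidSum_self {a : ℕ} (ha : 0 < a) : euclidSum a a = 1 := by
  rw [euclidSum_pos ha.ne', Nat.div_self ha, Nat.mod_self, euclidSum, euclidQuotients_zero]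
  rfl

/-- Induction along the subtractive Euclidean algorithm. -/
lemma subtractive_induction {M : ℕ → ℕ → Prop} (self : ∀ a, 0 < a → M a a)
    (left : ∀ a b, 0 < b → b < a → M (a - b) b → M a b)
    (right : ∀ a b, 0 < a → a < b → M a (b - a) → M a b) (a b : ℕ) (ha : 0 < a) (hb : 0 < b) :
    M a b := by
  induction h : a + b using Nat.strong_induction_on generalizing a b with
  | _ s ih =>
    rcases lt_trichotomy a b with h' | rfl | h'
    · exact right a b ha h' (ih _ (by omega) a (b - a) ha (by omega) rfl)
    · exact self a ha
    · exact left a b hb h' (ih _ (by omega) (a - b) b (by omega) hb rfl)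

lemma euclidSum_one_le {a b : ℕ} (ha : 0 < a) (hb : 0 < b) : 1 ≤ euclidSum a b := by
  refine subtractive_induction (M := fun a b => 1 ≤ euclidSum a b) ?_ ?_ ?_ a b ha hb
  · intro a ha; rw [euclidSum_self ha]
  · intro a b hb h _; rw [euclidSum_sub_left hb h]; omega
  · intro a b hb h _; rw [euclidSum_sub_right hb h]; omega

section Toric

open PowerSeries

variable {L : Type*} [Field L]

lemma pmult_of_orders {φ : PowerSeries L × PowerSeries L} {P Q : ℕ}
    (hP : φ.1.order = P) (hQ : φ.2.order = Q) : pmult φ = min P Q := by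
  rw [pmult, hP, hQ]
  rcases le_total P Q with h | h
  · rw [min_eq_left h, min_eq_left (by exact_mod_cast h)]; rfl
  · rw [min_eq_right h, min_eq_right (by exact_mod_cast h)]; rfl

lemma order_mul_of_constantCoeff_ne_zero {x U : PowerSeries L} (hU : constantCoeff U ≠ 0) :
    (x * U).order = x.order := by
  rw [order_mul, order_zero_of_unit (isUnit_iff_constantCoeff.mpr hU.isUnit), add_zero]

variable [Algebra ℂ L]

lemma BlowStep.orders_of_gt {q : Direction} {φ φ' : PowerSeries L × PowerSeries L}
    (h : BlowStep q φ φ') {P Q : ℕ} (hP : φ.1.order = P) (hQ : φ.2.order = Q) (hlt : Q < P) :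
    φ'.1.order = (P - Q : ℕ) ∧ φ'.2.order = Q := by
  have hq := h.direction_eq_of_gt (by rw [hP, hQ]; exact_mod_cast hlt)
  subst hq
  obtain ⟨h0, h1, h2⟩ := h.eq
  refine ⟨?_, by rw [h1, hQ]⟩
  rw [← h2, order_mul, hQ] at hP
  cases hh : φ'.1.order with
  | top => simp [hh] at hP
  | coe r => rw [hh] at hP; norm_cast at hP ⊢; omega

lemma BlowStep.orders_of_lt {q : Direction} {φ φ' : PowerSeries L × PowerSeries L}
    (h : BlowStep q φ φ') {P Q : ℕ} (hP : φ.1.order = P) (hQ : φ.2.order = Q) (hlt : P < Q) :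
    φ'.1.order = P ∧ φ'.2.order = (Q - P : ℕ) := by
  have hq := h.direction_eq_of_lt (by rw [hP, hQ]; exact_mod_cast hlt)
  subst hq
  obtain ⟨h0, h1, h2⟩ := h.eq
  refine ⟨by rw [h1, hP], ?_⟩
  rw [map_zero, map_zero, add_zero] at h2
  rw [← h2, order_mul, hP] at hQ
  cases hh : φ'.2.order with
  | top => simp [hh] at hQ
  | coe r => rw [hh] at hQ; norm_cast at hQ ⊢; omega

/-- In a toric chain the orders of the coordinates obey the subtractive Euclidean algorithm. -/
theorem orders_toric {p : ℕ → Direction} {φ : PowerSeries L × PowerSeries L} {K : ℕ}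
    (hφ : CanLift p φ K) (P Q : ℕ) (hP0 : 0 < P) (hQ0 : 0 < Q) :
    ∀ b, (liftParam p φ b).1.order = P → (liftParam p φ b).2.order = Q →
      b + euclidSum P Q ≤ K →
      (liftParam p φ (b + (euclidSum P Q - 1))).1.order = (Nat.gcd P Q : ℕ) ∧
      (liftParam p φ (b + (euclidSum P Q - 1))).2.order = (Nat.gcd P Q : ℕ) ∧
      ∑ c ∈ Finset.range (b + euclidSum P Q), pmult (liftParam p φ c) ^ 2 =
        ∑ c ∈ Finset.range b, pmult (liftParam p φ c) ^ 2 + P * Q := by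
  -- A step removes from a `P × Q` rectangle the square on its shorter side, which is the
  -- multiplicity; so the squares add up to `P * Q`. At the last point, of index `euclidSum P Q - 1`
  -- in the chain, both orders are the gcd.
  refine subtractive_induction (M := fun P Q =>
    ∀ b, (liftParam p φ b).1.order = P → (liftParam p φ b).2.order = Q →
      b + euclidSum P Q ≤ K →
      (liftParam p φ (b + (euclidSum P Q - 1))).1.order = (Nat.gcd P Q : ℕ) ∧
      (liftParam p φ (b + (euclidSum P Q - 1))).2.order = (Nat.gcd P Q : ℕ) ∧
      ∑ c ∈ Finset.range (b + euclidSum P Q), pmult (liftParam p φ c) ^ 2 =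
        ∑ c ∈ Finset.range b, pmult (liftParam p φ c) ^ 2 + P * Q) ?_ ?_ ?_ P Q hP0 hQ0
  · intro a ha b hP hQ hK
    rw [euclidSum_self ha] at hK ⊢
    rw [Nat.gcd_self, Nat.sub_self, add_zero, Finset.sum_range_succ, pmult_of_orders hP hQ,
      min_self, sq]
    exact ⟨hP, hQ, rfl⟩
  · intro P Q hQ0 hlt ih b hP hQ hK
    have h1 := euclidSum_one_le (show 0 < P - Q by omega) hQ0
    rw [euclidSum_sub_left hQ0 hlt] at hK ⊢
    obtain ⟨o1, o2⟩ := (hφ b (by omega)).orders_of_gt hP hQ hlt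
    obtain ⟨r1, r2, r3⟩ := ih (b + 1) o1 o2 (by omega)
    rw [show b + 1 + (euclidSum (P - Q) Q - 1) = b + (euclidSum (P - Q) Q + 1 - 1) by omega,
      Nat.gcd_sub_self_left hlt.le] at r1 r2
    refine ⟨r1, r2, ?_⟩
    rw [show b + (euclidSum (P - Q) Q + 1) = b + 1 + euclidSum (P - Q) Q by omega, r3,
      Finset.sum_range_succ, pmult_of_orders hP hQ, min_eq_right hlt.le, Nat.sub_mul, add_assoc,
      sq, Nat.add_sub_cancel' (Nat.mul_le_mul_right Q hlt.le)]
  · intro P Q hQ0 hlt ih b hP hQ hK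
    have h1 := euclidSum_one_le hQ0 (show 0 < Q - P by omega)
    rw [euclidSum_sub_right hQ0 hlt] at hK ⊢
    obtain ⟨o1, o2⟩ := (hφ b (by omega)).orders_of_lt hP hQ hlt
    obtain ⟨r1, r2, r3⟩ := ih (b + 1) o1 o2 (by omega)
    rw [show b + 1 + (euclidSum P (Q - P) - 1) = b + (euclidSum P (Q - P) + 1 - 1) by omega,
      Nat.gcd_sub_self_right hlt.le] at r1 r2
    refine ⟨r1, r2, ?_⟩
    rw [show b + (euclidSum P (Q - P) + 1) = b + 1 + euclidSum P (Q - P) by omega, r3,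
      Finset.sum_range_succ, pmult_of_orders hP hQ, min_eq_left hlt.le, Nat.mul_sub, add_assoc,
      sq, Nat.add_sub_cancel' (Nat.mul_le_mul_left P hlt.le)]

/-- The branch whose coordinates are those of `φ` times `U` and `V`. -/
def scaleParam (φ : PowerSeries ℂ × PowerSeries ℂ) (U V : PowerSeries L) :
    PowerSeries L × PowerSeries L :=
  (ext L φ.1 * U, ext L φ.2 * V)

lemma isCentered_scaleParam {φ : PowerSeries ℂ × PowerSeries ℂ} (h : IsCentered φ)
    (U V : PowerSeries L) : IsCentered (scaleParam φ U V) := by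
  constructor
  · simp only [scaleParam, map_mul, constantCoeff_ext, h.1, map_zero, zero_mul]
  · simp only [scaleParam, map_mul, constantCoeff_ext, h.2, map_zero, zero_mul]

lemma pmult_scaleParam {φ : PowerSeries ℂ × PowerSeries ℂ} {U V : PowerSeries L}
    (hU : constantCoeff U ≠ 0) (hV : constantCoeff V ≠ 0) : pmult (scaleParam φ U V) = pmult φ := by
  simp only [pmult, scaleParam, order_mul_of_constantCoeff_ne_zero hU,
    order_mul_of_constantCoeff_ne_zero hV, order_ext]

lemma BlowStep.scaleParam_vertical {φ φ' : PowerSeries ℂ × PowerSeries ℂ}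
    (h : BlowStep .vertical φ φ') (U : PowerSeries L) {V : PowerSeries L}
    (hV : constantCoeff V ≠ 0) :
    BlowStep .vertical (scaleParam φ U V) (scaleParam φ' (U * V⁻¹) V) := by
  refine ⟨isCentered_scaleParam h.centered _ _, isCentered_scaleParam h.centered' _ _, ?_⟩
  obtain ⟨h0, h1, h2⟩ := h.eq
  refine ⟨mul_ne_zero (ext_ne_zero h0) fun h => hV (by rw [h, map_zero]), ?_, ?_⟩
  · simp only [scaleParam, h1]
  · have hVV := PowerSeries.mul_inv_cancel V hV
    have h3 : ext L φ'.1 * ext L φ.2 = ext L φ.1 := by rw [← h2, ext, ext, ext, map_mul]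
    simp only [scaleParam]
    linear_combination (ext L φ'.1 * ext L φ.2 * U) * hVV + U * h3

lemma BlowStep.scaleParam_slope {φ φ' : PowerSeries ℂ × PowerSeries ℂ}
    (h : BlowStep (.slope 0) φ φ') {U : PowerSeries L} (V : PowerSeries L)
    (hU : constantCoeff U ≠ 0) :
    BlowStep (.slope 0) (scaleParam φ U V) (scaleParam φ' U (V * U⁻¹)) := by
  refine ⟨isCentered_scaleParam h.centered _ _, isCentered_scaleParam h.centered' _ _, ?_⟩
  obtain ⟨h0, h1, h2⟩ := h.eq
  refine ⟨mul_ne_zero (ext_ne_zero h0) fun h => hU (by rw [h, map_zero]), ?_, ?_⟩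
  · simp only [scaleParam, h1]
  · have hVV := PowerSeries.mul_inv_cancel U hU
    rw [map_zero, map_zero, add_zero] at h2
    have h3 : ext L φ.1 * ext L φ'.2 = ext L φ.2 := by rw [← h2, ext, ext, ext, map_mul]
    simp only [scaleParam, map_zero, add_zero]
    linear_combination (ext L φ.1 * ext L φ'.2 * V) * hVV + V * h3

/-- The branch `ψ` passes through the same first `b` points as `φ`, with equal multiplicities. -/
def Follows (p : ℕ → Direction) (φ : PowerSeries ℂ × PowerSeries ℂ)
    (ψ : PowerSeries L × PowerSeries L) (b : ℕ) : Prop :=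
  CanLift p ψ b ∧ ∀ e < b, pmult (liftParam p ψ e) = pmult (liftParam p φ e)

lemma Follows.succ {p : ℕ → Direction} {φ : PowerSeries ℂ × PowerSeries ℂ}
    {ψ ψ' : PowerSeries L × PowerSeries L} {b : ℕ} (h : Follows p φ ψ b)
    (hs : BlowStep (p b) (liftParam p ψ b) ψ')
    (hm : pmult (liftParam p ψ b) = pmult (liftParam p φ b)) : Follows p φ ψ (b + 1) := by
  refine ⟨h.1.succ hs, fun e he => ?_⟩
  rcases Nat.lt_succ_iff_lt_or_eq.mp he with h' | rfl
  · exact h.2 e h'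
  · exact hm

/-- A branch whose coordinates differ from those of `φ` by unit factors follows `φ` in a toric chain
up to the last point; `R` is a relation satisfied by the unit factors. -/
theorem follows_toric {p : ℕ → Direction} {φ : PowerSeries ℂ × PowerSeries ℂ} {K : ℕ}
    (hφ : CanLift p φ K) {ψ : PowerSeries L × PowerSeries L}
    {R : ℕ → ℕ → PowerSeries L → PowerSeries L → Prop}
    (hU : ∀ P Q U V, R P Q U V → constantCoeff U ≠ 0)
    (hV : ∀ P Q U V, R P Q U V → constantCoeff V ≠ 0)
    (hl : ∀ P Q U V, Q < P → R P Q U V → R (P - Q) Q (U * V⁻¹) V)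
    (hr : ∀ P Q U V, P < Q → R P Q U V → R P (Q - P) U (V * U⁻¹))
    (P Q : ℕ) (hP0 : 0 < P) (hQ0 : 0 < Q) :
    ∀ b U V, (liftParam p φ b).1.order = P → (liftParam p φ b).2.order = Q →
      b + euclidSum P Q ≤ K → Follows p φ ψ b →
      liftParam p ψ b = scaleParam (liftParam p φ b) U V → R P Q U V →
      Follows p φ ψ (b + (euclidSum P Q - 1)) ∧ ∃ U' V', R (Nat.gcd P Q) (Nat.gcd P Q) U' V' ∧
        liftParam p ψ (b + (euclidSum P Q - 1)) =
          scaleParam (liftParam p φ (b + (euclidSum P Q - 1))) U' V' := by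
  -- The relation `R` stays abstract as it serves twice: for branches whose contact survives the
  -- chain, and for branches that become generic at its last point.
  refine subtractive_induction (M := fun P Q =>
    ∀ b U V, (liftParam p φ b).1.order = P → (liftParam p φ b).2.order = Q →
      b + euclidSum P Q ≤ K → Follows p φ ψ b →
      liftParam p ψ b = scaleParam (liftParam p φ b) U V → R P Q U V →
      Follows p φ ψ (b + (euclidSum P Q - 1)) ∧ ∃ U' V', R (Nat.gcd P Q) (Nat.gcd P Q) U' V' ∧
        liftParam p ψ (b + (euclidSum P Q - 1)) =
          scaleParam (liftParam p φ (b + (euclidSum P Q - 1))) U' V') ?_ ?_ ?_ P Q hP0 hQ0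
  · intro a ha b U V hP hQ hK hF hψ hR
    rw [euclidSum_self ha, Nat.gcd_self, Nat.sub_self, add_zero]
    exact ⟨hF, U, V, hR, hψ⟩
  · intro P Q hQ0 hlt ih b U V hP hQ hK hF hψ hR
    have h1 := euclidSum_one_le (show 0 < P - Q by omega) hQ0
    rw [euclidSum_sub_left hQ0 hlt] at hK ⊢
    have hs := hφ b (by omega)
    obtain ⟨o1, o2⟩ := hs.orders_of_gt hP hQ hlt
    have hdir := hs.direction_eq_of_gt (by rw [hP, hQ]; exact_mod_cast hlt)
    rw [hdir] at hs
    have hs' := hs.scaleParam_vertical U (hV _ _ _ _ hR)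
    rw [← hψ, ← hdir] at hs'
    have hF' := hF.succ hs' (by rw [hψ, pmult_scaleParam (hU _ _ _ _ hR) (hV _ _ _ _ hR)])
    have := ih (b + 1) _ _ o1 o2 (by omega) hF' (liftParam_succ_eq hs') (hl _ _ _ _ hlt hR)
    rwa [show b + 1 + (euclidSum (P - Q) Q - 1) = b + (euclidSum (P - Q) Q + 1 - 1) by omega,
      Nat.gcd_sub_self_left hlt.le] at this
  · intro P Q hQ0 hlt ih b U V hP hQ hK hF hψ hR
    have h1 := euclidSum_one_le hQ0 (show 0 < Q - P by omega)
    rw [euclidSum_sub_right hQ0 hlt] at hK ⊢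
    have hs := hφ b (by omega)
    obtain ⟨o1, o2⟩ := hs.orders_of_lt hP hQ hlt
    have hdir := hs.direction_eq_of_lt (by rw [hP, hQ]; exact_mod_cast hlt)
    rw [hdir] at hs
    have hs' := hs.scaleParam_slope V (hU _ _ _ _ hR)
    rw [← hψ, ← hdir] at hs'
    have hF' := hF.succ hs' (by rw [hψ, pmult_scaleParam (hU _ _ _ _ hR) (hV _ _ _ _ hR)])
    have := ih (b + 1) _ _ o1 o2 (by omega) hF' (liftParam_succ_eq hs') (hr _ _ _ _ hlt hR)
    rwa [show b + 1 + (euclidSum P (Q - P) - 1) = b + (euclidSum P (Q - P) + 1 - 1) by omega,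
      Nat.gcd_sub_self_right hlt.le] at this

end Toric

/-! ### Contact along the successive blow-ups of a branch -/

section Stage

open PowerSeries

/-- After `b` blow-ups the first coordinate of `φ` has order `D`, the branches of contact greater
than `δ` with `φ` follow it and lose `δ` of their contact, and the sum of the squares of the
multiplicities of `φ` is `A`. -/
structure Stage (p : ℕ → Direction) (φ : PowerSeries ℂ × PowerSeries ℂ) (b D δ A : ℕ) : Prop where
  order_fst : (liftParam p φ b).1.order = D
  -- All fields are allowed: `L = ℂ` serves for conjugate branches, and a transcendental extension
  -- for curvettes.
  lifts : ∀ (L : Type) [Field L] [Algebra ℂ L] (ρ : ℕ) (c : L) (ψ : PowerSeries L × PowerSeries L),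
    δ < ρ → HasContact ρ c φ ψ →
      Follows p φ ψ b ∧ HasContact (ρ - δ) c (liftParam p φ b) (liftParam p ψ b)
  sum_sq : ∑ e ∈ Finset.range b, pmult (liftParam p φ e) ^ 2 = A

variable {p : ℕ → Direction} {φ : PowerSeries ℂ × PowerSeries ℂ} {b D δ A Q : ℕ}

lemma stage_zero (h : φ.1.order = D) : Stage p φ 0 D 0 0 where
  order_fst := h
  lifts _ _ _ _ _ _ _ hc := ⟨⟨fun e he => absurd he (Nat.not_lt_zero e),
    fun e he => absurd he (Nat.not_lt_zero e)⟩, hc⟩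
  sum_sq := by simp

lemma pmult_eq_of_le {L : Type*} [Field L] {ψ : PowerSeries L × PowerSeries L}
    (h1 : ψ.1.order = D) (h2 : (D : ℕ∞) ≤ ψ.2.order) : pmult ψ = D := by
  rw [pmult, min_eq_left (h1.le.trans h2), h1]; rfl

/-- When the first coordinate realizes the multiplicity `D`, a blow-up costs contact `D`, and the
sum of squares grows by `D²`. -/
lemma Stage.free (h : Stage p φ b D δ A) (hφ : CanLift p φ (b + 1))
    (hy : (D : ℕ∞) ≤ (liftParam p φ b).2.order) : Stage p φ (b + 1) D (δ + D) (A + D ^ 2) := by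
  have hs := hφ b (Nat.lt_succ_self b)
  obtain ⟨a, ha⟩ := hs.exists_slope_of_le (h.order_fst.le.trans hy)
  rw [ha] at hs
  have hm : pmult (liftParam p φ b) = D := pmult_eq_of_le h.order_fst hy
  refine ⟨by rw [hs.eq.2.1, h.order_fst], ?_, by rw [Finset.sum_range_succ, h.sum_sq, hm]⟩
  intro L _ _ ρ c ψ hρ hψ
  obtain ⟨hF, hc⟩ := h.lifts L ρ c ψ (by omega) hψ
  obtain ⟨ψ', hs', hc'⟩ := hc.blowStep_slope hs h.order_fst (by omega)
  rw [← ha] at hs'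
  refine ⟨hF.succ hs' ?_, ?_⟩
  · rw [hm]
    exact pmult_eq_of_le ((hc.order_fst (by omega)).trans h.order_fst)
      (hc.le_order_snd (by omega) hy)
  · rw [liftParam_succ_eq hs', Nat.add_comm δ D, Nat.sub_add_eq, Nat.sub_right_comm]
    exact hc'

/-! ### Unit factors comparing two branches in a toric chain. -/

section Unit

variable {L : Type*} [Field L] [Algebra ℂ L]

/-- Dividing by the second coordinate, of order `Q`, turns an additive difference into a unit
factor. Toric blow-ups act on unit factors by mere multiplication and division. -/
lemma HasContact.exists_scaleParam {ρ κ Q : ℕ} {c : L} {φ : PowerSeries ℂ × PowerSeries ℂ}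
    {ψ : PowerSeries L × PowerSeries L} (h : HasContact ρ c φ ψ) (hQ : φ.2.order = Q)
    (hρ : ρ = κ + Q) : ∃ (v w' : PowerSeries L) (μ : ℂ), μ ≠ 0 ∧
      ψ = scaleParam φ (1 + X ^ ρ * w') (1 + X ^ κ * v) ∧
      constantCoeff v = algebraMap ℂ L μ * c := by
  obtain ⟨w, w', μ, hμ, h1, h2, h3⟩ := h
  obtain ⟨y, hy, hy0⟩ := order_eq_iff_exists.mp hQ
  have hy0' : constantCoeff (ext L y) ≠ 0 := constantCoeff_ext_ne_zero hy0
  have hinv := PowerSeries.mul_inv_cancel _ hy0'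
  refine ⟨w * (ext L y)⁻¹, w', μ / constantCoeff y, div_ne_zero hμ hy0, Prod.ext h1 ?_, ?_⟩
  · have hext : ext L φ.2 = X ^ Q * ext L y := by
      rw [hy]; simp only [ext, map_mul, map_pow, PowerSeries.map_X]
    simp only [scaleParam]
    rw [h2, hext, hρ, pow_add]
    linear_combination (-X ^ κ * X ^ Q * w) * hinv
  · rw [map_mul, h3, PowerSeries.constantCoeff_inv, constantCoeff_ext, map_div₀]
    field_simp

/-- The relation between the unit factors of two branches of positive contact in a toric chain. -/
def UnitContact (κ : ℕ) (c : L) (P Q : ℕ) (U V : PowerSeries L) : Prop :=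
  -- The determinant `P β - Q α` is invariant along the chain. At its end, where `P = Q`, it says
  -- that `α ≠ β`, so that the branches still differ at order `κ`.
  ∃ (u v : PowerSeries L) (α β : ℂ), U = 1 + X ^ κ * u ∧ V = 1 + X ^ κ * v ∧
    constantCoeff u = algebraMap ℂ L α * c ∧ constantCoeff v = algebraMap ℂ L β * c ∧
    (P : ℂ) * β - Q * α ≠ 0

lemma UnitContact.left {κ : ℕ} (hκ : 0 < κ) {c : L} {P Q : ℕ} {U V : PowerSeries L} (hlt : Q < P)
    (h : UnitContact κ c P Q U V) : UnitContact κ c (P - Q) Q (U * V⁻¹) V := by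
  obtain ⟨u, v, α, β, rfl, rfl, h1, h2, h3⟩ := h
  have hV : constantCoeff (1 + X ^ κ * v) ≠ 0 := by
    rw [constantCoeff_one_add hκ]; exact one_ne_zero
  have hVV := PowerSeries.mul_inv_cancel _ hV
  refine ⟨(u - v) * (1 + X ^ κ * v)⁻¹, v, α - β, β, ?_, rfl, ?_, h2, ?_⟩
  · linear_combination hVV
  · rw [map_mul, PowerSeries.constantCoeff_inv, constantCoeff_one_add hκ, map_sub, h1, h2, map_sub]
    ring
  · rw [Nat.cast_sub hlt.le]
    convert h3 using 1
    ring

lemma UnitContact.symm {κ : ℕ} {c : L} {P Q : ℕ} {U V : PowerSeries L}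
    (h : UnitContact κ c P Q U V) : UnitContact κ c Q P V U := by
  obtain ⟨u, v, α, β, hU, hV, h1, h2, h3⟩ := h
  refine ⟨v, u, β, α, hV, hU, h2, h1, ?_⟩
  rw [← neg_ne_zero]
  convert h3 using 1
  ring

lemma UnitContact.constantCoeff_ne_zero {κ : ℕ} (hκ : 0 < κ) {c : L} {P Q : ℕ}
    {U V : PowerSeries L} (h : UnitContact κ c P Q U V) : constantCoeff U ≠ 0 := by
  obtain ⟨u, v, α, β, rfl, -⟩ := h
  rw [constantCoeff_one_add hκ]; exact one_ne_zero

/-- The last blow-up of a toric chain. -/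
lemma UnitContact.blowStep_slope {κ : ℕ} (hκ : 0 < κ) {c : L} {g : ℕ} {U V : PowerSeries L}
    (h : UnitContact κ c g g U V) {φ φ' : PowerSeries ℂ × PowerSeries ℂ} {a : ℂ} (ha : a ≠ 0)
    (hs : BlowStep (.slope a) φ φ') :
    ∃ ψ', BlowStep (.slope a) (scaleParam φ U V) ψ' ∧ HasContact κ c φ' ψ' := by
  have hU0 := h.constantCoeff_ne_zero hκ
  have hUU := PowerSeries.mul_inv_cancel _ hU0
  obtain ⟨u, v, α, β, hU, hV, h1, h2, h3⟩ := h
  obtain ⟨e0, e1, e2⟩ := hs.eq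
  have hU1 : constantCoeff U = 1 := by rw [hU, constantCoeff_one_add hκ]
  -- The new quotient of coordinates is `(φ'.2 + a) V / U`, and `V / U - 1 = X^κ (v - u) / U`.
  set w : PowerSeries L := (ext L φ'.2 + C (algebraMap ℂ L a)) * (v - u) * U⁻¹ with hw
  have hcont : HasContact κ c φ' (ext L φ'.1 * U, ext L φ'.2 + X ^ κ * w) := by
    refine ⟨w, u, a * (β - α), mul_ne_zero ha fun h0 => h3 ?_, by rw [hU], rfl, ?_⟩
    · rw [← mul_sub, h0, mul_zero]
    · rw [hw, map_mul, map_mul, PowerSeries.constantCoeff_inv, hU1, map_add, constantCoeff_ext,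
        hs.centered'.2, map_sub, h1, h2]
      simp only [map_mul, map_sub, map_zero, zero_add, inv_one, mul_one, constantCoeff_C]
      ring
  refine ⟨_, ⟨isCentered_scaleParam hs.centered _ _,
    isCentered_of_hasContact hκ hs.centered' hcont, ?_, ?_, ?_⟩, hcont⟩
  · exact mul_ne_zero (ext_ne_zero e0) fun h => hU0 (by rw [h, map_zero])
  · simp only [scaleParam, e1]
  · have hext2 : ext L φ.2 = ext L φ.1 * (ext L φ'.2 + C (algebraMap ℂ L a)) := by
      rw [← e2]; simp only [ext, map_mul, map_add, PowerSeries.map_C, Algebra.algebraMap_self,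
        RingHom.id_apply]
    have hVU : V - U = X ^ κ * (v - u) := by rw [hU, hV]; ring
    simp only [scaleParam]
    rw [hext2, hw]
    linear_combination (ext L φ.1 * (ext L φ'.2 + C (algebraMap ℂ L a)) * X ^ κ * (v - u)) * hUU
      - (ext L φ.1 * (ext L φ'.2 + C (algebraMap ℂ L a))) * hVU

end Unit

/-- Passing to unit factors costs contact `Q`, the order of the second coordinate; the chain itself
costs nothing more, and its last blow-up turns the unit factors back into an additive contact. -/
lemma Stage.toric (h : Stage p φ b D δ A) (hD : 0 < D) (hQ0 : 0 < Q)
    (hφ : CanLift p φ (b + euclidSum D Q)) (hy : (liftParam p φ b).2.order = Q) :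
    Stage p φ (b + euclidSum D Q) (Nat.gcd D Q) (δ + Q) (A + D * Q) := by
  have h1 := euclidSum_one_le hD hQ0
  obtain ⟨o1, o2, o3⟩ := orders_toric hφ D Q hD hQ0 b h.order_fst hy le_rfl
  have hs := hφ (b + (euclidSum D Q - 1)) (by omega)
  have hlast : b + (euclidSum D Q - 1) + 1 = b + euclidSum D Q := by omega
  rw [hlast] at hs
  obtain ⟨a, ha0, ha⟩ := hs.exists_slope_of_eq (o1.trans o2.symm)
  rw [ha] at hs
  refine ⟨by rw [hs.eq.2.1, o1], ?_, by rw [o3, h.sum_sq]⟩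
  intro L _ _ ρ c ψ hρ hψ
  obtain ⟨hF, hc⟩ := h.lifts L ρ c ψ (by omega) hψ
  set κ := ρ - (δ + Q) with hκdef
  have hκ : 0 < κ := by omega
  obtain ⟨v, w', μ, hμ, hψb, hv⟩ := hc.exists_scaleParam (κ := κ) hy (by omega)
  -- The factor of the first coordinate is trivial up to order `κ + Q > κ`, so `α = 0`, and the
  -- determinant is `D μ`.
  have hR : UnitContact κ c D Q (1 + X ^ (ρ - δ) * w') (1 + X ^ κ * v) := by
    refine ⟨X ^ Q * w', v, 0, μ, ?_, rfl, ?_, hv, ?_⟩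
    · rw [← mul_assoc, ← pow_add]
      congr 3
      omega
    · simp [hQ0.ne']
    · simpa using ⟨hD.ne', hμ⟩
  obtain ⟨hF', U', V', hR', hψ'⟩ := follows_toric hφ (R := UnitContact κ c)
    (fun P Q U V hR => hR.constantCoeff_ne_zero hκ)
    (fun P Q U V hR => hR.symm.constantCoeff_ne_zero hκ)
    (fun P Q U V hlt hR => hR.left hκ hlt) (fun P Q U V hlt hR => (hR.symm.left hκ hlt).symm)
    D Q hD hQ0 b _ _ h.order_fst hy le_rfl hF hψb hR
  obtain ⟨ψ₁, hs', hc'⟩ := hR'.blowStep_slope hκ ha0 hs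
  rw [← hψ', ← ha] at hs'
  have hF'' := hF'.succ hs' (by rw [hψ', pmult_scaleParam (hR'.constantCoeff_ne_zero hκ)
    (hR'.symm.constantCoeff_ne_zero hκ)])
  have hl := liftParam_succ_eq hs'
  rw [hlast] at hF'' hl
  exact ⟨hF'', by rw [hl]; exact hc'⟩

lemma Stage.isGeneric_free (h : Stage p φ b D δ A) (hD : 0 < D)
    (hy : (D : ℕ∞) ≤ (liftParam p φ b).2.order) {L : Type} [Field L] [Algebra ℂ L] {c : L}
    (hc : Transcendental ℂ c) {ψ : PowerSeries L × PowerSeries L} (hψ : HasContact (δ + D) c φ ψ) :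
    Follows p φ ψ b ∧ IsGeneric D (liftParam p ψ b) ∧ pmult (liftParam p φ b) = D := by
  obtain ⟨hF, hc'⟩ := h.lifts L (δ + D) c ψ (by omega) hψ
  rw [Nat.add_sub_cancel_left] at hc'
  exact ⟨hF, hc'.isGeneric hD hc h.order_fst hy, pmult_eq_of_le h.order_fst hy⟩

/-- When the contact is exhausted (`κ = 0`), the constant term of `V` is transcendental. The
quantity `V^P / U^Q` at `0` is invariant along the chain; at its end it is a power of `V / U`, which
is therefore transcendental too. -/
lemma Stage.isGeneric_toric (h : Stage p φ b D δ A) (hD : 0 < D) (hQ0 : 0 < Q)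
    (hφ : CanLift p φ (b + euclidSum D Q)) (hy : (liftParam p φ b).2.order = Q)
    {L : Type} [Field L] [Algebra ℂ L] {c : L}
    (hc : Transcendental ℂ c) {ψ : PowerSeries L × PowerSeries L} (hψ : HasContact (δ + Q) c φ ψ) :
    Follows p φ ψ (b + (euclidSum D Q - 1)) ∧
      IsGeneric (Nat.gcd D Q) (liftParam p ψ (b + (euclidSum D Q - 1))) ∧
      pmult (liftParam p φ (b + (euclidSum D Q - 1))) = Nat.gcd D Q := by
  obtain ⟨o1, o2, -⟩ := orders_toric hφ D Q hD hQ0 b h.order_fst hy le_rfl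
  obtain ⟨hF, hc'⟩ := h.lifts L (δ + Q) c ψ (by omega) hψ
  rw [Nat.add_sub_cancel_left] at hc'
  obtain ⟨v, w', μ, hμ, hψb, hv⟩ := hc'.exists_scaleParam (κ := 0) hy (by omega)
  have hV : constantCoeff (1 + X ^ 0 * v) = 1 + algebraMap ℂ L μ * c := by simp [hv]
  have htr : Transcendental ℂ (constantCoeff (1 + X ^ 0 * v)) := by
    rw [hV]
    intro halg
    apply hc
    have hμ1 : algebraMap ℂ L μ ≠ 0 := (map_ne_zero _).mpr hμ
    have : c = (1 + algebraMap ℂ L μ * c - algebraMap ℂ L 1) * algebraMap ℂ L μ⁻¹ := by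
      rw [map_inv₀, map_one]; field_simp; ring
    rw [this]
    exact (halg.sub (isAlgebraic_algebraMap _)).mul (isAlgebraic_algebraMap _)
  let R : ℕ → ℕ → PowerSeries L → PowerSeries L → Prop := fun P Q U V =>
    constantCoeff U ≠ 0 ∧ constantCoeff V ≠ 0 ∧
      Transcendental ℂ (constantCoeff V ^ P / constantCoeff U ^ Q)
  have hU1 : constantCoeff (1 + X ^ Q * w') = 1 := constantCoeff_one_add hQ0 w'
  have hR : R D Q (1 + X ^ Q * w') (1 + X ^ 0 * v) := by
    refine ⟨by rw [hU1]; exact one_ne_zero, fun h0 => htr (by rw [h0]; exact isAlgebraic_zero), ?_⟩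
    rw [hU1, one_pow, div_one]
    exact htr.pow hD
  obtain ⟨hF', U', V', ⟨hU', hV', htr'⟩, hψ'⟩ := follows_toric hφ (R := R)
    (fun P Q U V hR => hR.1) (fun P Q U V hR => hR.2.1)
    (fun P Q U V hlt hR => by
      obtain ⟨h1, h2, h3⟩ := hR
      refine ⟨?_, h2, ?_⟩
      · rw [map_mul, PowerSeries.constantCoeff_inv]
        exact mul_ne_zero h1 (inv_ne_zero h2)
      · convert h3 using 1
        rw [map_mul, PowerSeries.constantCoeff_inv, ← Nat.sub_add_cancel hlt.le, pow_add,
          Nat.add_sub_cancel]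
        field_simp
        rw [div_pow, div_mul_cancel₀ _ (pow_ne_zero _ h2)])
    (fun P Q U V hlt hR => by
      obtain ⟨h1, h2, h3⟩ := hR
      refine ⟨h1, ?_, ?_⟩
      · rw [map_mul, PowerSeries.constantCoeff_inv]
        exact mul_ne_zero h2 (inv_ne_zero h1)
      · convert h3 using 1
        rw [map_mul, PowerSeries.constantCoeff_inv, ← Nat.sub_add_cancel hlt.le, pow_add,
          Nat.add_sub_cancel]
        field_simp
        rw [div_pow, div_mul_cancel₀ _ (pow_ne_zero _ h1)])
    D Q hD hQ0 b _ _ h.order_fst hy le_rfl hF hψb hR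
  refine ⟨hF', ?_, by rw [pmult_of_orders o1 o2, min_self]⟩
  obtain ⟨x, hx, hx0⟩ := order_eq_iff_exists.mp o1
  obtain ⟨y, hy, hy0⟩ := order_eq_iff_exists.mp o2
  rw [hψ']
  refine ⟨Nat.gcd_pos_of_pos_left _ hD, ext L x * U', ext L y * V', Prod.ext ?_ ?_, ?_, ?_⟩
  · simp only [scaleParam]
    rw [hx]; simp only [ext, map_mul, map_pow, PowerSeries.map_X]; ring
  · simp only [scaleParam]
    rw [hy]; simp only [ext, map_mul, map_pow, PowerSeries.map_X]; ring
  · rw [map_mul]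
    exact mul_ne_zero (constantCoeff_ext_ne_zero hx0) hU'
  · rw [map_mul, map_mul, constantCoeff_ext, constantCoeff_ext]
    intro halg
    apply htr'
    have hx1 : algebraMap ℂ L (constantCoeff x) ≠ 0 := (map_ne_zero _).mpr hx0
    have hy1 : algebraMap ℂ L (constantCoeff y) ≠ 0 := (map_ne_zero _).mpr hy0
    rw [← div_pow]
    refine IsAlgebraic.pow ?_ _
    have : constantCoeff V' / constantCoeff U' =
        (algebraMap ℂ L (constantCoeff y) * constantCoeff V' /
          (algebraMap ℂ L (constantCoeff x) * constantCoeff U')) *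
          algebraMap ℂ L (constantCoeff x / constantCoeff y) := by
      rw [map_div₀]; field_simp
    rw [this]
    exact halg.mul (isAlgebraic_algebraMap _)

/-- The terms of order less than the contact with a conjugate branch. -/
lemma Stage.coeff_snd (h : Stage p φ b D δ A) (hφ : CanLift p φ (b + 1)) {ζ : ℂ}
    (hζ : IsPrimitiveRoot ζ D) (hD : 0 < D) {M : ℕ} (hM : δ < M) {c : ℂ} (hc : c ≠ 0)
    (hcont : HasContact M c φ (twist ζ φ)) :
    (∀ e, e < D → e < M - δ → coeff e (liftParam p φ b).2 = 0) ∧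
      (M - δ < D → coeff (M - δ) (liftParam p φ b).2 ≠ 0) := by
  obtain ⟨-, w, w', μ, hμ, -, h2, h3⟩ := h.lifts ℂ M c _ hM hcont
  rw [liftParam_twist (hφ.mono (Nat.le_succ b)) (hζ.ne_zero hD.ne')] at h2
  -- The twist multiplies the coefficient at `t^e` by `ζ^e`. Below the remaining contact the two
  -- branches agree, so that coefficient vanishes unless `D` divides `e`; at the contact itself they
  -- differ.
  have hco (e : ℕ) : (ζ ^ e - 1) * coeff e (liftParam p φ b).2 = coeff e (X ^ (M - δ) * w) := by
    have := congrArg (coeff e) h2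
    simp only [PlaneBranch.twist, coeff_rescale, map_add, ext, coeff_map,
      Algebra.algebraMap_self, RingHom.id_apply] at this
    linear_combination this
  refine ⟨fun e he he' => ?_, fun hlt h0 => ?_⟩
  · rcases Nat.eq_zero_or_pos e with rfl | hpos
    · rw [coeff_zero_eq_constantCoeff_apply]
      exact (hφ b (Nat.lt_succ_self b)).centered.2
    · have := hco e
      rw [coeff_X_pow_mul', if_neg (by omega)] at this
      exact (mul_eq_zero.mp this).resolve_left
        (sub_ne_zero.mpr (hζ.pow_ne_one_of_pos_of_lt hpos.ne' he))
  · have := hco (M - δ)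
    rw [h0, mul_zero, coeff_X_pow_mul', if_pos le_rfl, Nat.sub_self,
      coeff_zero_eq_constantCoeff_apply, h3] at this
    exact mul_ne_zero hμ hc this.symm

end Stage

/-! ### Characteristic sequences -/

section CharSeq

variable {S : HahnSeries ℚ ℂ} {n g : ℕ} {m : ℕ → ℕ}

lemma polydromy_spec (h : IsPuiseux S) :
    0 < polydromy S ∧ ∀ q : ℚ, S.coeff q ≠ 0 → ∃ i : ℤ, q = (i : ℚ) / polydromy S := by
  have hne : {n : ℕ | 0 < n ∧ ∀ q : ℚ, S.coeff q ≠ 0 → ∃ i : ℤ, q = (i : ℚ) / n}.Nonempty := by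
    obtain ⟨n, hn, h⟩ := h
    refine ⟨n, hn, fun q hq => ?_⟩
    obtain ⟨i, -, hi⟩ := h q hq
    exact ⟨i, by simpa using hi⟩
  exact Nat.sInf_mem hne

lemma dgcd_succ_dvd (n : ℕ) (m : ℕ → ℕ) (i : ℕ) : dgcd n m (i + 1) ∣ dgcd n m i :=
  Nat.gcd_dvd_left _ _

lemma dgcd_dvd_of_le {i l : ℕ} (h : i ≤ l) : dgcd n m l ∣ dgcd n m i := by
  induction l, h using Nat.le_induction with
  | base => exact dvd_rfl
  | succ l _ ih => exact (dgcd_succ_dvd n m l).trans ih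

lemma dgcd_dvd (i : ℕ) : dgcd n m i ∣ n := dgcd_dvd_of_le (Nat.zero_le i)

lemma dgcd_dvd_m {i l : ℕ} (hi : 1 ≤ i) (h : i ≤ l) : dgcd n m l ∣ m i := by
  obtain ⟨i, rfl⟩ := Nat.exists_eq_add_of_le' hi
  exact (dgcd_dvd_of_le h).trans (Nat.gcd_dvd_right _ _)

namespace IsCharSeq

lemma n_pos (hc : IsCharSeq S n g m) : 0 < n := hc.polydromy_eq ▸ (polydromy_spec hc.puiseux).1

lemma exists_nat_of_coeff_ne (hc : IsCharSeq S n g m) {q : ℚ} (hq : S.coeff q ≠ 0) :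
    ∃ k : ℕ, n ≤ k ∧ q = (k : ℚ) / n := by
  obtain ⟨i, hi⟩ := (polydromy_spec hc.puiseux).2 q hq
  rw [hc.polydromy_eq] at hi
  have hn : (0 : ℚ) < n := by exact_mod_cast hc.n_pos
  have h1 := hc.one_le q hq
  rw [hi, le_div_iff₀ hn, one_mul] at h1
  have h2 : (n : ℤ) ≤ i := by exact_mod_cast h1
  refine ⟨i.toNat, by omega, ?_⟩
  rw [hi]
  congr 1
  have : ((i.toNat : ℤ) : ℚ) = (i : ℚ) := by rw [Int.toNat_of_nonneg (by omega)]
  exact_mod_cast this.symm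

lemma n_le_of_coeff_ne (hc : IsCharSeq S n g m) {k : ℕ}
    (hk : S.coeff ((k : ℚ) / n) ≠ 0) : n ≤ k := by
  obtain ⟨l, hl, h⟩ := hc.exists_nat_of_coeff_ne hk
  have hn : (n : ℚ) ≠ 0 := by exact_mod_cast hc.n_pos.ne'
  rw [div_left_inj' hn] at h
  have : k = l := by exact_mod_cast h
  omega

lemma dgcd_pos (hc : IsCharSeq S n g m) (i : ℕ) : 0 < dgcd n m i :=
  Nat.pos_of_dvd_of_pos (dgcd_dvd i) hc.n_pos

lemma dgcd_dvd_m' (hc : IsCharSeq S n g m) {i l : ℕ} (h : i ≤ l) : dgcd n m l ∣ m i := by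
  rcases Nat.eq_zero_or_pos i with rfl | hi
  · rw [hc.zero]; exact dvd_zero _
  · exact dgcd_dvd_m hi h

lemma not_dvd_succ (hc : IsCharSeq S n g m) {i : ℕ} (hi : i < g) : ¬ dgcd n m i ∣ m (i + 1) :=
  hc.not_dvd (i + 1) (by omega) hi

lemma dvd_of_lt (hc : IsCharSeq S n g m) {i : ℕ} (hi : i < g) {k : ℕ} (hk : k < m (i + 1))
    (h : S.coeff ((k : ℚ) / n) ≠ 0) :
    dgcd n m i ∣ k :=
  hc.first (i + 1) (by omega) hi k hk h

lemma m_lt_succ (hc : IsCharSeq S n g m) {i : ℕ} (hi : i < g) : m i < m (i + 1) := by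
  by_contra! hle
  rcases Nat.eq_zero_or_pos i with rfl | hpos
  · rw [hc.zero] at hle
    exact hc.not_dvd_succ hi (by rw [Nat.le_zero.mp hle]; exact dvd_zero _)
  · rcases hle.lt_or_eq with hlt | heq
    · have h1 := hc.first i hpos hi.le _ hlt (hc.coeff_ne (i + 1) (by omega) hi)
      exact hc.not_dvd_succ hi ((dgcd_dvd_of_le (Nat.sub_le i 1)).trans h1)
    · exact hc.not_dvd_succ hi (heq ▸ dgcd_dvd_m hpos le_rfl)

lemma dgcd_dvd_sub (hc : IsCharSeq S n g m) {i : ℕ} : dgcd n m (i + 1) ∣ m (i + 1) - m i :=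
  Nat.dvd_sub (dgcd_dvd_m (by omega) le_rfl) (hc.dgcd_dvd_m' (Nat.le_succ i))

lemma mod_pos (hc : IsCharSeq S n g m) {i : ℕ} (hi : i < g) :
    0 < (m (i + 1) - m i) % dgcd n m i := by
  rw [Nat.pos_iff_ne_zero]
  intro h0
  apply hc.not_dvd_succ hi
  have h1 := Nat.dvd_of_mod_eq_zero h0
  have h2 := (Nat.dvd_add_right (hc.dgcd_dvd_m' le_rfl)).mpr h1
  rwa [Nat.add_sub_cancel' (hc.m_lt_succ hi).le] at h2

lemma gcd_mod (hc : IsCharSeq S n g m) {i : ℕ} (hi : i < g) :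
    Nat.gcd (dgcd n m i) ((m (i + 1) - m i) % dgcd n m i) = dgcd n m (i + 1) := by
  rw [Nat.gcd_comm, ← Nat.gcd_rec]
  obtain ⟨q, hq⟩ := hc.dgcd_dvd_m' (le_refl i)
  have : m (i + 1) = m (i + 1) - m i + dgcd n m i * q := by
    rw [← hq, Nat.sub_add_cancel (hc.m_lt_succ hi).le]
  rw [dgcd]
  conv_rhs => rw [this]
  simp

lemma hZero_eq (hc : IsCharSeq S n g m) (i : ℕ) :
    hZero n m (i + 1) = (m (i + 1) - m i) / dgcd n m i := by
  rw [hZero, hList, Nat.add_sub_cancel, euclidQuotients_pos (hc.dgcd_pos i).ne']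
  rfl

/-- A block of centres consists of `h_{i+1,0}` blow-ups costing contact `d_i` each, then a toric
chain for the pair formed by `d_i` and the first remainder. -/
lemma gammaIdx_succ (hc : IsCharSeq S n g m) (i : ℕ) :
    gammaIdx n m (i + 1) = gammaIdx n m i + hZero n m (i + 1) +
    euclidSum (dgcd n m i) ((m (i + 1) - m i) % dgcd n m i) := by
  rw [gammaIdx, hList, Nat.add_sub_cancel, hc.hZero_eq, add_assoc]
  exact congrArg _ (euclidSum_pos (hc.dgcd_pos i).ne')

lemma hZero_mul_add (hc : IsCharSeq S n g m) (i : ℕ) : hZero n m (i + 1) * dgcd n m i +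
    (m (i + 1) - m i) % dgcd n m i = m (i + 1) - m i := by
  rw [hc.hZero_eq]; exact Nat.div_add_mod' _ _

lemma m_eq (hc : IsCharSeq S n g m) {i : ℕ} (hi : i < g) :
    m (i + 1) = m i + hZero n m (i + 1) * dgcd n m i +
    (m (i + 1) - m i) % dgcd n m i := by
  have h1 := hc.hZero_mul_add i
  have h2 := hc.m_lt_succ hi
  omega

lemma gammaIdx_lt_succ (hc : IsCharSeq S n g m) {i : ℕ} (hi : i < g) :
    gammaIdx n m i + hZero n m (i + 1) < gammaIdx n m (i + 1) := by
  have := euclidSum_one_le (hc.dgcd_pos i) (hc.mod_pos hi)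
  rw [hc.gammaIdx_succ]
  omega

end IsCharSeq

lemma gammaIdx_mono : Monotone (gammaIdx n m) :=
  monotone_nat_of_le_succ fun i => by rw [gammaIdx]; omega

/-- The sums `∑_{i < r} (m_{i+1} - m_i) d_i`. -/
def contactSum (n : ℕ) (m : ℕ → ℕ) (r : ℕ) : ℕ :=
  ∑ i ∈ Finset.range r, (m (i + 1) - m i) * dgcd n m i

lemma contactSum_succ (r : ℕ) :
    contactSum n m (r + 1) = contactSum n m r + (m (r + 1) - m r) * dgcd n m r :=
  Finset.sum_range_succ _ _

end CharSeq

/-! ### The blow-ups of a branch with given characteristic sequence -/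

section Blocks

open PowerSeries

/-- The parametrization of the branch with `y`-root `S`. -/
def branchParam (S : HahnSeries ℚ ℂ) (n : ℕ) : PowerSeries ℂ × PowerSeries ℂ :=
  (X ^ n, uniformized S n)

/-- The parametrized branch which agrees with the branch of `S` up to order `E` (excluded) and has
coefficient `ξ` at `E`. -/
def genericParam {L : Type*} [Field L] [Algebra ℂ L] (S : HahnSeries ℚ ℂ) (n E : ℕ) (ξ : L) :
    PowerSeries L × PowerSeries L :=
  (X ^ n, ext L ((trunc E (uniformized S n) : Polynomial ℂ) : PowerSeries ℂ) + X ^ E * C ξ)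

variable {S : HahnSeries ℚ ℂ} {n g : ℕ} {m : ℕ → ℕ}

lemma hasContact_genericParam {L : Type*} [Field L] [Algebra ℂ L] (S : HahnSeries ℚ ℂ) (n E : ℕ)
    (ξ : L) : HasContact E (ξ - algebraMap ℂ L (S.coeff ((E : ℚ) / n))) (branchParam S n)
      (genericParam S n E ξ) := by
  have hdvd : X ^ E ∣ uniformized S n - ((trunc E (uniformized S n) : Polynomial ℂ) : PowerSeries ℂ) := by
    rw [X_pow_dvd_iff]
    intro e he
    rw [map_sub, Polynomial.coeff_coe, coeff_trunc, if_pos he, sub_self]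
  obtain ⟨v, hv⟩ := hdvd
  have hv0 : constantCoeff v = S.coeff ((E : ℚ) / n) := by
    have := congrArg (coeff E) hv
    rw [map_sub, Polynomial.coeff_coe, coeff_trunc, if_neg (lt_irrefl E), coeff_X_pow_mul',
      if_pos le_rfl, Nat.sub_self, coeff_zero_eq_constantCoeff_apply, sub_zero, uniformized,
      coeff_mk] at this
    exact this.symm
  refine ⟨C ξ - ext L v, 0, 1, one_ne_zero, ?_, ?_, ?_⟩
  · simp [genericParam, branchParam, ext]
  · simp only [genericParam, branchParam]
    have := congrArg (ext L) (sub_eq_iff_eq_add.mp hv)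
    simp only [ext, map_add, map_mul, map_pow, PowerSeries.map_X] at this ⊢
    linear_combination -this
  · rw [map_sub, constantCoeff_ext, constantCoeff_C, hv0, map_one, one_mul]

lemma branchParam_ne_zero : branchParam S n ≠ 0 := by
  intro h
  have := congrArg Prod.fst h
  simp [branchParam] at this

namespace IsCharSeq

lemma isCentered_branchParam (hc : IsCharSeq S n g m) : IsCentered (branchParam S n) := by
  refine ⟨by simp [branchParam, hc.n_pos.ne'], ?_⟩
  rw [branchParam, ← coeff_zero_eq_constantCoeff_apply, uniformized, coeff_mk]
  by_contra h
  have := hc.n_le_of_coeff_ne (k := 0) (by simpa using h)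
  have := hc.n_pos
  omega

/-- A root of unity of order `d_i` fixes all terms before `m_{i+1}`, as `d_i` divides their
exponents, and moves the term at `m_{i+1}`. -/
lemma hasContact_twist (hc : IsCharSeq S n g m) {i : ℕ} (hi : i < g) {ζ : ℂ}
    (hζ : IsPrimitiveRoot ζ (dgcd n m i)) :
    ∃ c : ℂ, c ≠ 0 ∧
      HasContact (m (i + 1)) c (branchParam S n) (twist ζ (branchParam S n)) := by
  have hζk (k : ℕ) (hk : dgcd n m i ∣ k) : ζ ^ k = 1 := (hζ.pow_eq_one_iff_dvd k).mpr hk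
  have hdvd : X ^ m (i + 1) ∣ rescale ζ (uniformized S n) - uniformized S n := by
    rw [X_pow_dvd_iff]
    intro e he
    rw [map_sub, coeff_rescale, uniformized, coeff_mk]
    by_cases h0 : S.coeff ((e : ℚ) / n) = 0
    · rw [h0, mul_zero, sub_zero]
    · rw [hζk e (hc.dvd_of_lt hi he h0), one_mul, sub_self]
  obtain ⟨w, hw⟩ := hdvd
  have hw0 : constantCoeff w = (ζ ^ m (i + 1) - 1) * S.coeff ((m (i + 1) : ℚ) / n) := by
    have := congrArg (coeff (m (i + 1))) hw
    rw [map_sub, coeff_rescale, uniformized, coeff_mk, coeff_X_pow_mul', if_pos le_rfl,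
      Nat.sub_self, coeff_zero_eq_constantCoeff_apply] at this
    rw [← this]; ring
  refine ⟨(ζ ^ m (i + 1) - 1) * S.coeff ((m (i + 1) : ℚ) / n),
    mul_ne_zero ?_ (hc.coeff_ne (i + 1) (by omega) hi), w, 0, 1, one_ne_zero, ?_, ?_, ?_⟩
  · rw [sub_ne_zero, Ne, hζ.pow_eq_one_iff_dvd]
    exact hc.not_dvd_succ hi
  · simp only [PlaneBranch.twist, branchParam, ext, Algebra.algebraMap_self, PowerSeries.map_id,
      id_eq, mul_zero, add_zero, mul_one]
    ext k
    rw [coeff_rescale, coeff_X_pow]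
    split_ifs with h
    · rw [h, hζk n (dgcd_dvd i), one_mul]
    · rw [mul_zero]
  · simp only [PlaneBranch.twist, branchParam, ext, Algebra.algebraMap_self, PowerSeries.map_id,
      id_eq]
    rw [← hw]; ring
  · rw [hw0]; simp

/-- The squares of multiplicities in a block: `d_i²` for each initial blow-up, and `d_i` times the
remainder for the toric chain. -/
lemma contactSum_add_mul (hc : IsCharSeq S n g m) {i : ℕ} :
    contactSum n m i + hZero n m (i + 1) * dgcd n m i ^ 2 +
    dgcd n m i * ((m (i + 1) - m i) % dgcd n m i) = contactSum n m (i + 1) := by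
  rw [contactSum_succ, ← hc.hZero_mul_add i]
  ring_nf
  simp

variable {p : ℕ → Direction} {k : ℕ}

/-- The conjugate of `hasContact_twist` measures the second coordinate. Its order is at least `d_i`
as long as the remaining contact exceeds `d_i`; after `h_{i+1,0}` blow-ups the remaining contact is
the remainder, less than `d_i`, and the order equals it. -/
lemma stage_add (hc : IsCharSeq S n g m) (hφ : CanLift p (branchParam S n) k) {i : ℕ} (hi : i < g)
    (h : Stage p (branchParam S n) (gammaIdx n m i) (dgcd n m i) (m i) (contactSum n m i)) {j : ℕ}
    (hj : j ≤ hZero n m (i + 1)) (hjk : gammaIdx n m i + j ≤ k) :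
    Stage p (branchParam S n) (gammaIdx n m i + j) (dgcd n m i) (m i + j * dgcd n m i)
        (contactSum n m i + j * dgcd n m i ^ 2) ∧
      (gammaIdx n m i + j < k → if j < hZero n m (i + 1) then
        ((dgcd n m i : ℕ) : ℕ∞) ≤ (liftParam p (branchParam S n) (gammaIdx n m i + j)).2.order
        else (liftParam p (branchParam S n) (gammaIdx n m i + j)).2.order =
          ((m (i + 1) - m i) % dgcd n m i : ℕ)) := by
  have hd := hc.dgcd_pos i
  obtain ⟨ζ, hζ⟩ : ∃ ζ : ℂ, IsPrimitiveRoot ζ (dgcd n m i) :=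
    ⟨_, Complex.isPrimitiveRoot_exp _ hd.ne'⟩
  obtain ⟨c, hc0, hcont⟩ := hc.hasContact_twist hi hζ
  have hm := hc.m_eq hi
  have hr := hc.mod_pos hi
  have hrd := Nat.mod_lt (m (i + 1) - m i) hd
  set r := (m (i + 1) - m i) % dgcd n m i
  set d := dgcd n m i
  have second {j : ℕ} (hj : j ≤ hZero n m (i + 1)) (hst : Stage p (branchParam S n)
      (gammaIdx n m i + j) d (m i + j * d) (contactSum n m i + j * d ^ 2))
      (hjk : gammaIdx n m i + j < k) : if j < hZero n m (i + 1) then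
        ((d : ℕ) : ℕ∞) ≤ (liftParam p (branchParam S n) (gammaIdx n m i + j)).2.order
        else (liftParam p (branchParam S n) (gammaIdx n m i + j)).2.order = (r : ℕ) := by
    have hjd : j * d ≤ hZero n m (i + 1) * d := Nat.mul_le_mul_right d hj
    obtain ⟨h1, h2⟩ := hst.coeff_snd (hφ.mono hjk) hζ hd (by omega) hc0 hcont
    split_ifs with hlt
    · have : (j + 1) * d ≤ hZero n m (i + 1) * d := Nat.mul_le_mul_right d hlt
      rw [Nat.add_mul, one_mul] at this
      exact PowerSeries.nat_le_order _ _ fun e he => h1 e he (by omega)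
    · have hje : j = hZero n m (i + 1) := by omega
      have hM : m (i + 1) - (m i + j * d) = r := by rw [hje]; omega
      rw [hM] at h1 h2
      exact PowerSeries.order_eq_nat.mpr ⟨h2 hrd, fun e he => h1 e (by omega) he⟩
  have first : Stage p (branchParam S n) (gammaIdx n m i + j) d (m i + j * d)
      (contactSum n m i + j * d ^ 2) := by
    induction j with
    | zero => simpa using h
    | succ j ih =>
      have hst := ih (by omega) (by omega)
      have h2 := second (by omega) hst (by omega)
      rw [if_pos (by omega)] at h2
      have := hst.free (hφ.mono hjk) h2
      rwa [show gammaIdx n m i + j + 1 = gammaIdx n m i + (j + 1) by omega,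
        show m i + j * d + d = m i + (j + 1) * d by ring,
        show contactSum n m i + j * d ^ 2 + d ^ 2 = contactSum n m i + (j + 1) * d ^ 2 by ring]
        at this
  exact ⟨first, second hj first⟩

lemma stage_gammaIdx (hc : IsCharSeq S n g m) (hφ : CanLift p (branchParam S n) k) {i : ℕ}
    (hi : i ≤ g) (hik : gammaIdx n m i ≤ k) :
    Stage p (branchParam S n) (gammaIdx n m i) (dgcd n m i) (m i) (contactSum n m i) := by
  induction i with
  | zero =>
    rw [hc.zero]
    exact stage_zero (by simp [branchParam, dgcd])
  | succ i ih =>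
    have hlt := hc.gammaIdx_lt_succ (show i < g by omega)
    have hs := hc.stage_add hφ (show i < g by omega) (ih (by omega) (by omega)) le_rfl (by omega)
    have hy := hs.2 (by omega)
    rw [if_neg (lt_irrefl _)] at hy
    have := hs.1.toric (hc.dgcd_pos i) (hc.mod_pos hi)
      (hφ.mono (by rw [← hc.gammaIdx_succ]; exact hik)) hy
    rwa [← hc.gammaIdx_succ, hc.gcd_mod hi, hc.contactSum_add_mul, ← hc.m_eq hi] at this

end IsCharSeq

end Blocks

/-! ### Intersection numbers of curvettes -/

section Curvette

open PowerSeries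

variable {S : HahnSeries ℚ ℂ} {n g : ℕ} {m : ℕ → ℕ}

lemma transcendental_sub_algebraMap {L : Type*} [Field L] [Algebra ℂ L] {ξ : L}
    (hξ : Transcendental ℂ ξ) (a : ℂ) : Transcendental ℂ (ξ - algebraMap ℂ L a) := by
  intro h
  apply hξ
  have := h.add (isAlgebraic_algebraMap a)
  rwa [sub_add_cancel] at this

namespace IsCharSeq

variable {p : ℕ → Direction} {k : ℕ}

lemma sum_sq_stage (hc : IsCharSeq S n g m) (hφ : CanLift p (branchParam S n) k) {i j : ℕ}
    (h : (1 ≤ i ∧ i < g ∧ j ≤ hZero n m (i + 1)) ∨ (1 ≤ i ∧ i ≤ g ∧ j = 0))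
    (hk : gammaIdx n m i + j ≤ k) :
    ∑ e ∈ Finset.range (gammaIdx n m i + j), pmult (liftParam p (branchParam S n) e) ^ 2 =
      contactSum n m i + j * dgcd n m i ^ 2 := by
  have hst := hc.stage_gammaIdx hφ (show i ≤ g by omega) (by omega)
  rcases h with h | h
  · exact (hc.stage_add hφ h.2.1 hst h.2.2 hk).1.sum_sq
  · obtain ⟨-, -, rfl⟩ := h
    simpa using hst.sum_sq

variable {L : Type} [Field L] [Algebra ℂ L] {ξ : L}

/-- The generic branch which agrees with the branch of `S` up to order `m_i + j d_i` is a curvette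
at the point of index `γ_i + j`. -/
lemma curvette (hc : IsCharSeq S n g m) (hφ : CanLift p (branchParam S n) k)
    (hξ : Transcendental ℂ ξ) {i j : ℕ}
    (h : (1 ≤ i ∧ i < g ∧ j ≤ hZero n m (i + 1)) ∨ (1 ≤ i ∧ i ≤ g ∧ j = 0))
    (hk : gammaIdx n m i + j ≤ k) : ∃ a, gammaIdx n m i + j = a + 1 ∧
      Follows p (branchParam S n) (genericParam S n (m i + j * dgcd n m i) ξ) a ∧
      IsGeneric (dgcd n m i)
        (liftParam p (genericParam S n (m i + j * dgcd n m i) ξ) a) ∧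
      pmult (liftParam p (branchParam S n) a) = dgcd n m i := by
  have hcont := hasContact_genericParam (L := L) S n (m i + j * dgcd n m i) ξ
  have htr := transcendental_sub_algebraMap hξ
    (S.coeff ((m i + j * dgcd n m i : ℕ) / (n : ℚ)))
  -- The point `q_{γ_i}` ends the toric chain of the preceding block, while `q_{γ_i+j}` with `j > 0`
  -- is the point reached after `j - 1` blow-ups of the new block. The index `a` is counted from
  -- `0`.
  rcases Nat.eq_zero_or_pos j with rfl | hj
  · obtain ⟨i, rfl⟩ : ∃ i', i = i' + 1 := ⟨i - 1, by omega⟩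
    have hi : i < g := by omega
    have hlt := hc.gammaIdx_lt_succ hi
    obtain ⟨h1, h2⟩ := hc.stage_add hφ hi (hc.stage_gammaIdx hφ hi.le (by omega)) le_rfl
      (by omega)
    have hy := h2 (by omega)
    rw [if_neg (lt_irrefl _)] at hy
    have hes := euclidSum_one_le (hc.dgcd_pos i) (hc.mod_pos hi)
    have hγ := hc.gammaIdx_succ i
    rw [zero_mul, add_zero] at hcont htr ⊢
    conv at hcont => enter [1]; rw [hc.m_eq hi]
    have := h1.isGeneric_toric (hc.dgcd_pos i) (hc.mod_pos hi) (hφ.mono (by omega)) hy htr hcont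
    rw [hc.gcd_mod hi] at this
    exact ⟨_, by omega, this⟩
  · obtain ⟨j, rfl⟩ : ∃ j', j = j' + 1 := ⟨j - 1, by omega⟩
    have h' : 1 ≤ i ∧ i < g ∧ j + 1 ≤ hZero n m (i + 1) := by
      rcases h with h | h
      · exact h
      · omega
    obtain ⟨h1, h2⟩ := hc.stage_add hφ h'.2.1 (hc.stage_gammaIdx hφ h'.2.1.le (by omega))
      (show j ≤ _ by omega) (by omega)
    have hy := h2 (by omega)
    rw [if_pos (by omega)] at hy
    conv at hcont => enter [1]; rw [Nat.add_mul, one_mul, ← add_assoc]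
    exact ⟨_, rfl, h1.isGeneric_free (hc.dgcd_pos i) hy htr hcont⟩

/-- The curvette has the multiplicities of the branch of `S` up to the point where it is generic.
Hence these rows are truncations of a single sequence, divided by `d_i`. -/
lemma dgcd_mul_Xrow (hc : IsCharSeq S n g m) (hφ : CanLift p (branchParam S n) k)
    (hξ : Transcendental ℂ ξ) {i j : ℕ}
    (h : (1 ≤ i ∧ i < g ∧ j ≤ hZero n m (i + 1)) ∨ (1 ≤ i ∧ i ≤ g ∧ j = 0))
    (hk : gammaIdx n m i + j ≤ k) (c : Fin k) :
    (dgcd n m i : ℤ) * Xrow k p (gammaIdx n m i + j) c =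
      if (c : ℕ) < gammaIdx n m i + j then (pmult (liftParam p (branchParam S n) c) : ℤ)
      else 0 := by
  obtain ⟨a, ha, hF, hgen, hm⟩ := hc.curvette hφ hξ h hk
  rw [ha, mul_Xrow hF.1 hgen (by omega) c]
  split_ifs with h1 h2 h2
  · rcases h1.lt_or_eq with h3 | h3
    · rw [hF.2 _ h3]
    · rw [h3, hgen.pmult_eq, hm]
  · omega
  · omega
  · rfl

/-- The products of the rows `X_{γ_i + j}` and `X_{γ_l}`. -/
theorem Xrow_dotProduct_Xrow (hc : IsCharSeq S n g m) (hφ : CanLift p (branchParam S n) k)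
    (hξ : Transcendental ℂ ξ) {i j l : ℕ}
    (h : (1 ≤ i ∧ i < g ∧ j ≤ hZero n m (i + 1)) ∨ (1 ≤ i ∧ i ≤ g ∧ j = 0))
    (hk : gammaIdx n m i + j ≤ k) (hl : 1 ≤ l) (hlg : l ≤ g) (hlk : gammaIdx n m l ≤ k) :
    (dgcd n m i * dgcd n m l : ℤ) *
      (Xrow k p (gammaIdx n m i + j) ⬝ᵥ Xrow k p (gammaIdx n m l)) =
      if l ≤ i then (contactSum n m l : ℤ) else contactSum n m i + j * dgcd n m i ^ 2 := by
  have hL : (1 ≤ l ∧ l < g ∧ 0 ≤ hZero n m (l + 1)) ∨ (1 ≤ l ∧ l ≤ g ∧ 0 = 0) :=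
    Or.inr ⟨hl, hlg, rfl⟩
  have e1 := hc.dgcd_mul_Xrow hφ hξ h hk
  have e2 := hc.dgcd_mul_Xrow hφ hξ hL hlk
  have e3 := hc.sum_sq_stage hφ h hk
  have e4 := hc.sum_sq_stage hφ hL hlk
  simp only [add_zero, zero_mul] at e2 e4
  have hmin : (if l ≤ i then gammaIdx n m l else gammaIdx n m i + j) ≤ k := by
    split_ifs <;> assumption
  have key : (dgcd n m i * dgcd n m l : ℤ) *
      (Xrow k p (gammaIdx n m i + j) ⬝ᵥ Xrow k p (gammaIdx n m l)) =
      ∑ e ∈ Finset.range (if l ≤ i then gammaIdx n m l else gammaIdx n m i + j),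
        (pmult (liftParam p (branchParam S n) e) ^ 2 : ℤ) := by
    -- The product of two truncations of one sequence is the sum of squares up to the smaller index;
    -- that is `γ_l` if `l ≤ i`, and otherwise `γ_i + j`, since the block of `i` ends before `γ_l`.
    have hiff (c : ℕ) : (c < gammaIdx n m i + j ∧ c < gammaIdx n m l) ↔
        c < (if l ≤ i then gammaIdx n m l else gammaIdx n m i + j) := by
      split_ifs with hli
      · have := gammaIdx_mono (n := n) (m := m) hli
        omega
      · have h1 : i < g := by omega
        have := gammaIdx_mono (n := n) (m := m) (show i + 1 ≤ l by omega)
        have := hc.gammaIdx_lt_succ h1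
        omega
    set N := if l ≤ i then gammaIdx n m l else gammaIdx n m i + j
    rw [dotProduct, Finset.mul_sum]
    have hterm (c : Fin k) : (dgcd n m i * dgcd n m l : ℤ) *
        (Xrow k p (gammaIdx n m i + j) c * Xrow k p (gammaIdx n m l) c) =
        if (c : ℕ) < N then (pmult (liftParam p (branchParam S n) c) ^ 2 : ℤ) else 0 := by
      rw [mul_mul_mul_comm, e1, e2, ite_mul, mul_ite, zero_mul, mul_zero, ← ite_and]
      simp only [hiff, sq]
    rw [Finset.sum_congr rfl fun c _ => hterm c, Fin.sum_univ_eq_sum_range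
      (fun c => if c < N then (pmult (liftParam p (branchParam S n) c) ^ 2 : ℤ) else 0) k,
      ← Finset.sum_filter]
    congr 1
    ext c
    simp only [Finset.mem_filter, Finset.mem_range]
    omega
  rw [key]
  split_ifs with hli
  · exact_mod_cast e4
  · exact_mod_cast e3

/-- The products of the row `X_{γ_l}` and multiplicity vectors. -/
theorem ordVec_dotProduct_Xrow (hc : IsCharSeq S n g m) (hφ : CanLift p (branchParam S n) k)
    (hξ : Transcendental ℂ ξ) {l : ℕ} (hl : 1 ≤ l) (hlg : l ≤ g) (hlk : gammaIdx n m l ≤ k)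
    {G : MvPowerSeries (Fin 2) ℂ} (hG : evalAt (genericParam S n (m l) ξ) G ≠ 0) :
    (dgcd n m l : ℤ) * (ordVec k p G ⬝ᵥ Xrow k p (gammaIdx n m l)) =
      ((evalAt (genericParam S n (m l) ξ) G).order.toNat : ℤ) := by
  obtain ⟨a, ha, hF, hgen, hm⟩ := hc.curvette hφ hξ (i := l) (j := 0)
    (Or.inr ⟨hl, hlg, rfl⟩) (by omega)
  simp only [zero_mul, add_zero] at ha hF hgen
  rw [ha]
  exact mul_ordVec_dotProduct_Xrow (θ := liftParam p (genericParam S n (m l) ξ)) hF.1 hgen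
    (by omega) hG

end IsCharSeq

end Curvette

/-! ### Products over the conjugates of a series in `u = x^{1/N}` -/

section Conjugates

open Polynomial

/-- `τ(ζ u)`. -/
def conjPoly (τ : ℂ[X]) (ζ : ℂ) : ℂ[X] := τ.comp (C ζ * X)

lemma conjPoly_one (τ : ℂ[X]) : conjPoly τ 1 = τ := by simp [conjPoly]

lemma coeff_conjPoly (τ : ℂ[X]) (ζ : ℂ) (k : ℕ) : (conjPoly τ ζ).coeff k = τ.coeff k * ζ ^ k := by
  rw [conjPoly, comp_C_mul_X_coeff]

lemma conjPoly_comp (τ : ℂ[X]) (ζ ζ' : ℂ) :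
    (conjPoly τ ζ).comp (C ζ' * X) = conjPoly τ (ζ * ζ') := by
  change conjPoly (conjPoly τ ζ) ζ' = _
  ext k
  simp only [coeff_conjPoly, mul_pow, mul_assoc]

/-- `∏_{ζ^N = 1} (Y - τ(ζ u))`. -/
def conjProd (N : ℕ) (τ : ℂ[X]) : ℂ[X][X] :=
  ∏ ζ ∈ nthRootsFinset N (1 : ℂ), (X - C (conjPoly τ ζ))

lemma conjProd_monic (N : ℕ) (τ : ℂ[X]) : (conjProd N τ).Monic :=
  monic_prod_of_monic _ _ fun _ _ => monic_X_sub_C _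

lemma card_nthRootsFinset_complex {N : ℕ} (hN : 0 < N) :
    (nthRootsFinset N (1 : ℂ)).card = N :=
  (Complex.isPrimitiveRoot_exp N hN.ne').card_nthRootsFinset

lemma conjProd_natDegree {N : ℕ} (hN : 0 < N) (τ : ℂ[X]) : (conjProd N τ).natDegree = N := by
  rw [conjProd, natDegree_prod_of_monic _ _ fun _ _ => monic_X_sub_C _]
  simp [card_nthRootsFinset_complex hN]

lemma conjProd_map {N : ℕ} (hN : 0 < N) (τ : ℂ[X]) {ζ₀ : ℂ} (hζ : ζ₀ ^ N = 1) :
    (conjProd N τ).map (compRingHom (C ζ₀ * X)) = conjProd N τ := by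
  have hζ0 : ζ₀ ≠ 0 := by
    rintro rfl
    rw [zero_pow hN.ne'] at hζ
    exact zero_ne_one hζ
  rw [conjProd, Polynomial.map_prod]
  refine Finset.prod_nbij' (fun ζ => ζ * ζ₀) (fun ζ => ζ * ζ₀⁻¹) ?_ ?_ ?_ ?_ ?_
  · intro ζ h
    rw [mem_nthRootsFinset hN] at h ⊢
    rw [mul_pow, h, hζ, mul_one]
  · intro ζ h
    rw [mem_nthRootsFinset hN] at h ⊢
    rw [mul_pow, h, inv_pow, hζ, inv_one, mul_one]
  · intro ζ _
    rw [mul_assoc, mul_inv_cancel₀ hζ0, mul_one]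
  · intro ζ _
    rw [mul_assoc, inv_mul_cancel₀ hζ0, mul_one]
  · intro ζ _
    rw [Polynomial.map_sub, map_X, map_C, coe_compRingHom_apply, conjPoly_comp]

/-- The product is invariant under `u ↦ ζ₀ u`, so only powers of `u^N` occur in its coefficients. -/
lemma exists_descent {N : ℕ} (hN : 0 < N) (τ : ℂ[X]) :
    ∃ P : ℂ[X][X], P.map (expand ℂ N : ℂ[X] →+* ℂ[X]) = conjProd N τ ∧ P.natDegree = N ∧
      P.Monic := by
  obtain ⟨ζ₀, hζ₀⟩ : ∃ ζ : ℂ, IsPrimitiveRoot ζ N := ⟨_, Complex.isPrimitiveRoot_exp _ hN.ne'⟩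
  have hl : conjProd N τ ∈ lifts (expand ℂ N : ℂ[X] →+* ℂ[X]) := by
    rw [lifts_iff_coeff_lifts]
    intro r
    set q := (conjProd N τ).coeff r with hq
    have hinv : q.comp (C ζ₀ * X) = q := by
      have := congrArg (fun P => coeff P r) (conjProd_map hN τ hζ₀.pow_eq_one)
      simpa only [coeff_map, coe_compRingHom_apply] using this
    refine ⟨contract N q, ?_⟩
    ext k
    rw [RingHom.coe_coe, coeff_expand hN]
    split_ifs with h
    · rw [coeff_contract hN.ne', Nat.div_mul_cancel h]
    · have := congrArg (fun P => coeff P k) hinv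
      simp only [comp_C_mul_X_coeff] at this
      by_contra h0
      refine h ((hζ₀.pow_eq_one_iff_dvd k).mp (mul_left_cancel₀ (Ne.symm h0) ?_))
      rw [this, mul_one]
  obtain ⟨P, h1, h2, h3⟩ := lifts_and_natDegree_eq_and_monic hl (conjProd_monic N τ)
  exact ⟨P, h1, h2.trans (conjProd_natDegree hN τ), h3⟩

open Classical in
/-- The monic polynomial `P` in `Y` over `ℂ[x]` with `P(u^N, Y) = ∏_{ζ^N = 1} (Y - τ(ζ u))`. -/
def normPoly (N : ℕ) (τ : ℂ[X]) : ℂ[X][X] :=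
  if h : 0 < N then (exists_descent h τ).choose else 1

variable {N : ℕ} {τ : ℂ[X]}

lemma normPoly_spec (hN : 0 < N) (τ : ℂ[X]) :
    (normPoly N τ).map (expand ℂ N : ℂ[X] →+* ℂ[X]) = conjProd N τ ∧
      (normPoly N τ).natDegree = N ∧ (normPoly N τ).Monic := by
  rw [normPoly, dif_pos hN]
  exact (exists_descent hN τ).choose_spec

lemma eval₂_normPoly (hN : 0 < N) {A : Type*} [CommRing A] (σ : ℂ[X] →+* A) (y : A) :
    eval₂ (σ.comp (expand ℂ N : ℂ[X] →+* ℂ[X])) y (normPoly N τ) =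
      ∏ ζ ∈ nthRootsFinset N (1 : ℂ), (y - σ (conjPoly τ ζ)) := by
  rw [← eval₂_map, (normPoly_spec hN τ).1, conjProd, eval₂_finsetProd]
  simp

/-- Polynomials in `Y` over `ℂ[x]` as polynomials in two variables. -/
def toMv : ℂ[X][X] →+* MvPolynomial (Fin 2) ℂ :=
  eval₂RingHom (aeval (MvPolynomial.X 0 : MvPolynomial (Fin 2) ℂ)).toRingHom (MvPolynomial.X 1)

lemma toMv_X : toMv X = MvPolynomial.X 1 := by simp [toMv]

lemma toMv_C_X : toMv (C X) = MvPolynomial.X 0 := by simp [toMv]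

lemma toMv_C_C (a : ℂ) : toMv (C (C a)) = MvPolynomial.C a := by
  simp [toMv, MvPolynomial.algebraMap_eq]

lemma aeval_toMv {A : Type*} [CommRing A] [Algebra ℂ A] (x y : A) (P : ℂ[X][X]) :
    MvPolynomial.aeval ![x, y] (toMv P) = eval₂ (aeval x : ℂ[X] →ₐ[ℂ] A).toRingHom y P := by
  have : ((MvPolynomial.aeval ![x, y] : MvPolynomial (Fin 2) ℂ →ₐ[ℂ] A) : _ →+* A).comp toMv =
      eval₂RingHom (aeval x : ℂ[X] →ₐ[ℂ] A).toRingHom y := by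
    refine ringHom_ext' (ringHom_ext' ?_ ?_) ?_
    · ext a
      simp [toMv]
    · simp [toMv]
    · simp [toMv]
  exact congrArg (fun f => f P) this

lemma aeval_toMv_normPoly (hN : 0 < N) {A : Type*} [CommRing A] [Algebra ℂ A] (z y : A) :
    MvPolynomial.aeval ![z ^ N, y] (toMv (normPoly N τ)) =
      ∏ ζ ∈ nthRootsFinset N (1 : ℂ), (y - aeval z (conjPoly τ ζ)) := by
  have : (aeval (z ^ N) : ℂ[X] →ₐ[ℂ] A).toRingHom =
      (aeval z : ℂ[X] →ₐ[ℂ] A).toRingHom.comp (expand ℂ N : ℂ[X] →+* ℂ[X]) := by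
    refine ringHom_ext' ?_ ?_
    · ext a
      simp
    · simp
  rw [aeval_toMv, this, eval₂_normPoly hN]
  rfl

end Conjugates

/-! ### Irreducibility of norms -/

section Irreducible

open PowerSeries

lemma evalAt_tilt_zero {x y : PowerSeries ℂ} (hx : constantCoeff x = 0) (hy : constantCoeff y = 0)
    (G : MvPowerSeries (Fin 2) ℂ) : evalAt (y, x) (tilt 0 G) = evalAt (x, y) G := by
  have h : IsCentered (y, x) := ⟨hy, hx⟩
  rw [tilt_apply, evalAt, MvPowerSeries.subst_comp_subst_apply (hasSubst_tiltMap 0) h.hasSubst,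
    evalAt]
  congr 1
  funext i
  change evalAt (y, x) (tiltMap 0 i) = _
  fin_cases i <;> simp [tiltMap, evalAt_X h]

/-- Evaluation at `(y, x)` of iterated power series. -/
def evalIterated {x y : PowerSeries ℂ} (hx : constantCoeff x = 0) (hy : constantCoeff y = 0) :
    PowerSeries CoeffRing →+* PowerSeries ℂ :=
  (MvPowerSeries.substAlgHom (R := ℂ)
    (show IsCentered (y, x) from ⟨hy, hx⟩).hasSubst).toRingHom.comp
      toIterated.symm.toRingEquiv.toRingHom

lemma evalIterated_apply {x y : PowerSeries ℂ} (hx : constantCoeff x = 0)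
    (hy : constantCoeff y = 0) (G : PowerSeries CoeffRing) :
    evalIterated hx hy G = evalAt (y, x) (toIterated.symm G) := by
  rw [evalAt, ← MvPowerSeries.coe_substAlgHom (show IsCentered (y, x) from ⟨hy, hx⟩).hasSubst]
  rfl

lemma evalIterated_X {x y : PowerSeries ℂ} (hx : constantCoeff x = 0)
    (hy : constantCoeff y = 0) : evalIterated hx hy X = y := by
  have : toIterated.symm X = MvPowerSeries.X 0 := by
    rw [AlgEquiv.symm_apply_eq]
    exact MvPowerSeries.finSuccEquiv_X_zero.symm
  rw [evalIterated_apply, this, evalAt_X ⟨hy, hx⟩]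
  rfl

/-- Here the coefficients are series in the variable evaluated at `x` alone. Hence one Weierstrass
polynomial, specialized at `x`, vanishes at all the roots `y` simultaneously. -/
lemma evalIterated_C {x y : PowerSeries ℂ} (hx : constantCoeff x = 0)
    (hy : constantCoeff y = 0) (c : CoeffRing) :
    evalIterated hx hy (C c) = evalIterated hx (map_zero constantCoeff) (C c) := by
  rw [evalIterated_apply, evalIterated_apply]
  ext k
  rw [coeff_evalAt ⟨hy, hx⟩, coeff_evalAt ⟨map_zero _, hx⟩]
  refine finsum_congr fun d => ?_
  by_cases hd : d 0 = 0
  · simp [hd]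
  · have := coeff_coeff_toIterated (toIterated.symm (C c)) (d 0) (d 1)
    rw [AlgEquiv.apply_symm_apply, coeff_C, if_neg hd, map_zero, ← finsupp_fin_two] at this
    rw [← this, zero_smul, zero_smul]

lemma ringHom_coe_polynomial {A B : Type*} [CommRing A] [CommRing B] (f : PowerSeries A →+* B)
    (W : Polynomial A) : f (W : PowerSeries A) = Polynomial.eval₂ (f.comp C) (f X) W := by
  have : f.comp Polynomial.coeToPowerSeries.ringHom =
      Polynomial.eval₂RingHom (f.comp C) (f X) := by
    refine Polynomial.ringHom_ext' ?_ ?_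
    · ext a; simp
    · simp
  exact congrArg (fun f => f W) this

lemma coeff_evalAt_X_zero (G : MvPowerSeries (Fin 2) ℂ) (k : ℕ) :
    coeff k (evalAt (X, (0 : PowerSeries ℂ)) G) =
      MvPowerSeries.coeff (Finsupp.single 0 k) G := by
  rw [coeff_evalAt ⟨constantCoeff_X, map_zero _⟩, finsum_eq_single _ (Finsupp.single 0 k)]
  · simp
  · intro d hd
    by_cases h1 : d 1 = 0
    · have h0 : k ≠ d 0 := by
        rintro rfl
        apply hd
        ext i
        fin_cases i
        · simp
        · simp [h1]
      simp [h1, coeff_X_pow, h0]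
    · simp [h1]

/-- A germ `G` with `G(0, y)` of order `e` has at most `e` roots `y` over a given `x(t)`. -/
lemma exists_monic_of_evalAt_eq_zero {G : MvPowerSeries (Fin 2) ℂ}
    (hG : evalAt ((0 : PowerSeries ℂ), X) G ≠ 0) {x : PowerSeries ℂ}
    (hx : constantCoeff x = 0) : ∃ W : Polynomial (PowerSeries ℂ), W.Monic ∧
      (W.natDegree : ℕ∞) = (evalAt ((0 : PowerSeries ℂ), X) G).order ∧
      ∀ y : PowerSeries ℂ, constantCoeff y = 0 → evalAt (x, y) G = 0 → W.eval y = 0 := by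
  set G' := toIterated (tilt 0 G) with hG'
  rw [← evalAt_tilt_zero (map_zero _) constantCoeff_X] at hG ⊢
  -- Reduction modulo the maximal ideal of the coefficients amounts to setting `x = 0`, so the
  -- Weierstrass degree is the order of `G(0, y)`.
  have hcoef (k : ℕ) : coeff k (G'.map (IsLocalRing.residue CoeffRing)) = 0 ↔
      coeff k (evalAt (X, (0 : PowerSeries ℂ)) (tilt 0 G)) = 0 := by
    rw [coeff_map, IsLocalRing.residue_eq_zero_iff, mem_maximalIdeal_coeffRing,
      coeff_evalAt_X_zero]
    have := coeff_coeff_toIterated (tilt 0 G) k 0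
    rw [Finsupp.single_zero, Finsupp.single_zero, add_zero,
      MvPowerSeries.coeff_zero_eq_constantCoeff_apply] at this
    rw [this]
  have hord : (G'.map (IsLocalRing.residue CoeffRing)).order =
      (evalAt (X, (0 : PowerSeries ℂ)) (tilt 0 G)).order := by
    refine le_antisymm ?_ ?_
    · exact PowerSeries.le_order _ _ fun k hk => (hcoef k).mp (coeff_of_lt_order k hk)
    · exact PowerSeries.le_order _ _ fun k hk => (hcoef k).mpr (coeff_of_lt_order k hk)
  have hmap : G'.map (IsLocalRing.residue CoeffRing) ≠ 0 := by
    rw [Ne, ← order_eq_top, hord, order_eq_top]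
    exact hG
  obtain ⟨W₀, h, hW⟩ := PowerSeries.exists_isWeierstrassFactorization hmap
  refine ⟨W₀.map ((evalIterated hx (map_zero constantCoeff)).comp C),
    hW.isDistinguishedAt.monic.map _, ?_, fun y hy hev => ?_⟩
  · rw [hW.isDistinguishedAt.monic.natDegree_map, hW.natDegree_eq_toNat_order_map,
      coe_toNat_order hmap, hord]
  · have h1 : evalIterated hx hy G' = 0 := by
      rw [evalIterated_apply, hG', AlgEquiv.symm_apply_apply, evalAt_tilt_zero hx hy, hev]
    rw [hW.eq_mul, map_mul] at h1
    have h2 := (mul_eq_zero.mp h1).resolve_right (hW.isUnit.map _).ne_zero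
    rw [ringHom_coe_polynomial, evalIterated_X] at h2
    rw [Polynomial.eval_map]
    have hcomp : (evalIterated hx hy).comp C =
        (evalIterated hx (map_zero constantCoeff)).comp C :=
      RingHom.ext fun c => evalIterated_C hx hy c
    rwa [hcomp] at h2

lemma isUnit_of_order_evalAt_eq_zero {G : MvPowerSeries (Fin 2) ℂ}
    (h : (evalAt ((0 : PowerSeries ℂ), X) G).order = 0) : IsUnit G := by
  by_contra hu
  rw [← constantCoeff_eq_zero_iff_not_isUnit] at hu
  have hs := (show IsCentered ((0 : PowerSeries ℂ), (X : PowerSeries ℂ)) from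
    ⟨map_zero _, constantCoeff_X⟩)
  have : constantCoeff (evalAt ((0 : PowerSeries ℂ), (X : PowerSeries ℂ)) G) = 0 := by
    rw [← coeff_zero_eq_constantCoeff_apply, coeff_evalAt hs]
    refine finsum_eq_zero_of_forall_eq_zero fun d => ?_
    by_cases hd : d = 0
    · rw [hd, MvPowerSeries.coeff_zero_eq_constantCoeff_apply, hu, zero_smul]
    · have : d 0 ≠ 0 ∨ d 1 ≠ 0 := by
        by_contra! h0
        exact hd (by ext i; fin_cases i <;> simp [h0])
      rw [coeff_zero_eq_constantCoeff_apply]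
      rcases this with h0 | h0 <;> simp [h0]
  rw [← one_le_order_iff_constCoeff_eq_zero, h] at this
  exact absurd this (by simp)

/-- If a factor `a` of a germ of degree `N` in `y` has `N` roots, the cofactor is a unit. -/
lemma isUnit_of_card_roots {N : ℕ} {a b : MvPowerSeries (Fin 2) ℂ}
    (hF : evalAt ((0 : PowerSeries ℂ), X) (a * b) = X ^ N) {x : PowerSeries ℂ}
    (hx : constantCoeff x = 0) (Y : Finset (PowerSeries ℂ)) (hY : N ≤ Y.card)
    (hroot : ∀ y ∈ Y, constantCoeff y = 0 ∧ evalAt (x, y) a = 0) : IsUnit b := by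
  rw [evalAt_mul ⟨map_zero _, constantCoeff_X⟩] at hF
  have hne : evalAt ((0 : PowerSeries ℂ), X) a ≠ 0 := by
    intro h0
    rw [h0, zero_mul] at hF
    exact pow_ne_zero N X_ne_zero hF.symm
  obtain ⟨W, hW, hdeg, hev⟩ := exists_monic_of_evalAt_eq_zero hne hx
  have hle : N ≤ W.natDegree := by
    refine hY.trans ?_
    refine Polynomial.card_le_degree_of_subset_roots fun y hy => ?_
    rw [Polynomial.mem_roots hW.ne_zero]
    exact hev y (hroot y hy).1 (hroot y hy).2
  apply isUnit_of_order_evalAt_eq_zero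
  have := congrArg PowerSeries.order hF
  rw [order_mul, order_X_pow, ← hdeg] at this
  cases h : (evalAt ((0 : PowerSeries ℂ), X) b).order with
  | top => rw [h] at this; simp at this
  | coe r => rw [h] at this; norm_cast at this ⊢; omega

lemma evalAt_twist {φ : PowerSeries ℂ × PowerSeries ℂ} (h : IsCentered φ) (ζ : ℂ)
    (G : MvPowerSeries (Fin 2) ℂ) : evalAt (twist ζ φ) G = rescale ζ (evalAt φ G) := by
  have h' : IsCentered (twist ζ φ) := by
    constructor <;> simp [twist, constantCoeff_rescale, h.1, h.2]
  ext k
  rw [coeff_rescale, coeff_evalAt h', coeff_evalAt h, ← smul_eq_mul (ζ ^ k), smul_finsum]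
  refine finsum_congr fun d => ?_
  have : (twist ζ φ).1 ^ d 0 * (twist ζ φ).2 ^ d 1 = rescale ζ (φ.1 ^ d 0 * φ.2 ^ d 1) := by
    simp [twist]
  rw [this, coeff_rescale, smul_eq_mul, smul_eq_mul, smul_eq_mul]
  ring

lemma aeval_X_powerSeries (q : Polynomial ℂ) :
    Polynomial.aeval (X : PowerSeries ℂ) q = (q : PowerSeries ℂ) := by
  have : (Polynomial.aeval (X : PowerSeries ℂ)).toRingHom =
      (Polynomial.coeToPowerSeries.ringHom : Polynomial ℂ →+* PowerSeries ℂ) := by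
    refine Polynomial.ringHom_ext' ?_ ?_
    · ext a; simp
    · simp
  exact congrArg (fun f => f q) this

lemma evalAt_toMv_normPoly {L : Type*} [Field L] [Algebra ℂ L] {N : ℕ} (hN : 0 < N)
    (τ : Polynomial ℂ) (z y : PowerSeries L) :
    evalAt (z ^ N, y) (toMv (normPoly N τ) : MvPowerSeries (Fin 2) ℂ) =
      ∏ ζ ∈ Polynomial.nthRootsFinset N (1 : ℂ), (y - Polynomial.aeval z (conjPoly τ ζ)) := by
  rw [evalAt_coe, aeval_toMv_normPoly hN]

lemma evalAt_normPoly_self {N : ℕ} (hN : 0 < N) (τ : Polynomial ℂ) :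
    evalAt ((X : PowerSeries ℂ) ^ N, (τ : PowerSeries ℂ))
      (toMv (normPoly N τ) : MvPowerSeries (Fin 2) ℂ) = 0 := by
  rw [evalAt_toMv_normPoly hN]
  refine Finset.prod_eq_zero (i := 1) ?_ ?_
  · rw [Polynomial.mem_nthRootsFinset hN, one_pow]
  · rw [conjPoly_one, aeval_X_powerSeries, sub_self]

lemma conjPoly_injOn {N : ℕ} (hN : 0 < N) {τ : Polynomial ℂ}
    (hτ : ∀ ζ : ℂ, ζ ^ N = 1 → conjPoly τ ζ = τ → ζ = 1) :
    Set.InjOn (fun ζ => (conjPoly τ ζ : PowerSeries ℂ)) (Polynomial.nthRootsFinset N (1 : ℂ)) := by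
  intro ζ hζ ζ' hζ' h
  rw [Finset.mem_coe, Polynomial.mem_nthRootsFinset hN] at hζ hζ'
  have h := Polynomial.coe_injective ℂ h
  have hζ0 : ζ' ≠ 0 := by
    rintro rfl
    rw [zero_pow hN.ne'] at hζ'
    exact zero_ne_one hζ'
  have h1 := congrArg (fun q => q.comp (Polynomial.C ζ'⁻¹ * Polynomial.X)) h
  simp only [conjPoly_comp] at h1
  rw [mul_inv_cancel₀ hζ0, conjPoly_one] at h1
  have := hτ _ (by rw [mul_pow, hζ, inv_pow, hζ', inv_one, mul_one]) h1
  rwa [mul_inv_eq_one₀ hζ0] at this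

lemma constantCoeff_conjPoly {τ : Polynomial ℂ} (h0 : τ.coeff 0 = 0) (ζ : ℂ) :
    constantCoeff (conjPoly τ ζ : PowerSeries ℂ) = 0 := by
  rw [← coeff_zero_eq_constantCoeff_apply, Polynomial.coeff_coe, coeff_conjPoly, h0, zero_mul]

/-- The norm of a series in `x^{1/N}` with `N` distinct conjugates is irreducible. -/
theorem irreducible_normPoly {N : ℕ} (hN : 0 < N) {τ : Polynomial ℂ} (h0 : τ.coeff 0 = 0)
    (hτ : ∀ ζ : ℂ, ζ ^ N = 1 → conjPoly τ ζ = τ → ζ = 1) :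
    Irreducible (toMv (normPoly N τ) : MvPowerSeries (Fin 2) ℂ) := by
  classical
  have hcx : constantCoeff (X ^ N : PowerSeries ℂ) = 0 := by simp [hN.ne']
  have hcτ : constantCoeff (τ : PowerSeries ℂ) = 0 := by
    have := constantCoeff_conjPoly h0 1
    rwa [conjPoly_one] at this
  have hcent : IsCentered ((X : PowerSeries ℂ) ^ N, (τ : PowerSeries ℂ)) := ⟨hcx, hcτ⟩
  have hF0 : evalAt ((0 : PowerSeries ℂ), X) (toMv (normPoly N τ) : MvPowerSeries (Fin 2) ℂ) =
      X ^ N := by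
    have := evalAt_toMv_normPoly hN τ (0 : PowerSeries ℂ) X
    rw [zero_pow hN.ne'] at this
    rw [this, Finset.prod_congr rfl (g := fun _ => X), Finset.prod_const,
      card_nthRootsFinset_complex hN]
    intro ζ _
    rw [← Polynomial.coeff_zero_eq_aeval_zero', coeff_conjPoly, h0, zero_mul, map_zero, sub_zero]
  have hroot := evalAt_normPoly_self hN τ
  -- A factor vanishing on the branch vanishes on its `N` distinct conjugates, all over the same `x
  -- = t^N`. It thus takes the whole degree `N` in `y`, and its cofactor is a unit.
  have hfac {a b : MvPowerSeries (Fin 2) ℂ}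
      (hab : (toMv (normPoly N τ) : MvPowerSeries (Fin 2) ℂ) = a * b)
      (ha : evalAt ((X : PowerSeries ℂ) ^ N, (τ : PowerSeries ℂ)) a = 0) : IsUnit b := by
    rw [hab] at hF0
    refine isUnit_of_card_roots hF0 hcx ((Polynomial.nthRootsFinset N (1 : ℂ)).image
      fun ζ => (conjPoly τ ζ : PowerSeries ℂ)) ?_ ?_
    · rw [Finset.card_image_of_injOn (conjPoly_injOn hN hτ), card_nthRootsFinset_complex hN]
    · intro y hy
      obtain ⟨ζ, hζ, rfl⟩ := Finset.mem_image.mp hy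
      rw [Polynomial.mem_nthRootsFinset hN] at hζ
      refine ⟨constantCoeff_conjPoly h0 ζ, ?_⟩
      have htw : twist ζ ((X : PowerSeries ℂ) ^ N, (τ : PowerSeries ℂ)) =
          (X ^ N, (conjPoly τ ζ : PowerSeries ℂ)) := by
        refine Prod.ext ?_ ?_
        · ext k
          simp only [twist, coeff_rescale, coeff_X_pow]
          split_ifs with h
          · rw [h, hζ, one_mul]
          · rw [mul_zero]
        · ext k
          simp only [twist, coeff_rescale, Polynomial.coeff_coe, coeff_conjPoly]
          ring
      rw [← htw, evalAt_twist hcent, ha, map_zero]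
  constructor
  · intro hu
    have h1 := hu.map (MvPowerSeries.substAlgHom (R := ℂ) hcent.hasSubst)
    rw [MvPowerSeries.coe_substAlgHom] at h1
    exact h1.ne_zero hroot
  · intro a b hab
    have h1 := hroot
    rw [hab, evalAt_mul hcent] at h1
    rcases mul_eq_zero.mp h1 with h2 | h2
    · exact Or.inr (hfac hab h2)
    · exact Or.inl (hfac (hab.trans (mul_comm a b)) h2)

end Irreducible

/-! ### Orders of norms along a branch -/

section Orders

open PowerSeries

/-- The partial sum up to `x^{E/n}` of `S`, as a polynomial in `u = x^{d/n}`. -/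
def truncPoly (S : HahnSeries ℚ ℂ) (n d E : ℕ) : Polynomial ℂ :=
  ∑ k ∈ Finset.range (E / d + 1), Polynomial.monomial k (S.coeff (((k * d : ℕ) : ℚ) / n))

lemma coeff_truncPoly (S : HahnSeries ℚ ℂ) (n : ℕ) {d : ℕ} (hd : 0 < d) (E k : ℕ) :
    (truncPoly S n d E).coeff k =
      if k * d ≤ E then S.coeff (((k * d : ℕ) : ℚ) / n) else 0 := by
  rw [truncPoly, Polynomial.finsetSum_coeff]
  simp only [Polynomial.coeff_monomial, Finset.sum_ite_eq', Finset.mem_range, Nat.lt_succ_iff,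
    Nat.le_div_iff_mul_le hd]

variable {L : Type*} [Field L] [Algebra ℂ L]

lemma coeff_aeval_X_pow (q : Polynomial ℂ) {d : ℕ} (hd : 0 < d) (k : ℕ) :
    coeff k (Polynomial.aeval ((X : PowerSeries L) ^ d) q) =
      if d ∣ k then algebraMap ℂ L (q.coeff (k / d)) else 0 := by
  have h : (Polynomial.aeval ((X : PowerSeries L) ^ d)).toRingHom =
      ((PowerSeries.map (algebraMap ℂ L)).comp Polynomial.coeToPowerSeries.ringHom).comp
        (Polynomial.expand ℂ d : Polynomial ℂ →+* Polynomial ℂ) := by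
    refine Polynomial.ringHom_ext' ?_ ?_
    · ext a
      simp [PowerSeries.algebraMap_apply]
    · simp
  have := congrArg (fun f => coeff k (f q)) h
  simp only [AlgHom.toRingHom_eq_coe, RingHom.coe_coe, RingHom.comp_apply, coeff_map,
    Polynomial.coeToPowerSeries.ringHom_apply, Polynomial.coeff_coe, Polynomial.coeff_expand hd]
    at this
  rw [this]
  split_ifs <;> simp

variable {S : HahnSeries ℚ ℂ} {n g : ℕ} {m : ℕ → ℕ}

lemma coeff_aeval_conjPoly_truncPoly {d : ℕ} (hd : 0 < d) (E : ℕ) (ζ : ℂ) (k : ℕ) :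
    coeff k (Polynomial.aeval ((X : PowerSeries L) ^ d) (conjPoly (truncPoly S n d E) ζ)) =
      if d ∣ k ∧ k ≤ E then algebraMap ℂ L (S.coeff ((k : ℚ) / n) * ζ ^ (k / d)) else 0 := by
  rw [coeff_aeval_X_pow _ hd, coeff_conjPoly, coeff_truncPoly S n hd]
  by_cases h : d ∣ k
  · rw [if_pos h, Nat.div_mul_cancel h]
    by_cases h2 : k ≤ E
    · rw [if_pos h2, if_pos ⟨h, h2⟩]
    · rw [if_neg h2, if_neg (fun h3 => h2 h3.2), zero_mul, map_zero]
  · rw [if_neg h, if_neg (fun h3 => h h3.1)]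

lemma evalAt_normPoly_truncPoly {d : ℕ} (hdn : d ∣ n) (hn : 0 < n) (E : ℕ) (y : PowerSeries L) :
    evalAt (X ^ n, y) (toMv (normPoly (n / d) (truncPoly S n d E)) : MvPowerSeries (Fin 2) ℂ) =
      ∏ ζ ∈ Polynomial.nthRootsFinset (n / d) (1 : ℂ),
        (y - Polynomial.aeval (X ^ d) (conjPoly (truncPoly S n d E) ζ)) := by
  rw [← evalAt_toMv_normPoly (Nat.div_pos (Nat.le_of_dvd hn hdn) (Nat.pos_of_dvd_of_pos hdn hn)),
    ← pow_mul, Nat.mul_div_cancel' hdn]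

lemma card_filter_pow_eq_one {N e : ℕ} (hN : 0 < N) (he : e ∣ N) :
    ((Polynomial.nthRootsFinset N (1 : ℂ)).filter fun ζ => ζ ^ e = 1).card = e := by
  have he0 := Nat.pos_of_dvd_of_pos he hN
  conv_rhs => rw [← card_nthRootsFinset_complex he0]
  congr 1
  ext ζ
  rw [Finset.mem_filter, Polynomial.mem_nthRootsFinset hN, Polynomial.mem_nthRootsFinset he0]
  refine ⟨fun h => h.2, fun h => ⟨?_, h⟩⟩
  obtain ⟨c, rfl⟩ := he
  rw [pow_mul, h, one_pow]

/-- Partial telescoping sums. -/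
lemma sum_ite_sub_le {μ : ℕ → ℕ} (hμ : Monotone μ) {P : ℕ → Prop} [DecidablePred P]
    {t k : ℕ} (h : ∀ r < t, P r → μ (r + 1) ≤ k) :
    ∑ r ∈ Finset.range t, (if P r then μ (r + 1) - μ r else 0) ≤ min k (μ t) := by
  induction t with
  | zero => simp
  | succ t ih =>
    rw [Finset.sum_range_succ]
    have h1 := ih fun r hr => h r (by omega)
    have h2 : μ t ≤ μ (t + 1) := hμ (Nat.le_succ t)
    split_ifs with hP
    · have := h t (by omega) hP
      omega
    · omega

/-- Groups the conjugates by contact: exactly `d_r / d_i` of the roots of unity act trivially on the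
exponents divisible by `d_r`. -/
lemma sum_sum_ite_pow {i : ℕ} (hn : 0 < n) (a : ℕ → ℕ) :
    ∑ ζ ∈ Polynomial.nthRootsFinset (n / dgcd n m i) (1 : ℂ), ∑ r ∈ Finset.range (i + 1),
      (if ζ ^ (dgcd n m r / dgcd n m i) = 1 then a r else 0) =
    ∑ r ∈ Finset.range (i + 1), a r * (dgcd n m r / dgcd n m i) := by
  have hd : 0 < dgcd n m i := Nat.pos_of_dvd_of_pos (dgcd_dvd i) hn
  rw [Finset.sum_comm]
  refine Finset.sum_congr rfl fun r hr => ?_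
  rw [← Finset.sum_filter, Finset.sum_const, card_filter_pow_eq_one, smul_eq_mul, mul_comm]
  · exact Nat.div_pos (Nat.le_of_dvd hn (dgcd_dvd i)) hd
  · exact Nat.div_dvd_div (dgcd_dvd_of_le (by simpa [Nat.lt_succ_iff] using hr)) (dgcd_dvd r)

lemma pow_div_eq_one {i r k : ℕ} (hr : r ≤ i) {ζ : ℂ} (hζ : ζ ^ (dgcd n m r / dgcd n m i) = 1)
    (hk : dgcd n m r ∣ k) : ζ ^ (k / dgcd n m i) = 1 := by
  obtain ⟨c, rfl⟩ := hk
  rw [mul_comm, Nat.mul_div_assoc c (dgcd_dvd_of_le hr), mul_comm, pow_mul, hζ, one_pow]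

lemma dgcd_mul_sum {i : ℕ} (a : ℕ → ℕ) :
    dgcd n m i * ∑ r ∈ Finset.range (i + 1), a r * (dgcd n m r / dgcd n m i) =
      ∑ r ∈ Finset.range (i + 1), a r * dgcd n m r := by
  rw [Finset.mul_sum]
  refine Finset.sum_congr rfl fun r hr => ?_
  rw [mul_left_comm, Nat.mul_div_cancel' (dgcd_dvd_of_le (by simpa [Nat.lt_succ_iff] using hr))]

lemma le_of_dvd_of_lt {d k E : ℕ} (hk : d ∣ k) (hE : d ∣ E) (h : k < E + d) : k ≤ E := by
  obtain ⟨a, rfl⟩ := hk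
  obtain ⟨b, rfl⟩ := hE
  have : d * a < d * (b + 1) := by rw [mul_add, mul_one]; exact h
  exact Nat.mul_le_mul_left d (Nat.lt_succ_iff.mp (lt_of_mul_lt_mul_left this (Nat.zero_le d)))

lemma sum_min_eq {i t : ℕ} (ht : t ≤ i + 1) :
    ∑ r ∈ Finset.range (i + 1), (m (min (r + 1) t) - m (min r t)) * dgcd n m r =
      contactSum n m t := by
  rw [contactSum, ← Finset.sum_subset (Finset.range_mono ht)]
  · refine Finset.sum_congr rfl fun r hr => ?_
    have := Finset.mem_range.mp hr
    rw [min_eq_left (by omega), min_eq_left (by omega)]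
  · intro r _ hr
    have : t ≤ r := by simpa using hr
    rw [min_eq_right (by omega), min_eq_right (by omega), Nat.sub_self, zero_mul]

namespace IsCharSeq

/-- A lower bound for the order of the norm of a partial sum along a branch. -/
lemma le_order_normPoly (hc : IsCharSeq S n g m) {i E : ℕ} {μ : ℕ → ℕ} (hμ : Monotone μ)
    {y : PowerSeries L}
    (h : ∀ r ≤ i, ∀ k < μ (r + 1), coeff k y = algebraMap ℂ L (S.coeff ((k : ℚ) / n)) ∧
      (S.coeff ((k : ℚ) / n) ≠ 0 → dgcd n m r ∣ k ∧ k ≤ E)) :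
    ((∑ r ∈ Finset.range (i + 1), (μ (r + 1) - μ r) * (dgcd n m r / dgcd n m i) : ℕ) : ℕ∞) ≤
      (evalAt (X ^ n, y) (toMv (normPoly (n / dgcd n m i) (truncPoly S n (dgcd n m i) E)) :
        MvPowerSeries (Fin 2) ℂ)).order := by
  have hd := hc.dgcd_pos i
  rw [evalAt_normPoly_truncPoly (dgcd_dvd i) hc.n_pos, order_prod, ← sum_sum_ite_pow hc.n_pos,
    Nat.cast_sum]
  refine Finset.sum_le_sum fun ζ _ => ?_
  refine PowerSeries.le_order _ _ fun k hk => ?_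
  by_contra hne
  have hk' := Nat.cast_lt.mp hk
  -- If `ζ` fixes the terms with exponent divisible by `d_r`, the conjugate agrees with `y` below `μ
  -- (r + 1)`. A nonzero coefficient at `k` thus requires `μ (r + 1) ≤ k` for all such `r`, and the
  -- sum of increments is at most `k`.
  have := sum_ite_sub_le hμ (t := i + 1) (k := k)
    (P := fun r => ζ ^ (dgcd n m r / dgcd n m i) = 1) ?_
  · omega
  intro r hr hP
  by_contra! hlt
  have hri := Nat.lt_succ_iff.mp hr
  obtain ⟨h1, h2⟩ := h r hri k hlt
  apply hne
  rw [map_sub, h1, coeff_aeval_conjPoly_truncPoly hd]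
  by_cases h0 : S.coeff ((k : ℚ) / n) = 0
  · simp [h0]
  · obtain ⟨h3, h4⟩ := h2 h0
    rw [if_pos ⟨(dgcd_dvd_of_le hri).trans h3, h4⟩, pow_div_eq_one hri hP h3, mul_one, sub_self]

lemma m_mono (hc : IsCharSeq S n g m) {r l : ℕ} (h : r ≤ l) (hl : l ≤ g) : m r ≤ m l := by
  induction l, h using Nat.le_induction with
  | base => exact le_rfl
  | succ l _ ih => exact (ih (by omega)).trans (hc.m_lt_succ (by omega)).le

lemma m_min_mono (hc : IsCharSeq S n g m) {t : ℕ} (ht : t ≤ g) : Monotone fun r => m (min r t) :=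
  fun r l h => hc.m_mono (by omega) (by omega)

lemma dgcd_dvd_stage (hc : IsCharSeq S n g m) (i j : ℕ) : dgcd n m i ∣ m i + j * dgcd n m i :=
  (Nat.dvd_add_right (hc.dgcd_dvd_m' le_rfl)).mpr (dvd_mul_left _ _)

lemma dvd_and_le_of_lt (hc : IsCharSeq S n g m) {i : ℕ} (hi : i < g) {r k : ℕ} (hr : r ≤ i)
    (hk : k < m (r + 1))
    (h : S.coeff ((k : ℚ) / n) ≠ 0) :
    dgcd n m r ∣ k ∧ k ≤ m i + hZero n m (i + 1) * dgcd n m i := by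
  refine ⟨hc.dvd_of_lt (by omega) hk h, ?_⟩
  have hk' : k < m (i + 1) := hk.trans_le (hc.m_mono (by omega) hi)
  have h1 := hc.m_eq hi
  have h2 := Nat.mod_lt (m (i + 1) - m i) (hc.dgcd_pos i)
  exact le_of_dvd_of_lt (hc.dvd_of_lt hi hk' h) (hc.dgcd_dvd_stage i _) (by omega)

/-! ### The polynomials `F_{i,j}` and their orders along branches. -/

/-- `F_{i,j}`, as a polynomial in `Y` over `ℂ[x]`. -/
def _root_.PlaneBranch.factorPoly (S : HahnSeries ℚ ℂ) (n : ℕ) (m : ℕ → ℕ) (i j : ℕ) :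
    Polynomial (Polynomial ℂ) :=
  normPoly (n / dgcd n m i) (truncPoly S n (dgcd n m i) (m i + j * dgcd n m i))

/-- `F_i`, as a polynomial in `Y` over `ℂ[x]`. -/
def _root_.PlaneBranch.stdPoly (S : HahnSeries ℚ ℂ) (n : ℕ) (m : ℕ → ℕ) (i : ℕ) :
    Polynomial (Polynomial ℂ) :=
  factorPoly S n m i (hZero n m (i + 1))

/-- Lower bound for `F_i` along a branch which agrees with `S` up to the order `m_t`. -/
lemma exists_le_order_stdPoly (hc : IsCharSeq S n g m) {i t : ℕ} (hi : i < g) (ht : t ≤ i + 1)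
    {y : PowerSeries L}
    (hy : ∀ k < m t, coeff k y = algebraMap ℂ L (S.coeff ((k : ℚ) / n))) :
    ∃ B : ℕ, dgcd n m i * B = contactSum n m t ∧
      (B : ℕ∞) ≤ (evalAt (X ^ n, y) (toMv (stdPoly S n m i) : MvPowerSeries (Fin 2) ℂ)).order := by
  refine ⟨_, (dgcd_mul_sum _).trans (sum_min_eq ht),
    hc.le_order_normPoly (hc.m_min_mono (show t ≤ g by omega)) ?_⟩
  intro r hr k hk
  refine ⟨hy k (hk.trans_le (hc.m_mono (by omega) (by omega))), fun h0 => ?_⟩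
  exact hc.dvd_and_le_of_lt hi hr (hk.trans_le (hc.m_mono (by omega) (by omega))) h0

/-- Lower bound for the norms of partial sums along the branch of `S`. -/
lemma exists_le_order_factorPoly (hc : IsCharSeq S n g m) {i j j' : ℕ}
    (h : (i < g ∧ j ≤ hZero n m (i + 1)) ∨ (i = g ∧ j = 0)) (hj : j ≤ j' + 1) :
    ∃ B : ℕ, dgcd n m i * B = contactSum n m i + j * dgcd n m i ^ 2 ∧
      (B : ℕ∞) ≤ (evalAt (branchParam S n) (toMv (factorPoly S n m i j') :
        MvPowerSeries (Fin 2) ℂ)).order := by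
  have hig : i ≤ g := by omega
  -- The last increment `j d_i` concerns only the conjugate `ζ = 1`, that is, the partial sum
  -- itself.
  let μ : ℕ → ℕ := fun r => if r ≤ i then m r else m i + j * dgcd n m i
  have hμ : Monotone μ := by
    intro r l hrl
    simp only [μ]
    split_ifs with h1 h2 h2
    · exact hc.m_mono hrl (by omega)
    · exact (hc.m_mono h1 hig).trans (Nat.le_add_right _ _)
    · omega
    · exact le_rfl
  refine ⟨_, ?_, hc.le_order_normPoly hμ ?_⟩
  · rw [dgcd_mul_sum, Finset.sum_range_succ, contactSum]
    congr 1
    · refine Finset.sum_congr rfl fun r hr => ?_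
      have := Finset.mem_range.mp hr
      simp only [μ]
      rw [if_pos (by omega), if_pos (by omega)]
    · simp only [μ]
      rw [if_pos le_rfl, if_neg (by omega), Nat.add_sub_cancel_left]
      ring
  · intro r hr k hk
    refine ⟨by simp [uniformized], fun h0 => ?_⟩
    have hd : dgcd n m r ∣ k := by
      rcases hr.lt_or_eq with hlt | rfl
      · simp only [μ] at hk
        rw [if_pos (by omega)] at hk
        exact hc.dvd_of_lt (by omega) hk h0
      · simp only [μ] at hk
        rw [if_neg (by omega)] at hk
        rcases h with ⟨h1, h2⟩ | ⟨h1, h2⟩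
        · have h3 := hc.m_eq h1
          have h4 : j * dgcd n m r ≤ hZero n m (r + 1) * dgcd n m r := Nat.mul_le_mul_right _ h2
          exact hc.dvd_of_lt h1 (by omega) h0
        · rw [h1, hc.last]; exact one_dvd k
    refine ⟨hd, ?_⟩
    have hk' : k < m i + j * dgcd n m i := by
      have := hμ (show r + 1 ≤ i + 1 by omega)
      simp only [μ] at this hk
      rw [if_neg (show ¬ i + 1 ≤ i by omega)] at this
      exact hk.trans_le this
    -- Relevant exponents are multiples of `d_i`, so those below `m_i + (j' + 1) d_i` already occur
    -- in the truncation at `m_i + j' d_i`. This is why `j = j' + 1` is allowed.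
    have h5 : j * dgcd n m i ≤ (j' + 1) * dgcd n m i := Nat.mul_le_mul_right _ hj
    rw [Nat.add_mul, one_mul] at h5
    rcases hr.lt_or_eq with hlt | rfl
    · simp only [μ] at hk
      rw [if_pos (by omega)] at hk
      have := hc.m_mono (show r + 1 ≤ i by omega) hig
      omega
    · exact le_of_dvd_of_lt hd (hc.dgcd_dvd_stage r j') (by omega)

/-- The order of `F_i` along the branch of `S`. -/
lemma order_stdPoly (hc : IsCharSeq S n g m) {i : ℕ} (hi : i < g) :
    ∃ B : ℕ, dgcd n m i * B = contactSum n m (i + 1) ∧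
      (evalAt (branchParam S n) (toMv (stdPoly S n m i) : MvPowerSeries (Fin 2) ℂ)).order = B := by
  obtain ⟨B, hB, hle⟩ := hc.exists_le_order_stdPoly (L := ℂ) hi le_rfl (y := uniformized S n)
    (by simp [uniformized])
  refine ⟨B, hB, le_antisymm ?_ hle⟩
  have hd := hc.dgcd_pos i
  have hB' : B = ∑ r ∈ Finset.range (i + 1), (m (r + 1) - m r) * (dgcd n m r / dgcd n m i) := by
    refine Nat.eq_of_mul_eq_mul_left hd ?_
    rw [hB, dgcd_mul_sum, contactSum]
  rw [hB', ← sum_sum_ite_pow hc.n_pos, stdPoly, factorPoly, branchParam,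
    evalAt_normPoly_truncPoly (dgcd_dvd i) hc.n_pos, order_prod, Nat.cast_sum]
  refine Finset.sum_le_sum fun ζ hζ => ?_
  rw [Polynomial.mem_nthRootsFinset (Nat.div_pos (Nat.le_of_dvd hc.n_pos (dgcd_dvd i)) hd)] at hζ
  -- The last level at which `ζ` acts trivially. The conjugate departs from `S` at `m_{r₀+1}`:
  -- through the action of `ζ` if `r₀ < i`, and because `d_i` does not divide `m_{i+1}`, so that
  -- this term is missing, if `r₀ = i`.
  obtain ⟨r₀, hr₀, hP, hnot⟩ : ∃ r₀ ≤ i, (∀ r ≤ r₀, ζ ^ (dgcd n m r / dgcd n m i) = 1) ∧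
      (r₀ = i ∨ ζ ^ (dgcd n m (r₀ + 1) / dgcd n m i) ≠ 1) := by
    by_contra! hall
    have : ∀ r ≤ i, ∀ r' ≤ r, ζ ^ (dgcd n m r' / dgcd n m i) = 1 := by
      intro r
      induction r with
      | zero =>
        intro _ r' hr'
        rw [Nat.le_zero.mp hr']
        exact hζ
      | succ r ih =>
        intro hr r' hr'
        rcases Nat.le_succ_iff.mp hr' with h' | rfl
        · exact ih (by omega) r' h'
        · exact (hall r (by omega) (ih (by omega))).2
    exact (hall i le_rfl (this i le_rfl)).1 rfl
  have hcoef : coeff (m (r₀ + 1)) (uniformized S n - Polynomial.aeval (X ^ dgcd n m i) (conjPoly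
      (truncPoly S n (dgcd n m i) (m i + hZero n m (i + 1) * dgcd n m i)) ζ)) ≠ 0 := by
    have hs := hc.coeff_ne (r₀ + 1) (by omega) (by omega)
    rw [map_sub, coeff_aeval_conjPoly_truncPoly hd, uniformized, coeff_mk,
      Algebra.algebraMap_self, RingHom.id_apply]
    rcases hr₀.lt_or_eq with hlt | rfl
    · have hdm : dgcd n m i ∣ m (r₀ + 1) := dgcd_dvd_m (by omega) (by omega)
      have hm1 := hc.m_mono (show r₀ + 1 ≤ i by omega) hi.le
      rw [if_pos ⟨hdm, by omega⟩]
      have : ζ ^ (m (r₀ + 1) / dgcd n m i) ≠ 1 := by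
        intro h1
        refine hnot.resolve_left hlt.ne ?_
        rw [dgcd, ← Nat.gcd_div (dgcd_dvd_of_le hlt.le) hdm, ← orderOf_dvd_iff_pow_eq_one]
        exact Nat.dvd_gcd (orderOf_dvd_of_pow_eq_one (hP r₀ le_rfl))
          (orderOf_dvd_of_pow_eq_one h1)
      intro h0
      apply this
      have h2 : S.coeff ((m (r₀ + 1) : ℚ) / n) * (1 - ζ ^ (m (r₀ + 1) / dgcd n m i)) = 0 := by
        linear_combination h0
      exact (sub_eq_zero.mp ((mul_eq_zero.mp h2).resolve_left hs)).symm
    · rw [if_neg fun h => hc.not_dvd_succ hi h.1, sub_zero]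
      exact hs
  refine (PowerSeries.order_le _ hcoef).trans ?_
  rw [Nat.cast_le]
  calc m (r₀ + 1) = ∑ r ∈ Finset.range (r₀ + 1), (m (r + 1) - m r) := by
        have : ∀ t ≤ g, m t = ∑ r ∈ Finset.range t, (m (r + 1) - m r) := by
          intro t
          induction t with
          | zero => intro _; simp [hc.zero]
          | succ t ih =>
            intro ht
            rw [Finset.sum_range_succ, ← ih (by omega),
              Nat.add_sub_cancel' (hc.m_lt_succ (by omega)).le]
        exact this _ (by omega)
    _ = ∑ r ∈ Finset.range (r₀ + 1),
          (if ζ ^ (dgcd n m r / dgcd n m i) = 1 then m (r + 1) - m r else 0) := by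
        refine Finset.sum_congr rfl fun r hr => ?_
        rw [if_pos (hP r (by simpa [Nat.lt_succ_iff] using hr))]
    _ ≤ _ := Finset.sum_le_sum_of_subset (Finset.range_mono (by omega))

/-- At `t^E` the curvette has the transcendental coefficient `ξ`, while every conjugate has a
complex one. -/
lemma evalAt_genericParam_factorPoly_ne_zero (hc : IsCharSeq S n g m) {ξ : L}
    (hξ : Transcendental ℂ ξ) (i j E : ℕ) :
    evalAt (genericParam S n E ξ) (toMv (factorPoly S n m i j) : MvPowerSeries (Fin 2) ℂ) ≠ 0 := by
  rw [genericParam, factorPoly, evalAt_normPoly_truncPoly (dgcd_dvd i) hc.n_pos,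
    Finset.prod_ne_zero_iff]
  intro ζ _ h0
  have h1 := congrArg (coeff E) h0
  rw [map_sub, coeff_aeval_conjPoly_truncPoly (hc.dgcd_pos i), map_add, ext, coeff_map,
    Polynomial.coeff_coe, coeff_trunc, if_neg (lt_irrefl E), map_zero, zero_add,
    coeff_X_pow_mul', if_pos le_rfl, Nat.sub_self, coeff_zero_C, map_zero, sub_eq_zero] at h1
  rw [h1] at hξ
  split_ifs at hξ
  · exact hξ (isAlgebraic_algebraMap _)
  · exact hξ isAlgebraic_zero

end IsCharSeq

end Orders

/-! ### Expansions in the standard factors -/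

section Expansion

open Polynomial

/-- Terms of distinct orders cannot cancel, so the order of the sum is the minimum. -/
lemma exists_order_sum_eq {s : Finset ℕ} {f : ℕ → PowerSeries ℂ}
    (hd : ∀ a ∈ s, ∀ b ∈ s, f a ≠ 0 → f b ≠ 0 → (f a).order = (f b).order → a = b)
    (hne : ∃ a ∈ s, f a ≠ 0) : ∃ a ∈ s, f a ≠ 0 ∧ (∑ b ∈ s, f b).order = (f a).order ∧
      ∀ b ∈ s, (f a).order ≤ (f b).order := by
  classical
  obtain ⟨a₀, ha₀, hfa₀⟩ := hne
  obtain ⟨a, ha, hmin⟩ := s.exists_min_image (fun a => (f a).order) ⟨a₀, ha₀⟩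
  have hfa : f a ≠ 0 := by
    intro h0
    have := hmin a₀ ha₀
    rw [h0, PowerSeries.order_zero, top_le_iff, PowerSeries.order_eq_top] at this
    exact hfa₀ this
  refine ⟨a, ha, hfa, ?_, hmin⟩
  have ho := PowerSeries.coe_toNat_order hfa
  rw [← ho, PowerSeries.order_eq_nat]
  have hco {k : ℕ} (hk : k ≤ (f a).order.toNat) :
      PowerSeries.coeff k (∑ b ∈ s, f b) = PowerSeries.coeff k (f a) := by
    rw [map_sum]
    refine Finset.sum_eq_single a (fun b hb hba => ?_) fun h => absurd ha h
    refine PowerSeries.coeff_of_lt_order k ?_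
    refine lt_of_le_of_lt (Nat.cast_le.mpr hk) ?_
    rw [ho]
    refine lt_of_le_of_ne (hmin b hb) fun heq => ?_
    have hfb : f b ≠ 0 := by
      rw [Ne, ← PowerSeries.order_eq_top, ← heq, PowerSeries.order_eq_top]
      exact hfa
    exact hba (hd b hb a ha hfb hfa heq.symm)
  refine ⟨?_, fun k hk => ?_⟩
  · rw [hco le_rfl]
    exact (PowerSeries.order_eq_nat.mp ho.symm).1
  · rw [hco hk.le]
    exact PowerSeries.coeff_of_lt_order k (by rw [← ho]; exact_mod_cast hk)

/-- Expansion in powers of a monic polynomial. -/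
lemma exists_expansion {A : Type*} [CommRing A] [Nontrivial A] {F : A[X]} (hF : F.Monic) (e : ℕ) :
    ∀ P : A[X], P.degree < (F.natDegree * e : ℕ) → ∃ c : ℕ → A[X],
      (∀ δ, (c δ).degree < (F.natDegree : ℕ)) ∧ P = ∑ δ ∈ Finset.range e, c δ * F ^ δ := by
  have hdF := degree_eq_natDegree hF.ne_zero
  induction e with
  | zero =>
    intro P hP
    refine ⟨fun _ => 0, fun _ => ?_, ?_⟩
    · rw [degree_zero]; exact WithBot.bot_lt_coe _
    · have : P = 0 := by
        by_contra h
        rw [mul_zero, degree_eq_natDegree h] at hP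
        exact absurd (Nat.cast_lt.mp hP) (Nat.not_lt_zero _)
      simpa using this
  | succ e ih =>
    intro P hP
    have hq : (P /ₘ F).degree < (F.natDegree * e : ℕ) := by
      by_cases h0 : P /ₘ F = 0
      · rw [h0, degree_zero]; exact WithBot.bot_lt_coe _
      · have hle : F.degree ≤ P.degree := by
          by_contra! hlt
          exact h0 ((divByMonic_eq_zero_iff hF).mpr hlt)
        have h1 := degree_add_divByMonic hF hle
        rw [hdF, degree_eq_natDegree h0] at h1
        rw [← h1] at hP
        rw [degree_eq_natDegree h0]
        norm_cast at hP ⊢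
        rw [mul_add, mul_one] at hP
        omega
    obtain ⟨c, hc, hsum⟩ := ih _ hq
    refine ⟨fun δ => if δ = 0 then P %ₘ F else c (δ - 1), fun δ => ?_, ?_⟩
    · dsimp only
      split_ifs
      · rw [← hdF]; exact degree_modByMonic_lt P hF
      · exact hc _
    · rw [Finset.sum_range_succ']
      simp only [if_true, pow_zero, mul_one, Nat.succ_ne_zero, if_false, Nat.add_sub_cancel,
        pow_succ, ← mul_assoc]
      rw [← Finset.sum_mul, ← hsum, mul_comm, add_comm]
      exact (modByMonic_add_div P F).symm

variable {S : HahnSeries ℚ ℂ} {n g : ℕ} {m : ℕ → ℕ}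

/-- Evaluation along the branch of `S`. -/
def branchEval (S : HahnSeries ℚ ℂ) (n : ℕ) : ℂ[X][X] →+* PowerSeries ℂ :=
  (MvPolynomial.aeval ![(branchParam S n).1, (branchParam S n).2]).toRingHom.comp toMv

lemma evalAt_branchParam (P : ℂ[X][X]) :
    evalAt (branchParam S n) (toMv P : MvPowerSeries (Fin 2) ℂ) = branchEval S n P :=
  evalAt_coe _

/-- The order of `F_s` along the branch of `S`. -/
def stdOrder (n : ℕ) (m : ℕ → ℕ) (s : ℕ) : ℕ := contactSum n m (s + 1) / dgcd n m s

/-- The terms `x^α ∏_{s < i} F_s^{δ_s}` of order at least `V` along the branch of `S`. -/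
def expansionTerms (S : HahnSeries ℚ ℂ) (n : ℕ) (m : ℕ → ℕ) (i V : ℕ) : Set ℂ[X][X] :=
  {T | ∃ (α : ℕ) (δ : ℕ → ℕ), (∀ s < i, δ s < dgcd n m s / dgcd n m (s + 1)) ∧
    T = C X ^ α * ∏ s ∈ Finset.range i, stdPoly S n m s ^ δ s ∧
    V ≤ α * n + ∑ s ∈ Finset.range i, δ s * stdOrder n m s}

lemma stdPoly_spec (hc : IsCharSeq S n g m) (i : ℕ) :
    (stdPoly S n m i).natDegree = n / dgcd n m i ∧ (stdPoly S n m i).Monic :=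
  (normPoly_spec (Nat.div_pos (Nat.le_of_dvd hc.n_pos (dgcd_dvd i)) (hc.dgcd_pos i)) _).2

lemma mul_pow_mem_span {i V a : ℕ} (ha : a < dgcd n m i / dgcd n m (i + 1)) {P : ℂ[X][X]}
    (hP : P ∈ Submodule.span ℂ (expansionTerms S n m i (V - a * stdOrder n m i))) :
    P * stdPoly S n m i ^ a ∈ Submodule.span ℂ (expansionTerms S n m (i + 1) V) := by
  have hle : Submodule.span ℂ (expansionTerms S n m i (V - a * stdOrder n m i)) ≤
      (Submodule.span ℂ (expansionTerms S n m (i + 1) V)).comap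
        (LinearMap.mulRight ℂ (stdPoly S n m i ^ a)) := by
    rw [Submodule.span_le]
    rintro T ⟨α, δ, h1, rfl, h3⟩
    rw [SetLike.mem_coe, Submodule.mem_comap, LinearMap.mulRight_apply]
    refine Submodule.subset_span ⟨α, Function.update δ i a, fun s hs => ?_, ?_, ?_⟩
    · rcases Nat.lt_succ_iff_lt_or_eq.mp hs with h | rfl
      · rw [Function.update_of_ne h.ne]; exact h1 s h
      · rw [Function.update_self]; exact ha
    · rw [Finset.prod_range_succ, Function.update_self, ← mul_assoc]
      have : ∏ s ∈ Finset.range i, stdPoly S n m s ^ Function.update δ i a s =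
          ∏ s ∈ Finset.range i, stdPoly S n m s ^ δ s := by
        refine Finset.prod_congr rfl fun s hs => ?_
        rw [Function.update_of_ne (Finset.mem_range.mp hs).ne]
      rw [this]
    · rw [Finset.sum_range_succ, Function.update_self]
      have : ∑ s ∈ Finset.range i, Function.update δ i a s * stdOrder n m s =
          ∑ s ∈ Finset.range i, δ s * stdOrder n m s := by
        refine Finset.sum_congr rfl fun s hs => ?_
        rw [Function.update_of_ne (Finset.mem_range.mp hs).ne]
      rw [this]
      omega
  exact hle hP

namespace IsCharSeq

lemma order_branchEval_stdPoly (hc : IsCharSeq S n g m) {i : ℕ} (hi : i < g) :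
    dgcd n m i * stdOrder n m i = contactSum n m (i + 1) ∧
      (branchEval S n (stdPoly S n m i)).order = stdOrder n m i := by
  obtain ⟨B, hB, ho⟩ := hc.order_stdPoly hi
  have : stdOrder n m i = B := by
    rw [stdOrder, ← hB, Nat.mul_div_cancel_left _ (hc.dgcd_pos i)]
  rw [this, ← evalAt_branchParam]
  exact ⟨hB, ho⟩

lemma sq_dgcd_dvd_contactSum (hc : IsCharSeq S n g m) (i : ℕ) :
    dgcd n m i * dgcd n m i ∣ contactSum n m i := by
  refine Finset.dvd_sum fun r hr => ?_
  have hr := Finset.mem_range.mp hr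
  exact mul_dvd_mul ((dgcd_dvd_of_le hr).trans hc.dgcd_dvd_sub) (dgcd_dvd_of_le hr.le)

/-- As `d_i²` divides `contactSum n m i`, the order of `F_i` is congruent to `m_{i+1} - m_i` modulo
`d_i`. -/
lemma gcd_stdOrder (hc : IsCharSeq S n g m) {i : ℕ} (hi : i < g) :
    Nat.gcd (dgcd n m i) (stdOrder n m i) = dgcd n m (i + 1) := by
  obtain ⟨c, h⟩ := hc.sq_dgcd_dvd_contactSum i
  have hd := hc.dgcd_pos i
  have : stdOrder n m i = (m (i + 1) - m i) + dgcd n m i * c := by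
    rw [stdOrder, contactSum_succ, h, mul_assoc, mul_comm (m (i + 1) - m i), ← mul_add,
      Nat.mul_div_cancel_left _ hd, add_comm]
  rw [this, Nat.gcd_add_mul_left_right, ← hc.gcd_mod hi, Nat.gcd_comm _ (_ % _), ← Nat.gcd_rec]

/-- Modulo `d_i` the order of `F_i` has additive order `d_i / d_{i+1}`, so an exponent below this
bound can be read off from the order of the term. -/
lemma eq_of_dvd_mul_stdOrder (hc : IsCharSeq S n g m) {i a b : ℕ} (hi : i < g) {o o' : ℕ}
    (ho : dgcd n m i ∣ o)
    (ho' : dgcd n m i ∣ o') (hb : b < dgcd n m i / dgcd n m (i + 1)) (hab : a ≤ b)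
    (h : o + a * stdOrder n m i = o' + b * stdOrder n m i) : a = b := by
  have h1 : o = o' + (b - a) * stdOrder n m i := by
    obtain ⟨c, rfl⟩ := Nat.exists_eq_add_of_le hab
    rw [Nat.add_sub_cancel_left]
    rw [Nat.add_mul] at h
    omega
  have h2 : dgcd n m i ∣ (b - a) * stdOrder n m i := (Nat.dvd_add_right ho').mp (h1 ▸ ho)
  have hg := hc.gcd_stdOrder hi
  have h3 : dgcd n m i / dgcd n m (i + 1) ∣ b - a := by
    have hpos : 0 < Nat.gcd (dgcd n m i) (stdOrder n m i) := hg ▸ hc.dgcd_pos (i + 1)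
    rw [← hg]
    refine (Nat.coprime_div_gcd_div_gcd hpos).dvd_of_dvd_mul_right
      (n := stdOrder n m i / Nat.gcd (dgcd n m i) (stdOrder n m i)) ?_
    rw [← Nat.mul_div_assoc _ (Nat.gcd_dvd_right _ _)]
    exact Nat.div_dvd_div (Nat.gcd_dvd_left _ _) h2
  by_contra hne
  exact absurd (Nat.le_of_dvd (by omega) h3) (by omega)

lemma coeff_branchEval_C (hc : IsCharSeq S n g m) (q : ℂ[X]) (k : ℕ) :
    PowerSeries.coeff k (branchEval S n (C q)) =
    if n ∣ k then q.coeff (k / n) else 0 := by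
  have : branchEval S n (C q) = aeval ((PowerSeries.X : PowerSeries ℂ) ^ n) q := by
    change MvPolynomial.aeval _ (toMv (C q)) = _
    rw [aeval_toMv, eval₂_C]
    rfl
  rw [this, coeff_aeval_X_pow _ hc.n_pos]
  rfl

/-- A polynomial of degree less than `n / d_i` in `Y` is a combination of terms of at least the same
order along the branch of `S`, and its order is divisible by `d_i`. -/
theorem mem_span_expansionTerms (hc : IsCharSeq S n g m) {i : ℕ} (hi : i ≤ g) : ∀ P : ℂ[X][X],
    P.degree < (n / dgcd n m i : ℕ) →
      (∀ V : ℕ, (V : ℕ∞) ≤ (branchEval S n P).order →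
        P ∈ Submodule.span ℂ (expansionTerms S n m i V)) ∧
      (P ≠ 0 → ∃ o : ℕ, (branchEval S n P).order = o ∧ dgcd n m i ∣ o) := by
  induction i with
  | zero =>
    intro P hP
    rw [dgcd, Nat.div_self hc.n_pos] at hP
    obtain ⟨q, rfl⟩ : ∃ q, P = C q :=
      ⟨P.coeff 0, eq_C_of_degree_le_zero (Nat.WithBot.lt_one_iff_le_zero.mp hP)⟩
    have hco := hc.coeff_branchEval_C q
    refine ⟨fun V hV => ?_, fun hne => ?_⟩
    · have hq : C q = ∑ a ∈ q.support, q.coeff a • (C X ^ a : ℂ[X][X]) := by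
        conv_lhs => rw [q.as_sum_support, map_sum]
        refine Finset.sum_congr rfl fun a _ => ?_
        rw [← C_mul_X_pow_eq_monomial, ← smul_eq_C_mul, ← smul_C, C_pow]
      rw [hq]
      refine Submodule.sum_mem _ fun a ha => Submodule.smul_mem _ _
        (Submodule.subset_span ⟨a, 0, fun s hs => absurd hs (Nat.not_lt_zero s), by simp, ?_⟩)
      rw [Finset.sum_range_zero, add_zero]
      by_contra! hlt
      have h1 := hco (a * n)
      rw [if_pos (dvd_mul_left _ _), Nat.mul_div_cancel _ hc.n_pos,
        PowerSeries.coeff_of_lt_order _ (lt_of_lt_of_le (Nat.cast_lt.mpr hlt) hV)] at h1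
      exact mem_support_iff.mp ha h1.symm
    · have hne' : branchEval S n (C q) ≠ 0 := by
        intro h0
        apply hne
        rw [C_eq_zero]
        ext a
        have h1 := hco (a * n)
        rw [if_pos (dvd_mul_left _ _), Nat.mul_div_cancel _ hc.n_pos, h0, map_zero] at h1
        rw [← h1, coeff_zero]
      refine ⟨_, (PowerSeries.coe_toNat_order hne').symm, ?_⟩
      have h1 := (PowerSeries.order_eq_nat.mp (PowerSeries.coe_toNat_order hne').symm).1
      rw [hco] at h1
      by_contra hnd
      exact h1 (if_neg hnd)
  | succ i ih =>
    intro P hP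
    have hig : i < g := hi
    obtain ⟨hdeg, hmon⟩ := stdPoly_spec hc i
    obtain ⟨hb1, hb2⟩ := hc.order_branchEval_stdPoly hig
    set F := stdPoly S n m i
    set b := stdOrder n m i
    set e := dgcd n m i / dgcd n m (i + 1) with he
    have hne : n / dgcd n m (i + 1) = F.natDegree * e := by
      rw [hdeg, Nat.div_mul_div_comm (dgcd_dvd i) (dgcd_succ_dvd n m i), mul_comm (dgcd n m i),
        Nat.mul_div_mul_right _ _ (hc.dgcd_pos i)]
    rw [hne] at hP
    obtain ⟨c, hcdeg, hsum⟩ := exists_expansion hmon e P hP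
    rw [hdeg] at hcdeg
    have hih (δ : ℕ) := ih hig.le (c δ) (hcdeg δ)
    have hterm {δ : ℕ} (h0 : c δ ≠ 0) : ∃ o : ℕ, dgcd n m i ∣ o ∧
        (branchEval S n (c δ)).order = o ∧
        (branchEval S n (c δ * F ^ δ)).order = (o + δ * b : ℕ) := by
      obtain ⟨o, ho, hdo⟩ := (hih δ).2 h0
      refine ⟨o, hdo, ho, ?_⟩
      rw [map_mul, map_pow, PowerSeries.order_mul, PowerSeries.order_pow, ho, hb2]
      push_cast
      rw [nsmul_eq_mul]
    have hczero {δ : ℕ} (h : branchEval S n (c δ * F ^ δ) ≠ 0) : c δ ≠ 0 := by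
      rintro h0
      rw [h0, zero_mul, map_zero] at h
      exact h rfl
    -- The coefficients of the `F`-adic expansion have orders divisible by `d_i`, so its nonzero
    -- terms have distinct orders and each is at least the order of `P`.
    have hdist : ∀ a ∈ Finset.range e, ∀ a' ∈ Finset.range e,
        branchEval S n (c a * F ^ a) ≠ 0 → branchEval S n (c a' * F ^ a') ≠ 0 →
        (branchEval S n (c a * F ^ a)).order = (branchEval S n (c a' * F ^ a')).order →
        a = a' := by
      intro a ha a' ha' h1 h2 heq
      obtain ⟨o, ho, -, hoo⟩ := hterm (hczero h1)
      obtain ⟨o', ho', -, hoo'⟩ := hterm (hczero h2)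
      rw [hoo, hoo', Nat.cast_inj] at heq
      rcases le_total a a' with h | h
      · exact hc.eq_of_dvd_mul_stdOrder hig ho ho' (Finset.mem_range.mp ha') h heq
      · exact (hc.eq_of_dvd_mul_stdOrder hig ho' ho (Finset.mem_range.mp ha) h heq.symm).symm
    by_cases hall : ∀ a ∈ Finset.range e, branchEval S n (c a * F ^ a) = 0
    · have hP0 : P = 0 := by
        rw [hsum]
        refine Finset.sum_eq_zero fun a ha => ?_
        by_contra hne0
        have hca : c a ≠ 0 := fun h0 => hne0 (by rw [h0, zero_mul])
        obtain ⟨o, -, -, hoo⟩ := hterm hca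
        rw [hall a ha, PowerSeries.order_zero] at hoo
        exact ENat.natCast_ne_top _ hoo.symm
      exact ⟨fun V _ => by rw [hP0]; exact Submodule.zero_mem _, fun h => absurd hP0 h⟩
    · push Not at hall
      obtain ⟨a, ha, hfa, hord, hmin⟩ := exists_order_sum_eq hdist hall
      rw [← map_sum, ← hsum] at hord
      obtain ⟨o, ho, -, hoo⟩ := hterm (hczero hfa)
      refine ⟨fun V hV => ?_, fun _ => ⟨_, hord.trans hoo, ?_⟩⟩
      · rw [hsum]
        refine Submodule.sum_mem _ fun δ hδ => mul_pow_mem_span (Finset.mem_range.mp hδ) ?_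
        by_cases h0 : c δ = 0
        · rw [h0]; exact Submodule.zero_mem _
        · obtain ⟨o', -, ho', hoo'⟩ := hterm h0
          refine (hih δ).1 _ ?_
          have := hV.trans (hord.le.trans (hmin δ hδ))
          rw [hoo', Nat.cast_le] at this
          rw [ho', Nat.cast_le]
          change V - δ * b ≤ o'
          omega
      · refine dvd_add ((dgcd_succ_dvd n m i).trans ho) (Dvd.dvd.mul_left ?_ a)
        rw [← hc.gcd_stdOrder hig]
        exact Nat.gcd_dvd_right _ _

end IsCharSeq

end Expansion

/-! ### The standard family -/

section Family

open Polynomial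

variable {S : HahnSeries ℚ ℂ} {n g : ℕ} {m : ℕ → ℕ}

/-- `H_{i,j}`, as a polynomial in `Y` over `ℂ[x]`. -/
def stepPoly (S : HahnSeries ℚ ℂ) (n : ℕ) (m : ℕ → ℕ) (i : ℕ) : ℕ → ℂ[X][X]
  | 0 => factorPoly S n m i 0 - stdPoly S n m (i - 1) ^ (dgcd n m (i - 1) / dgcd n m i)
  | j + 1 => factorPoly S n m i (j + 1) - factorPoly S n m i j

/-- The family `H_{i,j}`. -/
def stepMv (S : HahnSeries ℚ ℂ) (n : ℕ) (m : ℕ → ℕ) (i j : ℕ) : MvPolynomial (Fin 2) ℂ :=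
  toMv (stepPoly S n m i j)

lemma sum_stepPoly (i t : ℕ) : ∑ j ∈ Finset.range (t + 1), stepPoly S n m i j =
    factorPoly S n m i t - stdPoly S n m (i - 1) ^ (dgcd n m (i - 1) / dgcd n m i) := by
  induction t with
  | zero => simp [stepPoly]
  | succ t ih => rw [Finset.sum_range_succ, ih, stepPoly]; ring

lemma pow_add_sum_stepMv (i t : ℕ) :
    toMv (stdPoly S n m (i - 1)) ^ (dgcd n m (i - 1) / dgcd n m i) +
      ∑ j ∈ Finset.range (t + 1), stepMv S n m i j = toMv (factorPoly S n m i t) := by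
  simp only [stepMv]
  rw [← map_sum, ← map_pow, ← map_add, sum_stepPoly, add_sub_cancel]

lemma normPoly_one_zero : normPoly 1 0 = X := by
  have h := (normPoly_spec one_pos (0 : ℂ[X])).1
  have h1 : (expand ℂ 1 : ℂ[X] →+* ℂ[X]) = RingHom.id _ := by
    ext <;> simp
  rw [h1, Polynomial.map_id] at h
  rw [h, conjProd, Finset.prod_congr rfl (g := fun _ => X) fun ζ _ => by simp [conjPoly],
    Finset.prod_const, card_nthRootsFinset_complex one_pos, pow_one]

/-- Divisibility of the exponents of a partial sum. -/
lemma IsCharSeq.dvd_of_le (hc : IsCharSeq S n g m) {i j : ℕ}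
    (h : (i < g ∧ j ≤ hZero n m (i + 1)) ∨ (i = g ∧ j = 0)) {k : ℕ}
    (hk : k ≤ m i + j * dgcd n m i) (h0 : S.coeff ((k : ℚ) / n) ≠ 0) : dgcd n m i ∣ k := by
  rcases h with ⟨h1, h2⟩ | ⟨rfl, -⟩
  · have h3 := hc.m_eq h1
    have h4 := hc.mod_pos h1
    have h5 : j * dgcd n m i ≤ hZero n m (i + 1) * dgcd n m i := Nat.mul_le_mul_right _ h2
    exact hc.dvd_of_lt h1 (by omega) h0
  · rw [hc.last]; exact one_dvd k

/-- A term before `m_1` would force the leading exponent of `S` to have numerator divisible by `n`,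
so to be an integer. -/
lemma IsCharSeq.coeff_eq_zero_of_lt (hc : IsCharSeq S n g m) (hmod : IsModified S) {k : ℕ}
    (hk : k < m 1) : S.coeff ((k : ℚ) / n) = 0 := by
  by_contra h0
  have hS : S ≠ 0 := by
    rintro rfl
    simp at h0
  have hle := HahnSeries.orderTop_le_of_coeff_ne_zero h0
  have hord := HahnSeries.coeff_order_eq_zero.not.mpr hS
  rw [← HahnSeries.order_eq_orderTop_of_ne_zero hS] at hle
  obtain ⟨l, -, hl⟩ := hc.exists_nat_of_coeff_ne hord
  have hn : (0 : ℚ) < n := by exact_mod_cast hc.n_pos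
  rw [hl] at hle hord
  have hlk : l ≤ k := by
    have := WithTop.coe_le_coe.mp hle
    rw [div_le_div_iff_of_pos_right hn] at this
    exact_mod_cast this
  obtain ⟨z, rfl⟩ := hc.dvd_of_lt hc.pos (hlk.trans_lt hk) hord
  refine hmod z ?_
  rw [← HahnSeries.order_eq_orderTop_of_ne_zero hS, hl, dgcd]
  congr 1
  push_cast
  field_simp

/-- The partial sum before `m_1` is zero, so its norm is `y`. This starts the recursion of
`standardF`, and makes the factor `y^β` of a term the power of `F_0`. -/
lemma IsCharSeq.stdPoly_zero (hc : IsCharSeq S n g m) (hmod : IsModified S) :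
    stdPoly S n m 0 = X := by
  have h : truncPoly S n (dgcd n m 0) (m 0 + hZero n m (0 + 1) * dgcd n m 0) = 0 := by
    ext k
    rw [coeff_truncPoly S n (hc.dgcd_pos 0), coeff_zero]
    split_ifs with hk
    · have h1 := hc.m_eq hc.pos
      have h2 := hc.mod_pos hc.pos
      have h3 : k * dgcd n m 0 < m (0 + 1) := by omega
      exact hc.coeff_eq_zero_of_lt hmod h3
    · rfl
  rw [stdPoly, factorPoly, h, dgcd, Nat.div_self hc.n_pos, normPoly_one_zero]

lemma IsCharSeq.standardF_stepMv (hc : IsCharSeq S n g m) (hmod : IsModified S) (i : ℕ) :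
    standardF n m (stepMv S n m) i = toMv (stdPoly S n m i) := by
  induction i with
  | zero => rw [standardF, hc.stdPoly_zero hmod, toMv_X]
  | succ i ih => rw [standardF, ih]; exact pow_add_sum_stepMv (i + 1) _

lemma IsCharSeq.nestedF_stepMv (hc : IsCharSeq S n g m) (hmod : IsModified S) (i j : ℕ) :
    nestedF n m (stepMv S n m) i j = toMv (factorPoly S n m i j) := by
  rw [nestedF, hc.standardF_stepMv hmod, pow_add_sum_stepMv]

/-- The order of `ζ` divides `n / d_i` and the `m_r / d_i`, whose greatest common divisor is `1`.
Applied to a `ζ` fixing a partial sum, this separates its conjugates. -/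
lemma IsCharSeq.pow_eq_one (hc : IsCharSeq S n g m) {i : ℕ} {ζ : ℂ}
    (h0 : ζ ^ (n / dgcd n m i) = 1)
    (h : ∀ r, 1 ≤ r → r ≤ i → ζ ^ (m r / dgcd n m i) = 1) : ζ = 1 := by
  have key : ∀ r ≤ i, ζ ^ (dgcd n m r / dgcd n m i) = 1 := by
    intro r
    induction r with
    | zero => exact fun _ => h0
    | succ r ih =>
      intro hr
      rw [dgcd, ← Nat.gcd_div (dgcd_dvd_of_le (by omega)) (dgcd_dvd_m (by omega) hr),
        ← orderOf_dvd_iff_pow_eq_one]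
      exact Nat.dvd_gcd (orderOf_dvd_of_pow_eq_one (ih (by omega)))
        (orderOf_dvd_of_pow_eq_one (h (r + 1) (by omega) hr))
  have := key i le_rfl
  rwa [Nat.div_self (hc.dgcd_pos i), pow_one] at this

lemma IsCharSeq.irreducible_factorPoly (hc : IsCharSeq S n g m) {i : ℕ} (hi : i ≤ g) (j : ℕ) :
    Irreducible (toMv (factorPoly S n m i j) : MvPowerSeries (Fin 2) ℂ) := by
  have hd := hc.dgcd_pos i
  refine irreducible_normPoly (Nat.div_pos (Nat.le_of_dvd hc.n_pos (dgcd_dvd i)) hd) ?_ ?_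
  · rw [coeff_truncPoly S n hd, if_pos (by omega)]
    by_contra h0
    have h1 := hc.n_le_of_coeff_ne h0
    have h2 := hc.n_pos
    omega
  · intro ζ hζ hconj
    refine hc.pow_eq_one hζ fun r hr hri => ?_
    have h1 := congrArg (fun q => q.coeff (m r / dgcd n m i)) hconj
    have hdm : dgcd n m i ∣ m r := dgcd_dvd_m hr hri
    have hle : m r ≤ m i + j * dgcd n m i := (hc.m_mono hri hi).trans (Nat.le_add_right _ _)
    simp only [coeff_conjPoly, coeff_truncPoly S n hd, Nat.div_mul_cancel hdm, if_pos hle] at h1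
    have hs := hc.coeff_ne r hr (by omega)
    exact mul_left_cancel₀ hs (h1.trans (mul_one _).symm)

/-! ### The partial sums of `S` as roots of `F_{i,j}`, and their polydromy orders. -/

lemma coeff_partialSum (S : HahnSeries ℚ ℂ) (l q : ℚ) :
    (partialSum S l).coeff q = if q ≤ l then S.coeff q else 0 := rfl

lemma IsCharSeq.polydromy_partialSum (hc : IsCharSeq S n g m) {i j : ℕ}
    (h : (i < g ∧ j ≤ hZero n m (i + 1)) ∨ (i = g ∧ j = 0)) :
    polydromy (partialSum S (((m i + j * dgcd n m i : ℕ) : ℚ) / n)) = n / dgcd n m i := by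
  have hd := hc.dgcd_pos i
  have hn : (0 : ℚ) < n := by exact_mod_cast hc.n_pos
  have hN : 0 < n / dgcd n m i := Nat.div_pos (Nat.le_of_dvd hc.n_pos (dgcd_dvd i)) hd
  set E := m i + j * dgcd n m i with hE
  have hmem : n / dgcd n m i ∈ {N : ℕ | 0 < N ∧ ∀ q : ℚ,
      (partialSum S ((E : ℚ) / n)).coeff q ≠ 0 → ∃ z : ℤ, q = (z : ℚ) / N} := by
    refine ⟨hN, fun q hq => ?_⟩
    rw [coeff_partialSum] at hq
    obtain ⟨h1, h2⟩ := ite_ne_right_iff.mp hq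
    obtain ⟨k, -, rfl⟩ := hc.exists_nat_of_coeff_ne h2
    rw [div_le_div_iff_of_pos_right hn, Nat.cast_le] at h1
    obtain ⟨c, rfl⟩ := hc.dvd_of_le h h1 h2
    obtain ⟨N, hNn⟩ := dgcd_dvd (n := n) (m := m) i
    refine ⟨c, ?_⟩
    have hd' : (dgcd n m i : ℚ) ≠ 0 := by exact_mod_cast hd.ne'
    conv_rhs => rw [Nat.cast_div (dgcd_dvd i) hd']
    push_cast
    rw [div_div_eq_mul_div, mul_comm]
  refine le_antisymm (Nat.sInf_le hmem) (le_csInf ⟨_, hmem⟩ ?_)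
  rintro n' ⟨hn', hall⟩
  have hig : i ≤ g := by omega
  -- If `n'` is a common denominator, `n` divides each `m_r n'` with `1 ≤ r ≤ i`, hence `d_i n'`; so
  -- `n / d_i` divides `n'`.
  have key : ∀ r ≤ i, n ∣ dgcd n m r * n' := by
    intro r
    induction r with
    | zero => exact fun _ => dvd_mul_right n n'
    | succ r ih =>
      intro hr
      rw [dgcd, ← Nat.gcd_mul_right]
      refine Nat.dvd_gcd (ih (by omega)) ?_
      have hle : m (r + 1) ≤ E := (hc.m_mono hr hig).trans (Nat.le_add_right _ _)
      obtain ⟨z, hz⟩ := hall ((m (r + 1) : ℚ) / n) (by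
        rw [coeff_partialSum, if_pos]
        · exact hc.coeff_ne _ (by omega) (by omega)
        · rw [div_le_div_iff_of_pos_right hn, Nat.cast_le]; exact hle)
      have hn'' : (n' : ℚ) ≠ 0 := by exact_mod_cast hn'.ne'
      rw [div_eq_div_iff hn.ne' hn''] at hz
      have hz' : ((m (r + 1) * n' : ℕ) : ℤ) = z * n := by exact_mod_cast hz
      exact Int.natCast_dvd_natCast.mp ⟨z, by rw [hz', mul_comm]⟩
  have h1 := key i le_rfl
  obtain ⟨N, hNn⟩ := dgcd_dvd (n := n) (m := m) i
  have h2 : n / dgcd n m i = N := Nat.div_eq_of_eq_mul_right hd hNn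
  rw [h2]
  refine Nat.le_of_dvd hn' ?_
  have h3 : dgcd n m i * N ∣ dgcd n m i * n' := hNn ▸ h1
  exact Nat.dvd_of_mul_dvd_mul_left hd h3

lemma IsCharSeq.uniformized_partialSum (hc : IsCharSeq S n g m) (i E : ℕ) :
    uniformized (partialSum S ((E : ℚ) / n)) (n / dgcd n m i) =
      (truncPoly S n (dgcd n m i) E : PowerSeries ℂ) := by
  have hd := hc.dgcd_pos i
  have hn : (0 : ℚ) < n := by exact_mod_cast hc.n_pos
  ext k
  have hk : (k : ℚ) / ((n / dgcd n m i : ℕ) : ℚ) = ((k * dgcd n m i : ℕ) : ℚ) / n := by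
    rw [Nat.cast_div (dgcd_dvd i) (by exact_mod_cast hd.ne'), div_div_eq_mul_div, Nat.cast_mul]
  rw [uniformized, PowerSeries.coeff_mk, coeff_partialSum, Polynomial.coeff_coe,
    coeff_truncPoly S n hd, hk]
  simp only [div_le_div_iff_of_pos_right hn, Nat.cast_le]

lemma IsCharSeq.isYRoot_partialSum (hc : IsCharSeq S n g m) {i j : ℕ}
    (h : (i < g ∧ j ≤ hZero n m (i + 1)) ∨ (i = g ∧ j = 0)) :
    IsYRoot (toMv (factorPoly S n m i j) : MvPowerSeries (Fin 2) ℂ)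
      (partialSum S (((m i + j * dgcd n m i : ℕ) : ℚ) / n)) := by
  constructor
  · obtain ⟨N, hN, hall⟩ := hc.puiseux
    refine ⟨N, hN, fun q hq => hall q ?_⟩
    rw [coeff_partialSum] at hq
    exact (ite_ne_right_iff.mp hq).2
  · rw [hc.polydromy_partialSum h, hc.uniformized_partialSum]
    exact evalAt_normPoly_self
      (Nat.div_pos (Nat.le_of_dvd hc.n_pos (dgcd_dvd i)) (hc.dgcd_pos i)) _

lemma partialSum_partialSum (S : HahnSeries ℚ ℂ) (l : ℚ) :
    partialSum (partialSum S l) l = partialSum S l := by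
  ext q
  rw [coeff_partialSum, coeff_partialSum]
  split_ifs <;> rfl

lemma factorPoly_spec (hc : IsCharSeq S n g m) (i j : ℕ) :
    (factorPoly S n m i j).natDegree = n / dgcd n m i ∧ (factorPoly S n m i j).Monic :=
  (normPoly_spec (Nat.div_pos (Nat.le_of_dvd hc.n_pos (dgcd_dvd i)) (hc.dgcd_pos i)) _).2

lemma degree_sub_lt_of_monic {A : Type*} [CommRing A] [Nontrivial A] {P Q : A[X]} {N : ℕ}
    (hP : P.natDegree = N ∧ P.Monic) (hQ : Q.natDegree = N ∧ Q.Monic) : (P - Q).degree < N := by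
  have h1 := degree_eq_natDegree hP.2.ne_zero
  have h2 := degree_eq_natDegree hQ.2.ne_zero
  rw [hP.1] at h1
  rw [hQ.1] at h2
  rw [← h1]
  exact degree_sub_lt_left (h1.trans h2.symm) hP.2.ne_zero (by rw [hP.2.leadingCoeff, hQ.2.leadingCoeff])

lemma le_order_sub {V : ℕ} {x y : PowerSeries ℂ} (hx : (V : ℕ∞) ≤ x.order)
    (hy : (V : ℕ∞) ≤ y.order) : (V : ℕ∞) ≤ (x - y).order := by
  refine PowerSeries.le_order _ _ fun k hk => ?_
  rw [map_sub, PowerSeries.coeff_of_lt_order k (hk.trans_le hx),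
    PowerSeries.coeff_of_lt_order k (hk.trans_le hy), sub_zero]

/-- In the difference the leading terms in `y` cancel, and both members have order at least `V`
along `S`: `F_{i,j-1}` already agrees with `S` strictly below `m_i + j d_i`, and for `j = 0` the
power of `F_{i-1}` has order exactly `V`. -/
lemma IsCharSeq.stepPoly_mem_span (hc : IsCharSeq S n g m) {i j : ℕ} (hi : 1 ≤ i)
    (h : (i < g ∧ j ≤ hZero n m (i + 1)) ∨ (i = g ∧ j = 0)) :
    ∃ V : ℕ, dgcd n m i * V = contactSum n m i + j * dgcd n m i ^ 2 ∧
      stepPoly S n m i j ∈ Submodule.span ℂ (expansionTerms S n m i V) := by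
  have hd := hc.dgcd_pos i
  obtain ⟨V, hV, hle⟩ := hc.exists_le_order_factorPoly h (Nat.le_succ j)
  rw [evalAt_branchParam] at hle
  refine ⟨V, hV, (hc.mem_span_expansionTerms (show i ≤ g by omega) _ ?_).1 V ?_⟩
  · cases j with
    | zero =>
      refine degree_sub_lt_of_monic (factorPoly_spec hc i 0) ⟨?_, (stdPoly_spec hc _).2.pow _⟩
      obtain ⟨i, rfl⟩ := Nat.exists_eq_add_of_le' hi
      rw [(stdPoly_spec hc _).2.natDegree_pow, (stdPoly_spec hc _).1, Nat.add_sub_cancel, mul_comm,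
        Nat.div_mul_div_comm (dgcd_dvd i) (dgcd_succ_dvd n m i), mul_comm (dgcd n m i),
        Nat.mul_div_mul_right _ _ (hc.dgcd_pos i)]
    | succ j => exact degree_sub_lt_of_monic (factorPoly_spec hc i _) (factorPoly_spec hc i _)
  · cases j with
    | zero =>
      rw [stepPoly, map_sub]
      refine le_order_sub hle ?_
      obtain ⟨i, rfl⟩ := Nat.exists_eq_add_of_le' hi
      obtain ⟨h1, h2⟩ := hc.order_branchEval_stdPoly (show i < g by omega)
      rw [Nat.add_sub_cancel, map_pow, PowerSeries.order_pow, h2, nsmul_eq_mul]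
      have : V = dgcd n m i / dgcd n m (i + 1) * stdOrder n m i := by
        refine Nat.eq_of_mul_eq_mul_left hd ?_
        rw [hV, ← mul_assoc, Nat.mul_div_cancel' (dgcd_succ_dvd n m i), h1]
        simp
      rw [this]
      push_cast
      exact le_rfl
    | succ j =>
      rw [stepPoly, map_sub]
      refine le_order_sub hle ?_
      obtain ⟨V', hV', hle'⟩ := hc.exists_le_order_factorPoly h (le_refl (j + 1))
      rw [evalAt_branchParam] at hle'
      rwa [← Nat.eq_of_mul_eq_mul_left hd (hV'.trans hV.symm)]

end Family

/-! ### Admissibility of the terms -/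

section Admissible

open Polynomial

variable {S : HahnSeries ℚ ℂ} {n g : ℕ} {m : ℕ → ℕ}

lemma contactSum_mono {r l : ℕ} (h : r ≤ l) : contactSum n m r ≤ contactSum n m l :=
  Finset.sum_le_sum_of_subset (Finset.range_mono h)

lemma sum_ite_inv_sub_inv_le {d : ℕ → ℚ} (hpos : ∀ i, 0 < d i) (hd : ∀ i, d (i + 1) ≤ d i)
    (t i : ℕ) : ∑ s ∈ Finset.range i, (if t ≤ s then 1 / d (s + 1) - 1 / d s else 0) ≤ 1 / d i := by
  induction i with
  | zero => simpa using (hpos 0).le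
  | succ i ih =>
    rw [Finset.sum_range_succ]
    split_ifs with h
    · linarith
    · have := one_div_le_one_div_of_le (hpos (i + 1)) (hd i)
      linarith

/-- The numerical inequality between the orders of a term along the branch of `S` and along a
curvette. -/
lemma IsCharSeq.le_mul_order (hc : IsCharSeq S n g m) {i j l V α : ℕ} {δ o : ℕ → ℕ}
    (hi : i ≤ g) (hV : dgcd n m i * V = contactSum n m i + j * dgcd n m i ^ 2)
    (hδ : ∀ s < i, δ s < dgcd n m s / dgcd n m (s + 1))
    (hle : V ≤ α * n + ∑ s ∈ Finset.range i, δ s * stdOrder n m s)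
    (ho : ∀ s < i, contactSum n m (min (s + 1) l) ≤ dgcd n m s * o s) :
    (if l ≤ i then contactSum n m l else contactSum n m i + j * dgcd n m i ^ 2) ≤
      dgcd n m i * (α * n + ∑ s ∈ Finset.range i, δ s * o s) := by
  split_ifs with hli
  · let d : ℕ → ℚ := fun s => dgcd n m s
    let A : ℕ → ℚ := fun s => contactSum n m s
    have hd (s : ℕ) : 0 < d s := Nat.cast_pos.mpr (hc.dgcd_pos s)
    have hd1 (s : ℕ) : d (s + 1) ≤ d s := by
      simp only [d, Nat.cast_le]
      exact Nat.le_of_dvd (hc.dgcd_pos s) (dgcd_succ_dvd n m s)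
    have hA (s : ℕ) : A s ≤ A (s + 1) := by
      simp only [A, Nat.cast_le]
      exact contactSum_mono (Nat.le_succ s)
    -- `Q t` bounds from below the order of the term along a branch agreeing with `S` below `m_t`,
    -- and `Q i` is its order along `S`. As `δ_s / d_s ≤ 1/d_{s+1} - 1/d_s` telescopes, passing from
    -- `t + 1` to `t` lowers `Q` by at most `(A_{t+1} - A_t)/d_i`; so `A_t / d_i ≤ Q t` descends
    -- from `t = i` to `t = l`.
    let Q : ℕ → ℚ := fun t =>
      α * n + ∑ s ∈ Finset.range i, (δ s : ℚ) * (A (min (s + 1) t) / d s)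
    have hδ' (s : ℕ) (hs : s < i) : (δ s : ℚ) / d s ≤ 1 / d (s + 1) - 1 / d s := by
      have h1 := hδ s hs
      obtain ⟨e, he⟩ := dgcd_succ_dvd n m s
      have hpos := hc.dgcd_pos (s + 1)
      rw [he, Nat.mul_div_cancel_left e hpos] at h1
      have h2 : (δ s : ℚ) + 1 ≤ e := by exact_mod_cast h1
      have h3 : d s = d (s + 1) * e := by simp only [d]; exact_mod_cast he
      have h4 : 1 / d (s + 1) = e / d s := by
        rw [h3]
        have : (e : ℚ) ≠ 0 := by linarith [(Nat.cast_nonneg (δ s) : (0 : ℚ) ≤ δ s)]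
        have := (hd (s + 1)).ne'
        field_simp
      rw [h4, ← sub_div]
      exact div_le_div_of_nonneg_right (by linarith) (hd s).le
    have hstep (t : ℕ) : Q (t + 1) - Q t ≤ (A (t + 1) - A t) * (1 / d i) := by
      have h1 : Q (t + 1) - Q t = ∑ s ∈ Finset.range i,
          (A (t + 1) - A t) * (if t ≤ s then (δ s : ℚ) / d s else 0) := by
        simp only [Q]
        rw [add_sub_add_left_eq_sub, ← Finset.sum_sub_distrib]
        refine Finset.sum_congr rfl fun s _ => ?_
        split_ifs with h
        · rw [min_eq_right (by omega), min_eq_right (by omega)]; ring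
        · rw [min_eq_left (by omega), min_eq_left (by omega)]; ring
      rw [h1, ← Finset.mul_sum]
      refine mul_le_mul_of_nonneg_left ?_ (sub_nonneg.mpr (hA t))
      refine le_trans (Finset.sum_le_sum fun s hs => ?_) (sum_ite_inv_sub_inv_le hd hd1 t i)
      split_ifs
      · exact hδ' s (Finset.mem_range.mp hs)
      · exact le_rfl
    have hQi : A i / d i ≤ Q i := by
      have h1 : A i / d i ≤ V := by
        rw [div_le_iff₀ (hd i)]
        have : contactSum n m i ≤ V * dgcd n m i := by rw [mul_comm, hV]; omega
        simp only [A, d]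
        exact_mod_cast this
      refine h1.trans ?_
      have h2 : (V : ℚ) ≤ α * n + ∑ s ∈ Finset.range i, (δ s : ℚ) * stdOrder n m s := by
        exact_mod_cast hle
      refine h2.trans (add_le_add_right (Finset.sum_le_sum fun s hs => ?_) _)
      have hs' := Finset.mem_range.mp hs
      refine mul_le_mul_of_nonneg_left ?_ (Nat.cast_nonneg _)
      rw [min_eq_left (by omega), le_div_iff₀ (hd s)]
      have := (hc.order_branchEval_stdPoly (show s < g by omega)).1
      rw [mul_comm] at this
      simp only [A, d]
      exact_mod_cast this.le
    have hQl : A l / d i ≤ Q l := by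
      refine Nat.decreasingInduction' (m := l) (n := i) (P := fun t => A t / d i ≤ Q t)
        (fun t _ _ ht => ?_) hli hQi
      have h1 := hstep t
      have h2 : A t / d i = A (t + 1) / d i - (A (t + 1) - A t) * (1 / d i) := by ring
      rw [h2]
      linarith
    rw [div_le_iff₀ (hd i)] at hQl
    have hfin : Q l ≤ α * n + ∑ s ∈ Finset.range i, (δ s : ℚ) * o s := by
      refine add_le_add_right (Finset.sum_le_sum fun s hs => ?_) _
      refine mul_le_mul_of_nonneg_left ?_ (Nat.cast_nonneg _)
      rw [div_le_iff₀ (hd s), mul_comm]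
      simp only [A, d]
      exact_mod_cast ho s (Finset.mem_range.mp hs)
    have h1 := hQl.trans (mul_le_mul_of_nonneg_right hfin (hd i).le)
    rw [mul_comm]
    simp only [A, d] at h1
    exact_mod_cast h1
  -- For `l > i` the curvette agrees with `S` far enough that each `F_s` with `s < i` has at least
  -- its order along `S`.
  · rw [← hV]
    refine Nat.mul_le_mul_left _ (hle.trans (Nat.add_le_add_left (Finset.sum_le_sum fun s hs => ?_)
      _))
    have hs' := Finset.mem_range.mp hs
    refine Nat.mul_le_mul_left _ ?_
    refine Nat.le_of_mul_le_mul_left ?_ (hc.dgcd_pos s)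
    have := ho s hs'
    rw [min_eq_left (by omega)] at this
    rwa [(hc.order_branchEval_stdPoly (show s < g by omega)).1]

lemma Xrow_eq_zero {k i : ℕ} (p : ℕ → Direction) (h : k < i) : Xrow k p i = 0 := by
  funext c
  rw [Xrow, dif_neg (by omega)]
  rfl

/-- The order of a term along a curvette. -/
lemma IsCharSeq.order_term (hc : IsCharSeq S n g m) {L : Type} [Field L] [Algebra ℂ L] {ξ : L}
    (hξ : Transcendental ℂ ξ) {i l : ℕ} (hi : i ≤ g) (hl : l ≤ g) (α : ℕ) (δ : ℕ → ℕ) :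
    ∃ o : ℕ → ℕ, (∀ s < i, contactSum n m (min (s + 1) l) ≤ dgcd n m s * o s) ∧
      (evalAt (genericParam S n (m l) ξ) (toMv (C X ^ α * ∏ s ∈ Finset.range i,
        stdPoly S n m s ^ δ s) : MvPowerSeries (Fin 2) ℂ)).order =
        ((α * n + ∑ s ∈ Finset.range i, δ s * o s : ℕ) : ℕ∞) := by
  have hne (s : ℕ) : evalAt (genericParam S n (m l) ξ)
      (toMv (stdPoly S n m s) : MvPowerSeries (Fin 2) ℂ) ≠ 0 :=
    hc.evalAt_genericParam_factorPoly_ne_zero hξ s (hZero n m (s + 1)) (m l)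
  refine ⟨fun s => (evalAt (genericParam S n (m l) ξ)
    (toMv (stdPoly S n m s) : MvPowerSeries (Fin 2) ℂ)).order.toNat, fun s hs => ?_, ?_⟩
  · obtain ⟨B, hB, hle⟩ := hc.exists_le_order_stdPoly (L := L) (show s < g by omega)
      (show min (s + 1) l ≤ s + 1 by omega)
      (y := (genericParam S n (m l) ξ).2) (fun k hk => by
        have hk' : k < m l := hk.trans_le (hc.m_mono (by omega) hl)
        rw [genericParam, map_add, ext, PowerSeries.coeff_map, Polynomial.coeff_coe,
          PowerSeries.coeff_trunc, if_pos hk', PowerSeries.coeff_X_pow_mul', if_neg (by omega),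
          add_zero, uniformized, PowerSeries.coeff_mk])
    rw [← hB]
    refine Nat.mul_le_mul_left _ ?_
    dsimp only
    rw [← Nat.cast_le (α := ℕ∞), PowerSeries.coe_toNat_order (hne s)]
    exact hle
  · rw [evalAt_coe, map_mul, map_pow, toMv_C_X, map_mul, map_pow, MvPolynomial.aeval_X, map_prod,
      map_prod, PowerSeries.order_mul, PowerSeries.order_pow, PowerSeries.order_prod]
    push_cast
    congr 1
    · change α • ((PowerSeries.X : PowerSeries L) ^ n).order = _
      rw [PowerSeries.order_X_pow, nsmul_eq_mul]
    · refine Finset.sum_congr rfl fun s _ => ?_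
      rw [map_pow, map_pow, PowerSeries.order_pow, nsmul_eq_mul, ← evalAt_coe,
        PowerSeries.coe_toNat_order (hne s)]

lemma IsCharSeq.toMv_term (hc : IsCharSeq S n g m) (hmod : IsModified S) {i : ℕ} (hi : 1 ≤ i)
    (α : ℕ) (δ : ℕ → ℕ) :
    toMv (C X ^ α * ∏ s ∈ Finset.range i, stdPoly S n m s ^ δ s) =
      factorTerm n m (stepMv S n m) i α (δ 0) δ := by
  have hr : Finset.range i = insert 0 (Finset.Icc 1 (i - 1)) := by
    ext s
    simp only [Finset.mem_range, Finset.mem_insert, Finset.mem_Icc]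
    omega
  rw [hr, Finset.prod_insert (by simp), hc.stdPoly_zero hmod, map_mul, map_mul, map_pow, map_pow,
    toMv_C_X, toMv_X, map_prod, factorTerm, mul_assoc]
  congr 2
  refine Finset.prod_congr rfl fun s _ => ?_
  rw [map_pow, hc.nestedF_stepMv hmod]
  rfl

/-- `toMv` as a linear map. -/
def toMvLinear : ℂ[X][X] →ₗ[ℂ] MvPolynomial (Fin 2) ℂ where
  toFun := toMv
  map_add' := map_add toMv
  map_smul' a P := by
    have : a • P = C (C a) * P := by
      ext k l
      simp
    rw [this, map_mul, toMv_C_C, RingHom.id_apply, MvPolynomial.smul_eq_C_mul]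

/-- Multiplied by `d_i d_l`, admissibility reads off the two intersection formulas
`Xrow_dotProduct_Xrow` and `ordVec_dotProduct_Xrow`, and becomes `le_mul_order`. -/
theorem IsCharSeq.stepMv_mem_span (hc : IsCharSeq S n g m) (hmod : IsModified S) {k : ℕ}
    {p : ℕ → Direction} (hφ : CanLift p (branchParam S n) k) {i j : ℕ} (hi : 1 ≤ i)
    (h : (i < g ∧ j ≤ hZero n m (i + 1)) ∨ (i = g ∧ j = 0)) :
    stepMv S n m i j ∈ Submodule.span ℂ (admissibleTerms n g m k p (stepMv S n m) i j) := by
  have hig : i ≤ g := by omega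
  -- The rational function field supplies the transcendental coefficient of the curvettes.
  have hξ : Transcendental ℂ (RatFunc.X : RatFunc ℂ) := RatFunc.transcendental_X
  obtain ⟨V, hV, hmem⟩ := hc.stepPoly_mem_span hi h
  have hle : Submodule.span ℂ (expansionTerms S n m i V) ≤
      (Submodule.span ℂ (admissibleTerms n g m k p (stepMv S n m) i j)).comap toMvLinear := by
    rw [Submodule.span_le]
    rintro T ⟨α, δ, h1, rfl, h3⟩
    rw [SetLike.mem_coe, Submodule.mem_comap]
    refine Submodule.subset_span ⟨α, δ 0, δ, hc.toMv_term hmod hi α δ, fun l hl1 hl => ?_⟩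
    -- Rows of index beyond `k` are zero by the convention in `Xrow`: here both sides vanish, and
    -- below, when `γ_i + j` exceeds `k`, the left side vanishes while the right side is
    -- nonnegative.
    by_cases hlk : k < gammaIdx n m l
    · rw [Xrow_eq_zero p hlk, dotProduct_zero, dotProduct_zero]
    obtain ⟨o, ho1, ho2⟩ := hc.order_term hξ hig hl α δ
    have hne : evalAt (genericParam S n (m l) (RatFunc.X : RatFunc ℂ))
        (toMv (C X ^ α * ∏ s ∈ Finset.range i, stdPoly S n m s ^ δ s) :
          MvPowerSeries (Fin 2) ℂ) ≠ 0 := by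
      rw [Ne, ← PowerSeries.order_eq_top, ho2]
      exact ENat.natCast_ne_top _
    have hord := hc.ordVec_dotProduct_Xrow hφ hξ hl1 hl (not_lt.mp hlk) hne
    rw [ho2, ENat.toNat_natCast] at hord
    have hdl : (0 : ℤ) < dgcd n m l := by exact_mod_cast hc.dgcd_pos l
    have hdi : (0 : ℤ) < dgcd n m i := by exact_mod_cast hc.dgcd_pos i
    change _ ≤ ordVec k p (toMv (C X ^ α * ∏ s ∈ Finset.range i, stdPoly S n m s ^ δ s) :
          MvPowerSeries (Fin 2) ℂ) ⬝ᵥ _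
    by_cases hik : k < gammaIdx n m i + j
    · rw [Xrow_eq_zero p hik, zero_dotProduct]
      refine (mul_nonneg_iff_of_pos_left hdl).mp ?_
      rw [hord]
      exact Int.natCast_nonneg _
    have hdot := hc.Xrow_dotProduct_Xrow hφ hξ (i := i) (j := j) (by omega) (not_lt.mp hik) hl1 hl
      (not_lt.mp hlk)
    have hnum := hc.le_mul_order (l := l) hig hV h1 h3 ho1
    refine le_of_mul_le_mul_left ?_ (mul_pos hdi hdl)
    rw [hdot, mul_assoc, hord]
    have : ((if l ≤ i then contactSum n m l else contactSum n m i + j * dgcd n m i ^ 2 : ℕ) : ℤ) ≤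
        ((dgcd n m i * (α * n + ∑ s ∈ Finset.range i, δ s * o s) : ℕ) : ℤ) := Nat.cast_le.mpr hnum
    push_cast at this ⊢
    exact this
  exact hle hmem

/-- The family `H_{i,j}` of a modified Puiseux series is a family of standard factors. -/
theorem IsCharSeq.isStandardFamily (hc : IsCharSeq S n g m) (hmod : IsModified S) {k : ℕ}
    {p : ℕ → Direction} (hφ : CanLift p (branchParam S n) k) :
    IsStandardFamily S n g m k p (stepMv S n m) := by
  intro i j hij
  have hpos := hc.pos
  have h : 1 ≤ i ∧ ((i < g ∧ j ≤ hZero n m (i + 1)) ∨ (i = g ∧ j = 0)) := by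
    rcases hij with h | h
    · exact ⟨h.1, Or.inl h.2⟩
    · exact ⟨h.1 ▸ hpos, Or.inr h⟩
  rw [hc.nestedF_stepMv hmod]
  exact ⟨hc.irreducible_factorPoly (by omega) j,
    ⟨_, hc.isYRoot_partialSum h.2, partialSum_partialSum _ _, hc.polydromy_partialSum h.2⟩,
    hc.stepMv_mem_span hmod hφ h.1 h.2⟩

end Admissible

end PlaneBranch

end

theorem mainTheorem4
    -- the irreducible germ `f = 0`, with a modified Puiseux series `S` as a `y`-root
    (f : MvPowerSeries (Fin 2) ℂ) (hf : Irreducible f)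
    (S : HahnSeries ℚ ℂ) (hS : IsYRoot f S) (hmod : IsModified S)
    -- the characteristic sequence `(n; m 1, …, m g)` of `S`
    (n g : ℕ) (m : ℕ → ℕ) (hchar : IsCharSeq S n g m)
    -- the standard resolution of the germ, with centres `q_1, …, q_k`
    (k : ℕ) (p : ℕ → Direction) (hres : IsStandardResolution f k p) :
    ∃ H : ℕ → ℕ → MvPolynomial (Fin 2) ℂ,
      (∀ i j, ((1 ≤ i ∧ i < g ∧ j ≤ hZero n m (i + 1)) ∨ (i = g ∧ j = 0)) →
        Irreducible (nestedF n m H i j : MvPowerSeries (Fin 2) ℂ) ∧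
        (∃ T : HahnSeries ℚ ℂ, IsYRoot (nestedF n m H i j : MvPowerSeries (Fin 2) ℂ) T ∧
          partialSum T (((m i + j * dgcd n m i : ℕ) : ℚ) / n) =
            partialSum S (((m i + j * dgcd n m i : ℕ) : ℚ) / n) ∧
          polydromy T = n / dgcd n m i) ∧
        H i j ∈ Submodule.span ℂ (admissibleTerms n g m k p H i j)) ∧
      IsSetOfStandardFactors S n g m k p (fun i => nestedF n m H i (hZero n m (i + 1))) := by
  have hev : evalAt (branchParam S n) f = 0 := hchar.polydromy_eq ▸ hS.2
  -- The branch of `S` lies on the irreducible germ, so it passes through all the centres of the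
  -- resolution.
  have hφ : CanLift p (branchParam S n) k := canLift_of_evalAt_eq_zero
    hchar.isCentered_branchParam branchParam_ne_zero hf hev hres.passes
  have hfam := hchar.isStandardFamily hmod hφ
  exact ⟨stepMv S n m, hfam, stepMv S n m, hfam, fun _ _ _ => rfl⟩
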